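/- Let $\nu,\phi_0,\phi_1,\sigma_0^2>0$ and put $\sigma_1^2=\sigma_0^2\phi_0^{2\nu}/\phi_1^{2\nu}$. Let $D\subset\mathbb R^d$ be bounded and, for $j=0,1$, let $P_j$ be the probability measure under which $y=(y(s))_{s\in D}$ is a centred Gaussian process with Matérn covariance $$K_{\theta_j}(s,s')=\frac{\sigma_j^2(\phi_j\|s-s'\|)^\nu}{\Gamma(\nu)2^{\nu-1}}\,\mathcal K_\nu(\phi_j\|s-s'\|),\qquad K_{\theta_j}(s,s)=\sigma_j^2,$$ where $\mathcal K_\nu$ is the modified Bessel function of the second kind; $E_j$ denotes expectation under $P_j$. For each sample size $n$ let $s_{n,1},\dots,s_{n,n}\in D$ be distinct locations, $y_i=y(s_{n,i})$, $Y_n=(y_1,\dots,y_n)$, and let $S_{n,(i-1)}$ be a (possibly empty) subvector of $y_{(i-1)}=(y_1,\dots,y_{i-1})$. Assume that $d\le 3$, or that the design is nested, i.e. $s_{n,i}$ and the index set of $S_{n,(i-1)}$ do not depend on $n\ge i$. Put $$e_{i,0}=y_i-E_0(y_i\mid y_{(i-1)}),\qquad \tilde e_{i,1}=y_i-E_1(y_i\mid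 S_{n,(i-1)}),\qquad i=1,\dots,n$$ (so $e_{1,0}=\tilde e_{1,1}=y_1$). Let $\hat\sigma^2_{n,vecch}$ be a maximiser over $\sigma^2>0$ of Vecchia's approximate likelihood $\tilde p(Y_n\mid\phi_1,\sigma^2)=\prod_{i=1}^n p(y_i\mid S_{n,(i-1)};\sigma^2,\phi_1,\nu)$, in which $p(\cdot\mid\cdot\,;\sigma^2,\phi_1,\nu)$ are the conditional Gaussian densities under the Matérn model with decay $\phi_1$, smoothness $\nu$ and variance $\sigma^2$. Assume that, as $n\to\infty$, either $$\sum_{i=1}^n\frac{E_0(\tilde e_{i,1}-e_{i,0})^2}{E_1\tilde e_{i,1}^2}=O(1)\quad\text{and}\quad\sum_{i=1}^n\Big(\frac{E_0e_{i,0}^2}{E_1\tilde e_{i,1}^2}-1\Big)^2=O(1),$$ or $$\sum_{i=1}^n\frac{E_1(\tilde e_{i,1}-e_{i,0})^2}{E_0e_{i,0}^2}=O(1)\quad\text{and}\quad\sum_{i=1}^n\Big(\frac{E_1\tilde e_{i,1}^2}{E_0e_{i,0}^2}-1\Big)^2=O(1).$$ Then, for every $n\ge1$, the maximiser $\hat\sigma^2_{n,vecch}$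 exists and is unique $P_0$-almost surely, and under $P_0$ $$\sqrt n\,\big(\hat\sigma^2_{n,vecch}\,\phi_1^{2\nu}-\sigma_0^2\phi_0^{2\nu}\big)\xrightarrow{\ \mathcal L\ }N\big(0,\,2(\sigma_0^2\phi_0^{2\nu})^2\big).$$ -/

import Mathlib

open MeasureTheory ProbabilityTheory Filter Topology Asymptotics

noncomputable section

/-- The modified Bessel function of the second kind of order `ν`, for `x > 0`, in its integral form
`𝒦_ν(x) = ∫₀^∞ exp (-x cosh t) cosh (ν t) dt`. -/
def besselK (ν x : ℝ) : ℝ :=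
  ∫ t in Set.Ioi (0 : ℝ), Real.exp (-x * Real.cosh t) * Real.cosh (ν * t)

/-- The Matérn covariance at distance `r` with partial sill `v` (the variance `σ²`), decay `φ` and
smoothness `ν`. At `r = 0` it takes the value `v`, which is its limit as `r → 0`. -/
def matern (v φ ν r : ℝ) : ℝ :=
  if r = 0 then v
  else v * (φ * r) ^ ν / (Real.Gamma ν * 2 ^ (ν - 1)) * besselK ν (φ * r)

/-- Under the measure `P`, the real-valued process `y` is a centred Gaussian process with
covariance function `K`. -/
structure IsCentredGP {T Ω : Type*} [MeasurableSpace Ω] (y : T → Ω → ℝ) (P : Measure Ω)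
    (K : T → T → ℝ) : Prop where
  measurable : ∀ t, Measurable (y t)
  gaussian : IsGaussianProcess y P
  mean_zero : ∀ t, ∫ ω, y t ω ∂P = 0
  cov_eq : ∀ t u, cov[y t, y u; P] = K t u

/-- The sigma-algebra generated by the observations `y (s j)`, `j ∈ A`. -/
@[reducible]
def obsSigma {T Ω : Type*} (y : T → Ω → ℝ) (s : ℕ → T) (A : Finset ℕ) : MeasurableSpace Ω :=
  ⨆ j ∈ A, MeasurableSpace.comap (y (s j)) inferInstance

/-- The error `y (s i) - E_P (y (s i) | y (s j), j ∈ A)` in predicting the `i`-th observation from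
those with index in `A` under the measure `P`. (For `A = ∅` the conditional expectation is the
mean.) -/
def predError {T Ω : Type*} [MeasurableSpace Ω] (P : Measure Ω) (y : T → Ω → ℝ) (s : ℕ → T)
    (A : Finset ℕ) (i : ℕ) : Ω → ℝ :=
  fun ω => y (s i) ω - (P[y (s i) | obsSigma y s A]) ω

/-- The density at `x` of the centred Gaussian vector indexed by the finite set `A` with covariance
matrix `(C a b)`, `a, b ∈ A`. It is `1` for `A = ∅`. -/
def gaussDensity (C : ℕ → ℕ → ℝ) (A : Finset ℕ) (x : ℕ → ℝ) : ℝ :=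
  let V : Matrix A A ℝ := Matrix.of fun a b => C a b
  let z : A → ℝ := fun a => x a
  (Real.sqrt ((2 * Real.pi) ^ A.card * V.det))⁻¹ * Real.exp (-(z ⬝ᵥ (V⁻¹).mulVec z) / 2)

/-- The conditional density of the `i`-th coordinate given the coordinates in `A`. -/
def condGaussDensity (C : ℕ → ℕ → ℝ) (A : Finset ℕ) (i : ℕ) (x : ℕ → ℝ) : ℝ :=
  gaussDensity C (insert i A) x / gaussDensity C A x

/-- Vecchia's approximate likelihood of the first `n` coordinates of `x`, the `i`-th one being
conditioned on the coordinates in `N i`. -/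
def vecchiaLik (C : ℕ → ℕ → ℝ) (N : ℕ → Finset ℕ) (n : ℕ) (x : ℕ → ℝ) : ℝ :=
  ∏ i ∈ Finset.range n, condGaussDensity C (N i) i x

/-- `v` maximises over `(0, ∞)` Vecchia's approximate likelihood of the data `x`, observed at the
locations `s 0, …, s (n - 1)`, as a function of the variance parameter of the Matérn covariance
with fixed decay `φ` and smoothness `ν`. -/
def IsVecchiaMLE {E : Type*} [SeminormedAddCommGroup E] (φ ν : ℝ) (s : ℕ → E)
    (N : ℕ → Finset ℕ) (n : ℕ) (x : ℕ → ℝ) (v : ℝ) : Prop :=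
  0 < v ∧ IsMaxOn (fun w => vecchiaLik (fun a b => matern w φ ν ‖s a - s b‖) N n x)
    (Set.Ioi 0) v

end

set_option linter.unusedSectionVars false

/-! ### The Matérn covariance as a scale mixture of Gaussians -/

/-! The Matérn covariance is linear in its variance, so the prediction weights do not depend on σ².
At σ² = σ₁² t Vecchia's likelihood is therefore a constant times t^(-n/2) exp(-Q/(2t)), where Q = ∑
ẽ_i² / t_i and t_i = E₁ ẽ_i². Almost surely Q > 0, and then σ₁² Q / n is the unique maximiser
(`isVecchiaMLE_iff`). With κ = σ₀² φ₀^(2ν) = σ₁² φ₁^(2ν) the statistic becomes κ (Q - n) / √n.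

Put p_i = E₀ e_i². Under P₀ the standardised errors Z_i = e_i / √p_i are independent standard normal
(`map_stdErr_eq_pi`), so κ ∑ (Z_i² - 1) / √n has the claimed limit. By Slutsky it remains to show
E₀|Q - ∑ Z_i²| = o(√n).

Since ẽ_i - e_i is a linear form in the past, ẽ_i / √t_i = q_i Z_i + a_i with q_i² = p_i / t_i and
a_i independent of Z_i. Expanding the square gives the sum of a_i², a sum of martingale differences,
and the drift ∑ (q_i² - 1). The first two are O(1) in L¹ by the assumed bounds
(`integral_abs_sum_sq_sub_le`). The second pair of assumptions reduces to the first because the two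
spectral densities are comparable (`isBigO_sum_div_of_or`).

For the drift, Cauchy–Schwarz alone gives O(√n), which is not enough. For a nested design the q_i² -
1 form one square-summable sequence, and cutting off its head gives o(√n). In dimension at most 3
the spectral densities satisfy f₁ / f₀ - 1 = O((1 + ‖w‖²)⁻¹). The Fourier transforms of the
standardised errors are orthonormal in L²(f₀) and come from point masses in the bounded set D, so
their kernel ∑ |ĉ_i|² f₀ is bounded uniformly in n and the design. Integrating it against (1 +
‖w‖²)⁻¹ gives O(n^(3/7)) (`sum_tailForm_le`), hence a drift of order o(√n)
(`isLittleO_drift_of_finrank_le`). -/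

theorem integrableOn_rpow_mul_exp_neg_mul_Ioi {a r : ℝ} (ha : 0 < a) (hr : 0 < r) :
    IntegrableOn (fun t : ℝ => t ^ (a - 1) * Real.exp (-(r * t))) (Set.Ioi 0) := by
  have := integrableOn_rpow_mul_exp_neg_mul_rpow (p := 1) (s := a - 1) (b := r) (by linarith)
    one_pos hr
  simpa [neg_mul] using this

theorem image_mul_exp_univ {b : ℝ} (hb : 0 < b) :
    (fun u : ℝ => b * Real.exp u) '' Set.univ = Set.Ioi 0 := by
  ext t
  constructor
  · rintro ⟨u, -, rfl⟩
    exact mul_pos hb (Real.exp_pos u)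
  · intro ht
    have ht : 0 < t := ht
    refine ⟨Real.log (t / b), trivial, ?_⟩
    simp only
    rw [Real.exp_log (div_pos ht hb)]
    field_simp

theorem hasDerivWithinAt_mul_exp (b : ℝ) (u : ℝ) (s : Set ℝ) :
    HasDerivWithinAt (fun u : ℝ => b * Real.exp u) (b * Real.exp u) s u :=
  ((Real.hasDerivAt_exp u).const_mul b).hasDerivWithinAt

theorem injOn_mul_exp {b : ℝ} (hb : 0 < b) (s : Set ℝ) :
    Set.InjOn (fun u : ℝ => b * Real.exp u) s := fun _ _ _ _ h =>
  Real.exp_injective (mul_left_cancel₀ hb.ne' h)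

/-- The substitution t = r/(2φ) · exp u balances the two exponents φ² t and r²/(4t): their sum
becomes φ r cosh u. -/
theorem exp_mul_eq_rpow_mul_exp_cosh {φ r ν : ℝ} (hφ : 0 < φ) (hr : 0 < r) (u : ℝ) :
    |r / (2 * φ) * Real.exp u| • ((r / (2 * φ) * Real.exp u) ^ (ν - 1)
        * Real.exp (-(φ ^ 2 * (r / (2 * φ) * Real.exp u)))
        * Real.exp (-(r ^ 2) / (4 * (r / (2 * φ) * Real.exp u)))) =
      (r / (2 * φ)) ^ ν * (Real.exp (ν * u) * Real.exp (-(φ * r) * Real.cosh u)) := by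
  have hb : 0 < r / (2 * φ) := by positivity
  have hp : 0 < r / (2 * φ) * Real.exp u := by positivity
  rw [abs_of_pos hp, smul_eq_mul, ← mul_assoc, ← mul_assoc, mul_assoc (_ * _ ^ _),
    ← Real.exp_add]
  have h1 : r / (2 * φ) * Real.exp u * (r / (2 * φ) * Real.exp u) ^ (ν - 1)
      = (r / (2 * φ)) ^ ν * Real.exp (ν * u) := by
    rw [Real.rpow_sub_one hp.ne', mul_div_cancel₀ _ hp.ne', Real.mul_rpow hb.le
      (Real.exp_pos u).le, ← Real.exp_mul, mul_comm u]
  have h2 : -(φ ^ 2 * (r / (2 * φ) * Real.exp u)) + -(r ^ 2) / (4 * (r / (2 * φ) * Real.exp u))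
      = -(φ * r) * Real.cosh u := by
    rw [Real.cosh_eq, Real.exp_neg]
    have := (Real.exp_pos u).ne'
    field_simp
    ring
  rw [h1, h2, mul_assoc]

theorem integrableOn_gaussian_mixture {φ ν : ℝ} (hφ : 0 < φ) (hν : 0 < ν) (r : ℝ) :
    IntegrableOn (fun t : ℝ => t ^ (ν - 1) * Real.exp (-(φ ^ 2 * t))
      * Real.exp (-(r ^ 2) / (4 * t))) (Set.Ioi 0) := by
  refine Integrable.mono' (integrableOn_rpow_mul_exp_neg_mul_Ioi hν (pow_pos hφ 2)) ?_ ?_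
  · exact Measurable.aestronglyMeasurable (by fun_prop)
  · refine (ae_restrict_iff' measurableSet_Ioi).2 (Eventually.of_forall fun t ht => ?_)
    have ht : 0 < t := ht
    have h1 : 0 ≤ t ^ (ν - 1) * Real.exp (-(φ ^ 2 * t)) := by positivity
    rw [norm_mul, Real.norm_of_nonneg h1, Real.norm_of_nonneg (Real.exp_pos _).le]
    refine mul_le_of_le_one_right h1 (Real.exp_le_one_iff.2 ?_)
    exact div_nonpos_of_nonpos_of_nonneg (by nlinarith [sq_nonneg r]) (by positivity)

/-- After the exponential substitution the integrand on the line is exp(νu - φ r cosh u). Averaging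
over u and -u turns exp(νu) into cosh(νu), and folding onto the half-line gives twice the Bessel
integral. -/
theorem integral_gaussian_mixture {φ ν r : ℝ} (hφ : 0 < φ) (hν : 0 < ν) (hr : 0 < r) :
    ∫ t in Set.Ioi (0 : ℝ), t ^ (ν - 1) * Real.exp (-(φ ^ 2 * t)) * Real.exp (-(r ^ 2) / (4 * t))
      = 2 * (r / (2 * φ)) ^ ν * besselK ν (φ * r) := by
  have hb : 0 < r / (2 * φ) := by positivity
  have hint := integrableOn_gaussian_mixture hφ hν r
  rw [← image_mul_exp_univ hb] at hint ⊢
  rw [integral_image_eq_integral_abs_deriv_smul MeasurableSet.univ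
    (fun u _ => hasDerivWithinAt_mul_exp _ u _) (injOn_mul_exp hb _)]
  rw [integrableOn_image_iff_integrableOn_abs_deriv_smul MeasurableSet.univ
    (fun u _ => hasDerivWithinAt_mul_exp _ u _) (injOn_mul_exp hb _)] at hint
  simp only [exp_mul_eq_rpow_mul_exp_cosh hφ hr] at hint ⊢
  rw [integrableOn_univ] at hint
  rw [setIntegral_univ, integral_const_mul]
  have hint : Integrable fun u : ℝ => Real.exp (ν * u) * Real.exp (-(φ * r) * Real.cosh u) := by
    have := hint.const_mul ((r / (2 * φ)) ^ ν)⁻¹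
    refine this.congr (Eventually.of_forall fun u => ?_)
    simp only
    rw [← mul_assoc, inv_mul_cancel₀ (Real.rpow_pos_of_pos hb ν).ne', one_mul]
  have hsymm : ∫ u : ℝ, Real.exp (ν * u) * Real.exp (-(φ * r) * Real.cosh u) =
      2 * besselK ν (φ * r) := by
    have hneg := integral_neg_eq_self
      (fun u : ℝ => Real.exp (ν * u) * Real.exp (-(φ * r) * Real.cosh u)) volume
    have hadd := integral_add hint hint.comp_neg
    rw [hneg, ← two_mul] at hadd
    have habs := integral_comp_abs
      (f := fun u : ℝ => Real.exp (-(φ * r) * Real.cosh u) * Real.cosh (ν * u))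
    have : ∀ u : ℝ, Real.exp (ν * u) * Real.exp (-(φ * r) * Real.cosh u)
        + Real.exp (ν * -u) * Real.exp (-(φ * r) * Real.cosh (-u))
        = 2 * (Real.exp (-(φ * r) * Real.cosh |u|) * Real.cosh (ν * |u|)) := by
      intro u
      have h : Real.cosh (ν * |u|) = Real.cosh (ν * u) := by
        rcases abs_choice u with h | h <;> rw [h]
        rw [mul_neg, Real.cosh_neg]
      rw [Real.cosh_abs, h, Real.cosh_neg, Real.cosh_eq (ν * u), mul_neg]
      ring
    simp only [this] at hadd
    rw [integral_const_mul, habs] at hadd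
    rw [besselK]
    linarith
  rw [hsymm]
  ring

/-- A gamma mixture of Gaussians, whose Fourier transforms are explicit. It covers both branches of
`matern`: at r = 0 the mixture is a Gamma integral. -/
theorem matern_eq_integral {v φ ν r : ℝ} (hφ : 0 < φ) (hν : 0 < ν) (hr : 0 ≤ r) :
    matern v φ ν r = v * φ ^ (2 * ν) / Real.Gamma ν * ∫ t in Set.Ioi (0 : ℝ),
      t ^ (ν - 1) * Real.exp (-(φ ^ 2 * t)) * Real.exp (-(r ^ 2) / (4 * t)) := by
  have hΓ := (Real.Gamma_pos_of_pos hν).ne'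
  have hpow : φ ^ (2 * ν) = (φ ^ 2) ^ ν := by
    rw [← Real.rpow_natCast φ 2, ← Real.rpow_mul hφ.le]
    norm_num
  rcases hr.eq_or_lt with rfl | hr
  · have : ∀ t : ℝ, Real.exp (-((0 : ℝ) ^ 2) / (4 * t)) = 1 := by simp
    simp only [this, mul_one]
    rw [Real.integral_rpow_mul_exp_neg_mul_Ioi hν (pow_pos hφ 2), matern, if_pos rfl, hpow,
      one_div, Real.inv_rpow (by positivity)]
    have : (φ ^ 2) ^ ν ≠ 0 := (Real.rpow_pos_of_pos (by positivity) _).ne'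
    field_simp
  · rw [integral_gaussian_mixture hφ hν hr, matern, if_neg hr.ne', hpow,
      Real.div_rpow hr.le (by positivity), Real.mul_rpow (by norm_num) hφ.le,
      Real.mul_rpow hφ.le hr.le, Real.rpow_sub_one (by norm_num), ← Real.rpow_natCast φ 2,
      ← Real.rpow_mul hφ.le, Nat.cast_ofNat, two_mul ν, Real.rpow_add hφ]
    have h1 : φ ^ ν ≠ 0 := (Real.rpow_pos_of_pos hφ _).ne'
    have h2 : (2 : ℝ) ^ ν ≠ 0 := (Real.rpow_pos_of_pos (by norm_num) _).ne'
    field_simp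

/-! ### The spectral density of the Matérn covariance -/

section Spectral

variable {E : Type*} [NormedAddCommGroup E] [InnerProductSpace ℝ E] [FiniteDimensional ℝ E]
  [MeasurableSpace E] [BorelSpace E]

theorem integral_exp_neg_mul_sq_norm_mul_cos {b : ℝ} (hb : 0 < b) (x : E) :
    ∫ w : E, Real.exp (-b * ‖w‖ ^ 2) * Real.cos (inner ℝ x w) =
      (Real.pi / b) ^ ((Module.finrank ℝ E : ℝ) / 2) * Real.exp (-(‖x‖ ^ 2) / (4 * b)) := by
  have h := GaussianFourier.integral_cexp_neg_mul_sq_norm_add (b := (b : ℂ)) (V := E)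
    (by simpa using hb) Complex.I x
  have hi := GaussianFourier.integrable_cexp_neg_mul_sq_norm_add (b := (b : ℂ)) (V := E)
    (by simpa using hb) Complex.I x
  have hre := congrArg Complex.re h
  have hcomm : (∫ v : E, Complex.exp (-(b : ℂ) * ↑‖v‖ ^ 2 + Complex.I * ↑(inner ℝ x v))).re =
      ∫ v : E, (Complex.exp (-(b : ℂ) * ↑‖v‖ ^ 2 + Complex.I * ↑(inner ℝ x v))).re :=
    (integral_re hi).symm
  rw [hcomm] at hre
  have h1 : ∀ v : E, (Complex.exp (-(b : ℂ) * ↑‖v‖ ^ 2 + Complex.I * ↑(inner ℝ x v))).re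
      = Real.exp (-b * ‖v‖ ^ 2) * Real.cos (inner ℝ x v) := by
    intro v
    have e : -(b : ℂ) * ↑‖v‖ ^ 2 + Complex.I * ↑(inner ℝ x v)
      = ((-b * ‖v‖ ^ 2 : ℝ) : ℂ) + ((inner ℝ x v : ℝ) : ℂ) * Complex.I := by
      push_cast; ring
    rw [e, Complex.exp_add, Complex.exp_mul_I, ← Complex.ofReal_exp, ← Complex.ofReal_cos,
      ← Complex.ofReal_sin, Complex.re_ofReal_mul, Complex.add_re, Complex.ofReal_re,
      Complex.re_ofReal_mul, Complex.I_re, mul_zero, add_zero]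
  simp only [h1] at hre
  rw [hre]
  have e1 : ((Real.pi : ℂ) / b) ^ ((Module.finrank ℝ E : ℂ) / 2) =
      (((Real.pi / b) ^ ((Module.finrank ℝ E : ℝ) / 2) : ℝ) : ℂ) := by
    rw [Complex.ofReal_cpow (by positivity)]
    push_cast
    rfl
  have e2 : Complex.exp (Complex.I ^ 2 * ↑‖x‖ ^ 2 / (4 * b)) =
      ((Real.exp (-(‖x‖ ^ 2) / (4 * b)) : ℝ) : ℂ) := by
    rw [Complex.ofReal_exp, Complex.I_sq]
    push_cast
    ring_nf
  rw [e1, e2, ← Complex.ofReal_mul, Complex.ofReal_re]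

/-- The spectral density of the Matérn covariance. -/
noncomputable def maternSpectral (v φ ν : ℝ) (w : E) : ℝ :=
  v * φ ^ (2 * ν) * (Real.Gamma (ν + (Module.finrank ℝ E : ℝ) / 2)
    / (Real.Gamma ν * Real.pi ^ ((Module.finrank ℝ E : ℝ) / 2)))
    * (φ ^ 2 + ‖w‖ ^ 2) ^ (-(ν + (Module.finrank ℝ E : ℝ) / 2))

/-- The hypothesis of Fubini. The cosine is at most 1, and the Gaussian integral over `E`
contributes t^(-d/2), leaving the integrable gamma kernel of order ν. -/
theorem integrable_gaussian_mixture_prod {φ ν : ℝ} (hφ : 0 < φ) (hν : 0 < ν) (x : E) :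
    Integrable (fun p : ℝ × E => p.1 ^ (ν + (Module.finrank ℝ E : ℝ) / 2 - 1)
      * Real.exp (-(φ ^ 2 * p.1)) * (Real.exp (-p.1 * ‖p.2‖ ^ 2) * Real.cos (inner ℝ x p.2)))
      ((volume.restrict (Set.Ioi (0 : ℝ))).prod volume) := by
  set a := ν + (Module.finrank ℝ E : ℝ) / 2 with ha
  have key : Integrable (fun p : ℝ × E => p.1 ^ (a - 1)
      * Real.exp (-(φ ^ 2 * p.1)) * Real.exp (-p.1 * ‖p.2‖ ^ 2))
      ((volume.restrict (Set.Ioi (0 : ℝ))).prod volume) := by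
    rw [integrable_prod_iff (Measurable.aestronglyMeasurable (by fun_prop))]
    constructor
    · refine (ae_restrict_iff' measurableSet_Ioi).2 (Eventually.of_forall fun t ht => ?_)
      have ht : 0 < t := ht
      suffices Integrable fun w : E => Real.exp (-t * ‖w‖ ^ 2) from
        this.const_mul (t ^ (a - 1) * Real.exp (-(φ ^ 2 * t)))
      have := (GaussianFourier.integrable_cexp_neg_mul_sq_norm_add (b := (t : ℂ)) (V := E)
        (by simpa using ht) 0 0).re
      refine this.congr (Eventually.of_forall fun w => ?_)
      simp only [inner_zero_left]
      have e : -(t : ℂ) * ↑‖w‖ ^ 2 + 0 * ((0 : ℝ) : ℂ) = ((-t * ‖w‖ ^ 2 : ℝ) : ℂ) := by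
        push_cast; ring
      rw [e, ← Complex.ofReal_exp]
      exact Complex.ofReal_re _
    · have hI := (integrableOn_rpow_mul_exp_neg_mul_Ioi hν (pow_pos hφ 2)).const_mul
        (Real.pi ^ ((Module.finrank ℝ E : ℝ) / 2))
      refine hI.congr ((ae_restrict_iff' measurableSet_Ioi).2 (Eventually.of_forall fun t ht => ?_))
      have ht : 0 < t := ht
      have h1 : ∀ w : E, ‖t ^ (a - 1) * Real.exp (-(φ ^ 2 * t)) * Real.exp (-t * ‖w‖ ^ 2)‖ =
          t ^ (a - 1) * Real.exp (-(φ ^ 2 * t)) * Real.exp (-t * ‖w‖ ^ 2) := fun w =>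
        Real.norm_of_nonneg (by positivity)
      simp only [h1]
      rw [integral_const_mul, GaussianFourier.integral_rexp_neg_mul_sq_norm ht,
        Real.div_rpow Real.pi_pos.le ht.le]
      have h2 : t ^ (a - 1) = t ^ (ν - 1) * t ^ ((Module.finrank ℝ E : ℝ) / 2) := by
        rw [← Real.rpow_add ht, ha]
        ring_nf
      rw [h2]
      have := (Real.rpow_pos_of_pos ht ((Module.finrank ℝ E : ℝ) / 2)).ne'
      field_simp
  refine key.mono (Measurable.aestronglyMeasurable (by fun_prop)) (Eventually.of_forall fun p => ?_)
  rw [← mul_assoc, norm_mul]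
  exact mul_le_of_le_one_right (norm_nonneg _) (Real.abs_cos_le_one _)

/-- Integrating over t first is a Gamma integral and yields the spectral density. Integrating over w
first yields the Gaussian mixture, so swapping the order proves the spectral representation. -/
theorem maternSpectral_mul_cos_eq {v φ ν : ℝ} (hφ : 0 < φ) (hν : 0 < ν) (x w : E) :
    maternSpectral v φ ν w * Real.cos (inner ℝ x w) =
      v * φ ^ (2 * ν) / (Real.Gamma ν * Real.pi ^ ((Module.finrank ℝ E : ℝ) / 2)) *
      ∫ t in Set.Ioi (0 : ℝ), t ^ (ν + (Module.finrank ℝ E : ℝ) / 2 - 1)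
      * Real.exp (-(φ ^ 2 * t)) * (Real.exp (-t * ‖w‖ ^ 2) * Real.cos (inner ℝ x w)) := by
  have ha : 0 < ν + (Module.finrank ℝ E : ℝ) / 2 := by positivity
  have h1 : ∀ t : ℝ, t ^ (ν + (Module.finrank ℝ E : ℝ) / 2 - 1)
      * Real.exp (-(φ ^ 2 * t)) * (Real.exp (-t * ‖w‖ ^ 2) * Real.cos (inner ℝ x w)) =
      t ^ (ν + (Module.finrank ℝ E : ℝ) / 2 - 1) * Real.exp (-((φ ^ 2 + ‖w‖ ^ 2) * t))
        * Real.cos (inner ℝ x w) := by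
    intro t
    have : -((φ ^ 2 + ‖w‖ ^ 2) * t) = -(φ ^ 2 * t) + -t * ‖w‖ ^ 2 := by ring
    rw [this, Real.exp_add]
    ring
  simp only [h1]
  rw [integral_mul_const, Real.integral_rpow_mul_exp_neg_mul_Ioi ha (by positivity),
    maternSpectral, one_div, Real.inv_rpow (by positivity), Real.rpow_neg (by positivity)]
  ring

theorem integrable_maternSpectral {v φ ν : ℝ} (hφ : 0 < φ) (hν : 0 < ν) :
    Integrable (maternSpectral v φ ν : E → ℝ) := by
  have h := ((integrable_gaussian_mixture_prod hφ hν (0 : E)).integral_prod_right).const_mul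
    (v * φ ^ (2 * ν) / (Real.Gamma ν * Real.pi ^ ((Module.finrank ℝ E : ℝ) / 2)))
  refine h.congr (Eventually.of_forall fun w => ?_)
  have := maternSpectral_mul_cos_eq (v := v) hφ hν 0 w
  simp only [inner_zero_left, Real.cos_zero, mul_one] at this ⊢
  exact this.symm

/-- The spectral representation of the Matérn covariance. -/
theorem matern_eq_integral_cos {v φ ν : ℝ} (hφ : 0 < φ) (hν : 0 < ν) (x : E) :
    matern v φ ν ‖x‖ = ∫ w : E, maternSpectral v φ ν w * Real.cos (inner ℝ x w) := by
  simp only [maternSpectral_mul_cos_eq hφ hν]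
  rw [integral_const_mul, ← integral_integral_swap (integrable_gaussian_mixture_prod hφ hν x),
    matern_eq_integral hφ hν (norm_nonneg x)]
  have h1 : ∫ t in Set.Ioi (0 : ℝ), ∫ w : E, t ^ (ν + (Module.finrank ℝ E : ℝ) / 2 - 1)
      * Real.exp (-(φ ^ 2 * t)) * (Real.exp (-t * ‖w‖ ^ 2) * Real.cos (inner ℝ x w)) =
      ∫ t in Set.Ioi (0 : ℝ), Real.pi ^ ((Module.finrank ℝ E : ℝ) / 2) *
        (t ^ (ν - 1) * Real.exp (-(φ ^ 2 * t)) * Real.exp (-(‖x‖ ^ 2) / (4 * t))) := by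
    refine setIntegral_congr_fun measurableSet_Ioi fun t ht => ?_
    have ht : 0 < t := ht
    rw [integral_const_mul, integral_exp_neg_mul_sq_norm_mul_cos ht,
      Real.div_rpow Real.pi_pos.le ht.le]
    have h2 : t ^ (ν + (Module.finrank ℝ E : ℝ) / 2 - 1)
        = t ^ (ν - 1) * t ^ ((Module.finrank ℝ E : ℝ) / 2) := by
      rw [← Real.rpow_add ht]
      ring_nf
    rw [h2]
    have := (Real.rpow_pos_of_pos ht ((Module.finrank ℝ E : ℝ) / 2)).ne'
    field_simp
  rw [h1, integral_const_mul]
  have := (Real.rpow_pos_of_pos Real.pi_pos ((Module.finrank ℝ E : ℝ) / 2)).ne'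
  rw [← mul_assoc, ← div_div, div_mul_cancel₀ _ this]

end Spectral

/-! ### Exponential sums and bandlimited inequalities -/

theorem sq_integral_mul_le {α : Type*} [MeasurableSpace α] {μ : Measure α} {F G : α → ℝ}
    (hF : MemLp F 2 μ) (hG : MemLp G 2 μ) (hF0 : 0 ≤ F) (hG0 : 0 ≤ G) :
    (∫ a, F a * G a ∂μ) ^ 2 ≤ (∫ a, F a ^ 2 ∂μ) * ∫ a, G a ^ 2 ∂μ := by
  have h := integral_mul_le_Lp_mul_Lq_of_nonneg (p := 2) (q := 2) (μ := μ) (f := F) (g := G)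
    Real.HolderConjugate.two_two (Eventually.of_forall hF0) (Eventually.of_forall hG0)
    (by simpa using hF) (by simpa using hG)
  simp only [Real.rpow_two] at h
  rw [← Real.sqrt_eq_rpow, ← Real.sqrt_eq_rpow] at h
  have hF' : 0 ≤ ∫ a, F a ^ 2 ∂μ := integral_nonneg fun a => sq_nonneg _
  have hG' : 0 ≤ ∫ a, G a ^ 2 ∂μ := integral_nonneg fun a => sq_nonneg _
  calc (∫ a, F a * G a ∂μ) ^ 2
      ≤ (√(∫ a, F a ^ 2 ∂μ) * √(∫ a, G a ^ 2 ∂μ)) ^ 2 :=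
        pow_le_pow_left₀ (integral_nonneg fun a => mul_nonneg (hF0 a) (hG0 a)) h 2
    _ = _ := by rw [mul_pow, Real.sq_sqrt hF', Real.sq_sqrt hG']

section ExpSum

variable {E : Type*} [NormedAddCommGroup E] [InnerProductSpace ℝ E] [FiniteDimensional ℝ E]
  [MeasurableSpace E] [BorelSpace E]

open FourierTransform SchwartzMap in
-- Take the Fourier transform of a smooth bump equal to 1 on a ball around `D`; by inversion the
-- integral is a value of the bump. Convolution with this function reproduces every exponential sum
-- with frequencies in `D`.
theorem exists_schwartzMap_integral_exp_eq_one {D : Set E} (hD : Bornology.IsBounded D) :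
    ∃ η : 𝓢(E, ℂ), ∀ s ∈ D,
      ∫ w, η w * Complex.exp (-(Complex.I * (inner ℝ s w : ℝ))) = 1 := by
  obtain ⟨R, hR⟩ := hD.subset_closedBall 0
  let b : ContDiffBump (0 : E) := ⟨max R 1, max R 1 + 1, by positivity, by linarith⟩
  let χ : E → ℂ := fun x => (b x : ℂ)
  have hχ : ContDiff ℝ (↑(⊤ : ℕ∞)) χ := Complex.ofRealCLM.contDiff.comp b.contDiff
  have hχc : HasCompactSupport χ :=
    b.hasCompactSupport.comp_left (g := fun r : ℝ => (r : ℂ)) Complex.ofReal_zero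
  let f : 𝓢(E, ℂ) := hχc.toSchwartzMap hχ
  refine ⟨𝓕 f, fun s hs => ?_⟩
  -- The factor (2π)⁻¹ compensates the 2π in the exponent of `𝓕⁻`; it shrinks norms, so the point
  -- stays in the ball where the bump is 1.
  have h1 : 𝓕⁻ (𝓕 f) (-(2 * Real.pi)⁻¹ • s) = 1 := by
    rw [fourierInv_fourier_eq]
    change ((b _ : ℝ) : ℂ) = 1
    rw [b.one_of_mem_closedBall, Complex.ofReal_one]
    have hs' := hR hs
    rw [mem_closedBall_zero_iff] at hs' ⊢
    have h2π : (2 * Real.pi)⁻¹ ≤ 1 := inv_le_one_of_one_le₀ (by linarith [Real.pi_gt_three])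
    rw [norm_smul, norm_neg, Real.norm_of_nonneg (by positivity)]
    calc (2 * Real.pi)⁻¹ * ‖s‖ ≤ 1 * ‖s‖ := by gcongr
      _ ≤ max R 1 := by rw [one_mul]; exact hs'.trans (le_max_left _ _)
  rw [SchwartzMap.fourierInv_coe, Real.fourierInv_eq'] at h1
  rw [← h1]
  refine integral_congr_ae (Eventually.of_forall fun w => ?_)
  simp only [smul_eq_mul]
  rw [mul_comm, inner_smul_right, real_inner_comm]
  congr 2
  push_cast
  have : (Real.pi : ℂ) ≠ 0 := by exact_mod_cast Real.pi_ne_zero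
  field_simp

/-- The Fourier transform of the point masses `c k` at `x k`, `k < n`. -/
noncomputable def expSum (x : ℕ → E) (n : ℕ) (c : ℕ → ℝ) (w : E) : ℂ :=
  ∑ k ∈ Finset.range n, (c k : ℂ) * Complex.exp (Complex.I * (inner ℝ (x k) w : ℝ))

theorem continuous_expSum (x : ℕ → E) (n : ℕ) (c : ℕ → ℝ) : Continuous (expSum x n c) := by
  unfold expSum
  fun_prop

theorem norm_expSum_le (x : ℕ → E) (n : ℕ) (c : ℕ → ℝ) (w : E) :
    ‖expSum x n c w‖ ≤ ∑ k ∈ Finset.range n, |c k| := by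
  refine (norm_sum_le _ _).trans (Finset.sum_le_sum fun k _ => ?_)
  rw [norm_mul, Complex.norm_exp_I_mul_ofReal, mul_one, Complex.norm_real, Real.norm_eq_abs]

theorem expSum_sum_mul {ι : Type*} (S : Finset ι) (x : ℕ → E) (n : ℕ) (a : ι → ℝ)
    (c : ι → ℕ → ℝ) (w : E) :
    expSum x n (fun k => ∑ i ∈ S, a i * c i k) w = ∑ i ∈ S, (a i : ℂ) * expSum x n (c i) w := by
  simp only [expSum, Complex.ofReal_sum, Complex.ofReal_mul, Finset.sum_mul, Finset.mul_sum]
  rw [Finset.sum_comm]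
  simp only [mul_assoc]

theorem integrable_norm_expSum_sq_mul {f : E → ℝ} (hint : Integrable f) (x : ℕ → E) (n : ℕ)
    (c : ℕ → ℝ) : Integrable fun w => ‖expSum x n c w‖ ^ 2 * f w := by
  refine hint.bdd_mul (c := (∑ k ∈ Finset.range n, |c k|) ^ 2)
    ((continuous_expSum x n c).norm.pow 2).aestronglyMeasurable (Eventually.of_forall fun w => ?_)
  rw [norm_pow, norm_norm]
  exact pow_le_pow_left₀ (norm_nonneg _) (norm_expSum_le x n c w) 2

theorem integrable_inner_expSum_mul {f : E → ℝ} (hint : Integrable f) (x : ℕ → E) (n : ℕ)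
    (c c' : ℕ → ℝ) : Integrable fun w => inner ℝ (expSum x n c w) (expSum x n c' w) * f w := by
  refine hint.bdd_mul
    (c := (∑ k ∈ Finset.range n, |c k|) * ∑ k ∈ Finset.range n, |c' k|)
    (((continuous_expSum x n c).inner (continuous_expSum x n c')).aestronglyMeasurable)
    (Eventually.of_forall fun w => ?_)
  exact (norm_inner_le_norm _ _).trans (mul_le_mul (norm_expSum_le x n c w)
    (norm_expSum_le x n c' w) (norm_nonneg _) (Finset.sum_nonneg fun k _ => abs_nonneg _))

theorem expSum_eq_integral {x : ℕ → E} {n : ℕ} {η : E → ℂ} (hη : Integrable η)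
    (h1 : ∀ k < n, ∫ w, η w * Complex.exp (-(Complex.I * (inner ℝ (x k) w : ℝ))) = 1)
    (c : ℕ → ℝ) (w : E) :
    expSum x n c w = ∫ u, η u * expSum x n c (w - u) := by
  have hterm : ∀ (k : ℕ) (u : E), η u * ((c k : ℂ)
      * Complex.exp (Complex.I * (inner ℝ (x k) (w - u) : ℝ))) =
      (c k : ℂ) * Complex.exp (Complex.I * (inner ℝ (x k) w : ℝ))
        * (η u * Complex.exp (-(Complex.I * (inner ℝ (x k) u : ℝ)))) := by
    intro k u
    rw [inner_sub_right, Complex.ofReal_sub, mul_sub, sub_eq_add_neg, Complex.exp_add]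
    ring
  have hi : ∀ k, Integrable fun u =>
      η u * Complex.exp (-(Complex.I * (inner ℝ (x k) u : ℝ))) := by
    intro k
    refine hη.mul_bdd (c := 1)
      (Continuous.aestronglyMeasurable (by fun_prop)) (Eventually.of_forall fun u => ?_)
    rw [← mul_neg, ← Complex.ofReal_neg, Complex.norm_exp_I_mul_ofReal]
  simp only [expSum, Finset.mul_sum, hterm]
  rw [integral_finsetSum _ fun k _ => (hi k).const_mul _]
  refine Finset.sum_congr rfl fun k hk => ?_
  rw [integral_const_mul, h1 k (Finset.mem_range.1 hk), mul_one]

/-- A pointwise bound for the Fourier transforms of measures on a bounded set in terms of their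
`L²` norm with respect to a moderate weight. -/
theorem exists_norm_expSum_sq_mul_le {f : E → ℝ} (hcont : Continuous f) (hpos : ∀ w, 0 < f w)
    (hint : Integrable f) {K : ℝ} {m : ℕ} (hmod : ∀ w u, f w ≤ K * (1 + ‖u‖) ^ m * f (w - u))
    {D : Set E} (hD : Bornology.IsBounded D) :
    ∃ C : ℝ, 0 < C ∧ ∀ (x : ℕ → E) (n : ℕ), (∀ k < n, x k ∈ D) → ∀ (c : ℕ → ℝ) (w : E),
      ‖expSum x n c w‖ ^ 2 * f w ≤ C * ∫ u, ‖expSum x n c u‖ ^ 2 * f u := by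
  obtain ⟨η, hη⟩ := exists_schwartzMap_integral_exp_eq_one hD
  have hK : 0 < K := by
    have h := hmod 0 0
    simp only [norm_zero, add_zero, one_pow, mul_one, sub_zero] at h
    have := hpos 0
    by_contra! hK
    nlinarith
  have hηint : Integrable (η : E → ℂ) := η.integrable
  obtain ⟨M, hM⟩ : ∃ M : ℝ, ∀ u, (1 + ‖u‖) ^ m * ‖η u‖ ≤ M :=
    ⟨_, fun u => by
      simpa using SchwartzMap.one_add_le_sup_seminorm_apply (𝕜 := ℝ) (m := (m, 0))
        (le_refl m) (le_refl 0) η u⟩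
  have hG2 : Integrable fun u => ‖η u‖ ^ 2 * (K * (1 + ‖u‖) ^ m) := by
    refine (hηint.norm.const_mul (K * M)).mono' (Continuous.aestronglyMeasurable ?_)
      (Eventually.of_forall fun u => ?_)
    · have := η.continuous
      fun_prop
    · rw [Real.norm_of_nonneg (by positivity)]
      calc ‖η u‖ ^ 2 * (K * (1 + ‖u‖) ^ m) = K * ((1 + ‖u‖) ^ m * ‖η u‖) * ‖η u‖ := by ring
        _ ≤ K * M * ‖η u‖ := by
          gcongr
          exact hM u
  set A := ∫ u, ‖η u‖ ^ 2 * (K * (1 + ‖u‖) ^ m) with hA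
  have hA0 : 0 ≤ A := integral_nonneg fun u => by positivity
  refine ⟨A + 1, by linarith, fun x n hx c w => ?_⟩
  have hB0 : 0 ≤ ∫ u, ‖expSum x n c u‖ ^ 2 * f u :=
    integral_nonneg fun u => mul_nonneg (sq_nonneg _) (hpos u).le
  suffices ‖expSum x n c w‖ ^ 2 * f w ≤ A * ∫ u, ‖expSum x n c u‖ ^ 2 * f u by nlinarith
  -- Cauchy–Schwarz for the reproducing convolution. The moderate growth of `f` moves √f(w) inside
  -- as √f(w - u), at the cost of a polynomial weight absorbed by the rapidly decaying η.
  set F : E → ℝ := fun u => ‖expSum x n c (w - u)‖ * √(f (w - u)) with hF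
  set G : E → ℝ := fun u => ‖η u‖ * √(K * (1 + ‖u‖) ^ m) with hG
  have hFsq : ∀ u, F u ^ 2 = ‖expSum x n c (w - u)‖ ^ 2 * f (w - u) := fun u => by
    rw [hF]; simp only [mul_pow]; rw [Real.sq_sqrt (hpos _).le]
  have hGsq : ∀ u, G u ^ 2 = ‖η u‖ ^ 2 * (K * (1 + ‖u‖) ^ m) := fun u => by
    simp only [hG]; rw [mul_pow, Real.sq_sqrt (by positivity)]
  have hexp := continuous_expSum x n c
  have hFc : Continuous F := by fun_prop
  have hGc : Continuous G := by
    have := η.continuous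
    fun_prop
  have hFL : MemLp F 2 volume := by
    rw [memLp_two_iff_integrable_sq hFc.aestronglyMeasurable]
    simp only [hFsq]
    exact (integrable_norm_expSum_sq_mul hint x n c).comp_sub_left w
  have hGL : MemLp G 2 volume := by
    rw [memLp_two_iff_integrable_sq hGc.aestronglyMeasurable]
    simpa only [hGsq] using hG2
  have hCS := sq_integral_mul_le hFL hGL (fun u => by positivity) (fun u => by positivity)
  simp only [hFsq, hGsq] at hCS
  rw [integral_sub_left_eq_self (fun u => ‖expSum x n c u‖ ^ 2 * f u), ← hA] at hCS
  have hFG : Integrable fun u => F u * G u := MemLp.integrable_mul hFL hGL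
  have hle : ‖expSum x n c w‖ * √(f w) ≤ ∫ u, F u * G u := by
    rw [expSum_eq_integral hηint (fun k hk => hη _ (hx k hk)) c w]
    have hint' : Integrable fun u => ‖η u * expSum x n c (w - u)‖ * √(f w) := by
      refine (Integrable.norm ?_).mul_const _
      refine hηint.mul_bdd (c := ∑ k ∈ Finset.range n, |c k|)
        (Continuous.aestronglyMeasurable (by fun_prop)) (Eventually.of_forall fun u => ?_)
      exact norm_expSum_le _ _ _ _
    refine (mul_le_mul_of_nonneg_right (norm_integral_le_integral_norm _)
      (Real.sqrt_nonneg _)).trans ?_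
    rw [← integral_mul_const]
    refine integral_mono hint' hFG fun u => ?_
    have h := Real.sqrt_le_sqrt (hmod w u)
    rw [Real.sqrt_mul (by positivity)] at h
    calc ‖η u * expSum x n c (w - u)‖ * √(f w)
        ≤ ‖η u * expSum x n c (w - u)‖ * (√(K * (1 + ‖u‖) ^ m) * √(f (w - u))) := by gcongr
      _ = F u * G u := by rw [norm_mul, hF, hG]; ring
  calc ‖expSum x n c w‖ ^ 2 * f w = (‖expSum x n c w‖ * √(f w)) ^ 2 := by
        rw [mul_pow, Real.sq_sqrt (hpos w).le]
    _ ≤ (∫ u, F u * G u) ^ 2 := pow_le_pow_left₀ (by positivity) hle 2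
    _ ≤ _ := by rw [mul_comm A]; exact hCS

/-- Along (x - y)/‖x - y‖² the two phases differ by exactly one radian, and cos 1 < 1. -/
theorem exp_I_inner_injective :
    Function.Injective fun (x w : E) => Complex.exp (Complex.I * (inner ℝ x w : ℝ)) := by
  intro x y h
  by_contra hxy
  have hn : ‖x - y‖ ^ 2 ≠ 0 := pow_ne_zero 2 (norm_ne_zero_iff.2 (sub_ne_zero.2 hxy))
  have h1 := congrFun h ((‖x - y‖ ^ 2)⁻¹ • (x - y))
  simp only at h1
  have h2 : inner ℝ x ((‖x - y‖ ^ 2)⁻¹ • (x - y)) =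
      inner ℝ y ((‖x - y‖ ^ 2)⁻¹ • (x - y)) + 1 := by
    rw [← sub_eq_iff_eq_add', ← inner_sub_left, inner_smul_right, real_inner_self_eq_norm_sq,
      inv_mul_cancel₀ hn]
  rw [h2, Complex.ofReal_add, mul_add, Complex.exp_add, mul_eq_left₀ (Complex.exp_ne_zero _)] at h1
  have h3 := congrArg Complex.re h1
  rw [Complex.ofReal_one, mul_one, ← one_mul Complex.I, ← Complex.ofReal_one,
    Complex.exp_ofReal_mul_I_re, Complex.ofReal_re] at h3
  linarith [Real.cos_one_le]

/-- Distinct locations give distinct characters of `E`, and distinct characters are linearly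
independent. -/
theorem eq_zero_of_expSum_eq_zero {x : ℕ → E} {n : ℕ} (hx : Set.InjOn x (Set.Iio n)) {c : ℕ → ℝ}
    (h : ∀ w, expSum x n c w = 0) : ∀ k < n, c k = 0 := by
  let χ : ℕ → Multiplicative E →* ℂ := fun k =>
    { toFun := fun w => Complex.exp (Complex.I * (inner ℝ (x k) w.toAdd : ℝ))
      map_one' := by simp
      map_mul' := fun w u => by
        rw [toAdd_mul, inner_add_right, Complex.ofReal_add, mul_add, Complex.exp_add] }
  have hχ : Set.InjOn χ (Finset.range n : Set ℕ) := by
    intro k hk l hl hkl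
    refine hx (by simpa using hk) (by simpa using hl) (exp_I_inner_injective ?_)
    funext w
    exact DFunLike.congr_fun hkl (Multiplicative.ofAdd w)
  have hli := (linearIndependent_monoidHom (Multiplicative E) ℂ).comp
    (fun k : Finset.range n => χ k) (hχ.injective)
  rw [Fintype.linearIndependent_iff] at hli
  intro k hk
  have := hli (fun k => (c k : ℂ)) ?_ ⟨k, Finset.mem_range.2 hk⟩
  · exact_mod_cast this
  · funext w
    have hw := h w.toAdd
    rw [expSum, ← Finset.sum_coe_sort] at hw
    simpa [χ] using hw

end ExpSum

/-! ### Quadratic forms of covariance matrices -/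

/-- The bilinear form of the matrix `(C k l)`, `k, l < n`. -/
noncomputable def covForm (C : ℕ → ℕ → ℝ) (n : ℕ) (c c' : ℕ → ℝ) : ℝ :=
  ∑ k ∈ Finset.range n, ∑ l ∈ Finset.range n, c k * c' l * C k l

theorem covForm_comm {C : ℕ → ℕ → ℝ} (hC : ∀ k l, C k l = C l k) (n : ℕ) (c c' : ℕ → ℝ) :
    covForm C n c c' = covForm C n c' c := by
  unfold covForm
  rw [Finset.sum_comm]
  refine Finset.sum_congr rfl fun k _ => Finset.sum_congr rfl fun l _ => ?_
  rw [hC l k]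
  ring

theorem covForm_add_left (C : ℕ → ℕ → ℝ) (n : ℕ) (a b c : ℕ → ℝ) :
    covForm C n (fun k => a k + b k) c = covForm C n a c + covForm C n b c := by
  simp only [covForm, add_mul, Finset.sum_add_distrib]

theorem covForm_add_right (C : ℕ → ℕ → ℝ) (n : ℕ) (a b c : ℕ → ℝ) :
    covForm C n c (fun k => a k + b k) = covForm C n c a + covForm C n c b := by
  simp only [covForm, mul_add, add_mul, Finset.sum_add_distrib]

theorem covForm_mul_left (C : ℕ → ℕ → ℝ) (n : ℕ) (r : ℝ) (a b : ℕ → ℝ) :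
    covForm C n (fun k => r * a k) b = r * covForm C n a b := by
  simp only [covForm, Finset.mul_sum, mul_assoc]

theorem covForm_mul_right (C : ℕ → ℕ → ℝ) (n : ℕ) (r : ℝ) (a b : ℕ → ℝ) :
    covForm C n a (fun k => r * b k) = r * covForm C n a b := by
  simp only [covForm, Finset.mul_sum]
  refine Finset.sum_congr rfl fun k _ => Finset.sum_congr rfl fun l _ => ?_
  ring

theorem covForm_eq_sum_left (C : ℕ → ℕ → ℝ) (n : ℕ) (a b : ℕ → ℝ) :
    covForm C n a b = ∑ k ∈ Finset.range n, a k * ∑ l ∈ Finset.range n, b l * C k l := by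
  simp only [covForm, Finset.mul_sum, mul_assoc]

theorem covForm_sum_left {ι : Type*} (S : Finset ι) (C : ℕ → ℕ → ℝ) (n : ℕ) (a : ι → ℝ)
    (c : ι → ℕ → ℝ) (b : ℕ → ℝ) :
    covForm C n (fun k => ∑ i ∈ S, a i * c i k) b = ∑ i ∈ S, a i * covForm C n (c i) b := by
  simp only [covForm_eq_sum_left]
  simp only [Finset.sum_mul]
  rw [Finset.sum_comm]
  simp only [mul_assoc, ← Finset.mul_sum]

theorem covForm_sum_sum {ι : Type*} [DecidableEq ι] (S : Finset ι) {C : ℕ → ℕ → ℝ}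
    (hC : ∀ k l, C k l = C l k) {n : ℕ} {c : ι → ℕ → ℝ} (a : ι → ℝ)
    (horth : ∀ i ∈ S, ∀ j ∈ S, covForm C n (c i) (c j) = if i = j then 1 else 0) :
    covForm C n (fun k => ∑ i ∈ S, a i * c i k) (fun k => ∑ i ∈ S, a i * c i k) =
      ∑ i ∈ S, a i ^ 2 := by
  rw [covForm_sum_left]
  refine Finset.sum_congr rfl fun i hi => ?_
  rw [covForm_comm hC, covForm_sum_left]
  rw [Finset.sum_eq_single i]
  · rw [horth i hi i hi, if_pos rfl]
    ring
  · intro j hj hji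
    rw [horth j hj i hi, if_neg hji, mul_zero]
  · exact fun h => absurd hi h

/-! ### Covariance forms as L² inner products in the spectral domain. -/

section Spectral

variable {E : Type*} [NormedAddCommGroup E] [InnerProductSpace ℝ E] [FiniteDimensional ℝ E]
  [MeasurableSpace E] [BorelSpace E]

theorem inner_exp_I_mul (a b : ℝ) :
    inner ℝ (Complex.exp (Complex.I * a)) (Complex.exp (Complex.I * b)) = Real.cos (a - b) := by
  rw [mul_comm Complex.I, mul_comm Complex.I, Complex.inner, Complex.mul_re, Complex.conj_re,
    Complex.conj_im, Complex.exp_ofReal_mul_I_re, Complex.exp_ofReal_mul_I_re,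
    Complex.exp_ofReal_mul_I_im, Complex.exp_ofReal_mul_I_im, Real.cos_sub]
  ring

theorem inner_expSum (x : ℕ → E) (n : ℕ) (c c' : ℕ → ℝ) (w : E) :
    inner ℝ (expSum x n c w) (expSum x n c' w) =
      covForm (fun k l => Real.cos (inner ℝ (x k - x l) w)) n c c' := by
  simp only [expSum, covForm, sum_inner, inner_sum, ← Complex.real_smul, real_inner_smul_left,
    real_inner_smul_right, inner_exp_I_mul, inner_sub_left, mul_assoc]
  rw [Finset.sum_comm]
  refine Finset.sum_congr rfl fun k _ => Finset.sum_congr rfl fun l _ => ?_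
  ring

theorem covForm_eq_integral {f : E → ℝ} (hint : Integrable f) {C : ℕ → ℕ → ℝ} {x : ℕ → E}
    (hC : ∀ k l, C k l = ∫ w, f w * Real.cos (inner ℝ (x k - x l) w)) (n : ℕ) (c c' : ℕ → ℝ) :
    covForm C n c c' = ∫ w, inner ℝ (expSum x n c w) (expSum x n c' w) * f w := by
  have hi : ∀ k l, Integrable fun w => f w * Real.cos (inner ℝ (x k - x l) w) := fun k l =>
    hint.mul_bdd (c := 1) (Continuous.aestronglyMeasurable (by fun_prop))
      (Eventually.of_forall fun w => Real.abs_cos_le_one _)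
  have hterm : ∀ w, inner ℝ (expSum x n c w) (expSum x n c' w) * f w =
      ∑ k ∈ Finset.range n, ∑ l ∈ Finset.range n,
        c k * c' l * (f w * Real.cos (inner ℝ (x k - x l) w)) := by
    intro w
    rw [inner_expSum, covForm, Finset.sum_mul]
    refine Finset.sum_congr rfl fun k _ => ?_
    rw [Finset.sum_mul]
    exact Finset.sum_congr rfl fun l _ => by ring
  simp only [hterm]
  rw [integral_finsetSum _ fun k _ => integrable_finsetSum _ fun l _ => (hi k l).const_mul _]
  refine Finset.sum_congr rfl fun k _ => ?_
  rw [integral_finsetSum _ fun l _ => (hi k l).const_mul _]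
  refine Finset.sum_congr rfl fun l _ => ?_
  rw [integral_const_mul, hC]

theorem covForm_self_eq_integral {f : E → ℝ} (hint : Integrable f) {C : ℕ → ℕ → ℝ} {x : ℕ → E}
    (hC : ∀ k l, C k l = ∫ w, f w * Real.cos (inner ℝ (x k - x l) w)) (n : ℕ) (c : ℕ → ℝ) :
    covForm C n c c = ∫ w, ‖expSum x n c w‖ ^ 2 * f w := by
  simp only [covForm_eq_integral hint hC, real_inner_self_eq_norm_sq]

/-- The spectral functions of an orthonormal family form a bounded reproducing kernel. -/
theorem sum_norm_expSum_sq_mul_le {f : E → ℝ} (hpos : ∀ w, 0 < f w) {B : ℝ} (hB : 0 < B)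
    {C : ℕ → ℕ → ℝ} (hsymm : ∀ k l, C k l = C l k) {x : ℕ → E} {n : ℕ}
    (hbd : ∀ (c : ℕ → ℝ) (w : E), ‖expSum x n c w‖ ^ 2 * f w ≤ B * covForm C n c c)
    {c : ℕ → ℕ → ℝ} {N : ℕ}
    (horth : ∀ i < N, ∀ j < N, covForm C n (c i) (c j) = if i = j then 1 else 0) (w : E) :
    ∑ i ∈ Finset.range N, ‖expSum x n (c i) w‖ ^ 2 * f w ≤ 2 * B := by
  have horth' : ∀ i ∈ Finset.range N, ∀ j ∈ Finset.range N,
      covForm C n (c i) (c j) = if i = j then 1 else 0 := fun i hi j hj =>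
    horth i (Finset.mem_range.1 hi) j (Finset.mem_range.1 hj)
  -- Test the pointwise bound on the combination with weights a_i. With S = ∑ a_i² its form is S by
  -- orthonormality and its value at w has modulus at least S, so S² f ≤ B S. The weights must be
  -- real, so real and imaginary parts are treated separately; this is the factor 2.
  have key : ∀ a : ℕ → ℝ, |∑ i ∈ Finset.range N, a i ^ 2| ≤
      ‖∑ i ∈ Finset.range N, (a i : ℂ) * expSum x n (c i) w‖ →
      (∑ i ∈ Finset.range N, a i ^ 2) * f w ≤ B := by
    intro a ha
    set S := ∑ i ∈ Finset.range N, a i ^ 2 with hS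
    have hS0 : 0 ≤ S := Finset.sum_nonneg fun i _ => sq_nonneg _
    have h1 := hbd (fun k => ∑ i ∈ Finset.range N, a i * c i k) w
    rw [expSum_sum_mul, covForm_sum_sum _ hsymm a horth', ← hS] at h1
    have h2 : S ^ 2 * f w ≤ B * S := by
      refine le_trans ?_ h1
      rw [← sq_abs]
      have := hpos w
      gcongr
    rcases hS0.eq_or_lt with h0 | h0
    · rw [← h0, zero_mul]
      exact hB.le
    · have h3 : S * (S * f w) ≤ S * B := by linarith
      exact le_of_mul_le_mul_left h3 h0
  have hre := key (fun i => (expSum x n (c i) w).re) (by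
    refine le_trans (le_of_eq ?_) (Complex.abs_re_le_norm _)
    simp [sq])
  have him := key (fun i => (expSum x n (c i) w).im) (by
    refine le_trans (le_of_eq ?_) (Complex.abs_im_le_norm _)
    simp [sq])
  have hsum : ∑ i ∈ Finset.range N, ‖expSum x n (c i) w‖ ^ 2 * f w =
      (∑ i ∈ Finset.range N, (expSum x n (c i) w).re ^ 2) * f w
        + (∑ i ∈ Finset.range N, (expSum x n (c i) w).im ^ 2) * f w := by
    rw [← add_mul, ← Finset.sum_add_distrib, Finset.sum_mul]
    refine Finset.sum_congr rfl fun i _ => ?_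
    rw [Complex.sq_norm, Complex.normSq_apply]
    ring
  rw [hsum]
  linarith

/-- Split at t = l. It is used with t = (1 + ‖w‖²)⁻¹; the power 7/4 makes the last term decay like
‖w‖^(-7/2), which is integrable in dimension at most 3. -/
theorem inv_le_add_rpow {t l : ℝ} (ht : 0 < t) (hl : 0 < l) :
    t ≤ l + l ^ (-(3 / 4) : ℝ) * t ^ (7 / 4 : ℝ) := by
  rcases le_or_gt t l with h | h
  · have : 0 ≤ l ^ (-(3 / 4) : ℝ) * t ^ (7 / 4 : ℝ) := by positivity
    linarith
  · have h1 : t ^ (-(3 / 4) : ℝ) ≤ l ^ (-(3 / 4) : ℝ) :=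
      Real.rpow_le_rpow_of_nonpos hl h.le (by norm_num)
    have h2 : t = t ^ (-(3 / 4) : ℝ) * t ^ (7 / 4 : ℝ) := by
      rw [← Real.rpow_add ht]
      norm_num
    have h3 : t ^ (-(3 / 4) : ℝ) * t ^ (7 / 4 : ℝ) ≤ l ^ (-(3 / 4) : ℝ) * t ^ (7 / 4 : ℝ) := by
      gcongr
    linarith

/-- The form `c ↦ ∫ ‖ĉ‖² f / (1 + ‖w‖²)`. -/
noncomputable def tailForm (f : E → ℝ) (x : ℕ → E) (n : ℕ) (c : ℕ → ℝ) : ℝ :=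
  ∫ w, ‖expSum x n c w‖ ^ 2 * f w * (1 + ‖w‖ ^ 2)⁻¹

theorem inv_one_add_norm_sq_le_one (w : E) : (1 + ‖w‖ ^ 2)⁻¹ ≤ 1 :=
  inv_le_one_of_one_le₀ (by nlinarith [sq_nonneg ‖w‖])

theorem integrable_tailForm {f : E → ℝ} (hint : Integrable f) (x : ℕ → E) (n : ℕ) (c : ℕ → ℝ) :
    Integrable fun w => ‖expSum x n c w‖ ^ 2 * f w * (1 + ‖w‖ ^ 2)⁻¹ := by
  refine (integrable_norm_expSum_sq_mul hint x n c).mul_bdd (c := 1)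
    (Measurable.aestronglyMeasurable (by fun_prop)) (Eventually.of_forall fun w => ?_)
  rw [Real.norm_of_nonneg (by positivity)]
  exact inv_one_add_norm_sq_le_one w

theorem tailForm_nonneg {f : E → ℝ} (hpos : ∀ w, 0 < f w) (x : ℕ → E) (n : ℕ) (c : ℕ → ℝ) :
    0 ≤ tailForm f x n c :=
  integral_nonneg fun w => by
    have := hpos w
    positivity

theorem tailForm_mul (f : E → ℝ) (x : ℕ → E) (n : ℕ) (r : ℝ) (c : ℕ → ℝ) :
    tailForm f x n (fun k => r * c k) = r ^ 2 * tailForm f x n c := by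
  have : ∀ w, expSum x n (fun k => r * c k) w = (r : ℂ) * expSum x n c w := by
    intro w
    simp only [expSum, Complex.ofReal_mul, Finset.mul_sum, mul_assoc]
  simp only [tailForm, this]
  rw [← integral_const_mul]
  refine integral_congr_ae (Eventually.of_forall fun w => ?_)
  simp only [norm_mul, Complex.norm_real, mul_pow, Real.norm_eq_abs, sq_abs, mul_assoc]

/-- The kernel g = ∑ ‖ĉ_i‖² f has total mass n and is at most 2B pointwise. Splitting the weight as
l + l^(-3/4) (1 + ‖w‖²)^(-7/4), the mass controls the first part and the sup bound the second. -/
theorem sum_tailForm_le (hdim : Module.finrank ℝ E ≤ 3) {f : E → ℝ} (hint : Integrable f)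
    (hpos : ∀ w, 0 < f w) {B : ℝ} (hB : 0 < B) {C : ℕ → ℕ → ℝ} {x : ℕ → E} {n : ℕ} (hn : 0 < n)
    (hC : ∀ k l, C k l = ∫ w, f w * Real.cos (inner ℝ (x k - x l) w))
    (hbd : ∀ (c : ℕ → ℝ) (w : E), ‖expSum x n c w‖ ^ 2 * f w ≤ B * covForm C n c c)
    {c : ℕ → ℕ → ℝ}
    (horth : ∀ i < n, ∀ j < n, covForm C n (c i) (c j) = if i = j then 1 else 0) :
    ∑ i ∈ Finset.range n, tailForm f x n (c i) ≤
      (1 + 2 * B * ∫ w : E, (1 + ‖w‖ ^ 2) ^ (-(7 / 2 : ℝ) / 2)) * (n : ℝ) ^ (3 / 7 : ℝ) := by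
  have hsymm : ∀ k l, C k l = C l k := fun k l => by
    rw [hC, hC]
    refine integral_congr_ae (Eventually.of_forall fun w => ?_)
    simp only
    rw [← neg_sub (x l), inner_neg_left, Real.cos_neg]
  have hI : Integrable fun w : E => (1 + ‖w‖ ^ 2) ^ (-(7 / 2 : ℝ) / 2) :=
    integrable_rpow_neg_one_add_norm_sq (by
      have : (Module.finrank ℝ E : ℝ) ≤ 3 := by exact_mod_cast hdim
      linarith)
  have hn' : (0 : ℝ) < n := by exact_mod_cast hn
  -- This choice balances n l against l^(-3/4): both equal n^(3/7). Only 3/7 < 1/2 matters later.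
  set l : ℝ := (n : ℝ) ^ (-(4 / 7) : ℝ) with hl
  have hl0 : 0 < l := Real.rpow_pos_of_pos hn' _
  have hl1 : n * l = (n : ℝ) ^ (3 / 7 : ℝ) := by
    nth_rewrite 1 [← Real.rpow_one (n : ℝ)]
    rw [hl, ← Real.rpow_add hn']
    norm_num
  have hl2 : l ^ (-(3 / 4) : ℝ) = (n : ℝ) ^ (3 / 7 : ℝ) := by
    rw [hl, ← Real.rpow_mul hn'.le]
    norm_num
  have hgint : ∀ i, Integrable fun w => ‖expSum x n (c i) w‖ ^ 2 * f w :=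
    fun i => integrable_norm_expSum_sq_mul hint x n (c i)
  simp only [tailForm]
  rw [← integral_finsetSum _ fun i _ => integrable_tailForm hint x n (c i)]
  have hle : ∫ w, ∑ i ∈ Finset.range n, ‖expSum x n (c i) w‖ ^ 2 * f w * (1 + ‖w‖ ^ 2)⁻¹ ≤
      ∫ w, ((∑ i ∈ Finset.range n, ‖expSum x n (c i) w‖ ^ 2 * f w) * l
        + 2 * B * l ^ (-(3 / 4) : ℝ) * (1 + ‖w‖ ^ 2) ^ (-(7 / 2 : ℝ) / 2)) := by
    refine integral_mono (integrable_finsetSum _ fun i _ => integrable_tailForm hint x n (c i))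
      (((integrable_finsetSum _ fun i _ => hgint i).mul_const _).add (hI.const_mul _)) fun w => ?_
    simp only
    rw [← Finset.sum_mul]
    have h1 := sum_norm_expSum_sq_mul_le hpos hB hsymm hbd horth w
    have h0 : 0 ≤ ∑ i ∈ Finset.range n, ‖expSum x n (c i) w‖ ^ 2 * f w :=
      Finset.sum_nonneg fun i _ => mul_nonneg (sq_nonneg _) (hpos w).le
    set g := ∑ i ∈ Finset.range n, ‖expSum x n (c i) w‖ ^ 2 * f w
    have hw : 0 < 1 + ‖w‖ ^ 2 := by positivity
    have h2 := inv_le_add_rpow (inv_pos.2 hw) hl0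
    have h3 : ((1 + ‖w‖ ^ 2)⁻¹) ^ (7 / 4 : ℝ) = (1 + ‖w‖ ^ 2) ^ (-(7 / 2 : ℝ) / 2) := by
      rw [Real.inv_rpow hw.le, ← Real.rpow_neg hw.le]
      norm_num
    rw [h3] at h2
    have h4 : 0 ≤ l ^ (-(3 / 4) : ℝ) * (1 + ‖w‖ ^ 2) ^ (-(7 / 2 : ℝ) / 2) := by positivity
    calc g * (1 + ‖w‖ ^ 2)⁻¹
        ≤ g * (l + l ^ (-(3 / 4) : ℝ) * (1 + ‖w‖ ^ 2) ^ (-(7 / 2 : ℝ) / 2)) := by gcongr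
      _ = g * l + g * (l ^ (-(3 / 4) : ℝ) * (1 + ‖w‖ ^ 2) ^ (-(7 / 2 : ℝ) / 2)) := by ring
      _ ≤ g * l + 2 * B * (l ^ (-(3 / 4) : ℝ) * (1 + ‖w‖ ^ 2) ^ (-(7 / 2 : ℝ) / 2)) := by gcongr
      _ = _ := by ring
  refine hle.trans (le_of_eq ?_)
  rw [integral_add ((integrable_finsetSum _ fun i _ => hgint i).mul_const _) (hI.const_mul _),
    integral_mul_const, integral_const_mul, integral_finsetSum _ fun i _ => hgint i]
  have hone : ∑ i ∈ Finset.range n, ∫ w, ‖expSum x n (c i) w‖ ^ 2 * f w = n := by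
    rw [Finset.sum_congr rfl fun i hi => by
      rw [← covForm_self_eq_integral hint hC, horth i (Finset.mem_range.1 hi) i
        (Finset.mem_range.1 hi), if_pos rfl]]
    simp
  rw [hone, hl1, hl2]
  ring

/-- Comparison of two covariance forms whose spectral densities are close at infinity. -/
theorem abs_covForm_sub_le {f₀ f₁ : E → ℝ} (h₀ : Integrable f₀) (h₁ : Integrable f₁)
    (hpos : ∀ w, 0 < f₀ w) {K : ℝ} (hK : ∀ w, |f₁ w - f₀ w| ≤ K * (f₀ w * (1 + ‖w‖ ^ 2)⁻¹))
    {C₀ C₁ : ℕ → ℕ → ℝ} {x : ℕ → E} (hK0 : 0 ≤ K)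
    (hC₀ : ∀ k l, C₀ k l = ∫ w, f₀ w * Real.cos (inner ℝ (x k - x l) w))
    (hC₁ : ∀ k l, C₁ k l = ∫ w, f₁ w * Real.cos (inner ℝ (x k - x l) w)) (n : ℕ) (a b : ℕ → ℝ) :
    |covForm C₁ n a b - covForm C₀ n a b| ≤
      K / 2 * (tailForm f₀ x n a + covForm C₀ n b b) := by
  rw [covForm_eq_integral h₁ hC₁, covForm_eq_integral h₀ hC₀, ← integral_sub
    (integrable_inner_expSum_mul h₁ x n a b) (integrable_inner_expSum_mul h₀ x n a b),
    covForm_self_eq_integral h₀ hC₀, tailForm, ← integral_add (integrable_tailForm h₀ x n a)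
    (integrable_norm_expSum_sq_mul h₀ x n b), ← integral_const_mul]
  rw [← Real.norm_eq_abs]
  refine (norm_integral_le_of_norm_le (((integrable_tailForm h₀ x n a).add
    (integrable_norm_expSum_sq_mul h₀ x n b)).const_mul _) (Eventually.of_forall fun w => ?_))
  rw [Real.norm_eq_abs, ← mul_sub, abs_mul]
  have h1 : |(inner ℝ (expSum x n a w) (expSum x n b w) : ℝ)| ≤ ‖expSum x n a w‖ * ‖expSum x n b w‖ :=
    abs_real_inner_le_norm _ _
  set A := ‖expSum x n a w‖
  set B := ‖expSum x n b w‖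
  set q := (1 + ‖w‖ ^ 2)⁻¹
  have hq0 : 0 ≤ q := by positivity
  have hq1 : q ≤ 1 := inv_one_add_norm_sq_le_one w
  have hf := hpos w
  have hA : 0 ≤ A := norm_nonneg _
  have hB : 0 ≤ B := norm_nonneg _
  -- The decaying factor `q` is put entirely on `A`, and q² ≤ q since q ≤ 1. So only the first
  -- argument needs a small tail form.
  have h2 : A * B * q ≤ (A ^ 2 * q + B ^ 2) / 2 := by
    have : 0 ≤ (A * q - B) ^ 2 := sq_nonneg _
    have : A ^ 2 * q ^ 2 ≤ A ^ 2 * q := by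
      rw [sq q]
      exact mul_le_mul_of_nonneg_left (mul_le_of_le_one_left hq0 hq1) (sq_nonneg A)
    nlinarith
  calc |(inner ℝ (expSum x n a w) (expSum x n b w) : ℝ)| * |f₁ w - f₀ w|
      ≤ A * B * (K * (f₀ w * q)) := by
        gcongr
        exact hK w
    _ = K * f₀ w * (A * B * q) := by ring
    _ ≤ K * f₀ w * ((A ^ 2 * q + B ^ 2) / 2) := by gcongr
    _ = _ := by ring

theorem abs_covForm_self_sub_le {f₀ f₁ : E → ℝ} (h₀ : Integrable f₀) (h₁ : Integrable f₁)
    {K : ℝ} (hK : ∀ w, |f₁ w - f₀ w| ≤ K * (f₀ w * (1 + ‖w‖ ^ 2)⁻¹))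
    {C₀ C₁ : ℕ → ℕ → ℝ} {x : ℕ → E}
    (hC₀ : ∀ k l, C₀ k l = ∫ w, f₀ w * Real.cos (inner ℝ (x k - x l) w))
    (hC₁ : ∀ k l, C₁ k l = ∫ w, f₁ w * Real.cos (inner ℝ (x k - x l) w)) (n : ℕ) (a : ℕ → ℝ) :
    |covForm C₁ n a a - covForm C₀ n a a| ≤ K * tailForm f₀ x n a := by
  rw [covForm_self_eq_integral h₁ hC₁, covForm_self_eq_integral h₀ hC₀, ← integral_sub
    (integrable_norm_expSum_sq_mul h₁ x n a) (integrable_norm_expSum_sq_mul h₀ x n a),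
    tailForm, ← integral_const_mul]
  rw [← Real.norm_eq_abs]
  refine (norm_integral_le_of_norm_le ((integrable_tailForm h₀ x n a).const_mul _)
    (Eventually.of_forall fun w => ?_))
  rw [Real.norm_eq_abs, ← mul_sub, abs_mul, abs_of_nonneg (sq_nonneg ‖expSum x n a w‖)]
  calc ‖expSum x n a w‖ ^ 2 * |f₁ w - f₀ w|
      ≤ ‖expSum x n a w‖ ^ 2 * (K * (f₀ w * (1 + ‖w‖ ^ 2)⁻¹)) := by
        gcongr
        exact hK w
    _ = _ := by ring

theorem covForm_self_le {f₀ f₁ : E → ℝ} (h₀ : Integrable f₀) (h₁ : Integrable f₁)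
    {K : ℝ} (hK : ∀ w, f₀ w ≤ K * f₁ w) {C₀ C₁ : ℕ → ℕ → ℝ} {x : ℕ → E}
    (hC₀ : ∀ k l, C₀ k l = ∫ w, f₀ w * Real.cos (inner ℝ (x k - x l) w))
    (hC₁ : ∀ k l, C₁ k l = ∫ w, f₁ w * Real.cos (inner ℝ (x k - x l) w)) (n : ℕ) (a : ℕ → ℝ) :
    covForm C₀ n a a ≤ K * covForm C₁ n a a := by
  rw [covForm_self_eq_integral h₁ hC₁, covForm_self_eq_integral h₀ hC₀, ← integral_const_mul]
  refine integral_mono (integrable_norm_expSum_sq_mul h₀ x n a)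
    ((integrable_norm_expSum_sq_mul h₁ x n a).const_mul _) fun w => ?_
  simp only
  calc ‖expSum x n a w‖ ^ 2 * f₀ w ≤ ‖expSum x n a w‖ ^ 2 * (K * f₁ w) := by
        gcongr
        exact hK w
    _ = _ := by ring

end Spectral

/-! ### Covariance forms of the Matérn model -/

section MaternForms

variable {E : Type*} [NormedAddCommGroup E] [InnerProductSpace ℝ E] [FiniteDimensional ℝ E]
  [MeasurableSpace E] [BorelSpace E]

theorem maternSpectral_pos {v φ ν : ℝ} (hv : 0 < v) (hφ : 0 < φ) (hν : 0 < ν) (w : E) :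
    0 < maternSpectral v φ ν w := by
  have h1 := Real.Gamma_pos_of_pos hν
  have h2 := Real.Gamma_pos_of_pos (show 0 < ν + (Module.finrank ℝ E : ℝ) / 2 by positivity)
  unfold maternSpectral
  positivity

theorem continuous_maternSpectral {v φ ν : ℝ} (hφ : 0 < φ) :
    Continuous (maternSpectral v φ ν : E → ℝ) := by
  unfold maternSpectral
  refine continuous_const.mul (Continuous.rpow_const (by fun_prop) fun w => Or.inl ?_)
  positivity

theorem rpow_neg_le_mul_rpow_neg {a s t M : ℝ} (ha : 0 ≤ a) (hs : 0 < s) (ht : 0 < t) (hM : 0 < M)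
    (h : t ≤ M * s) : s ^ (-a) ≤ M ^ a * t ^ (-a) := by
  have h1 : (M * s) ^ (-a) ≤ t ^ (-a) := Real.rpow_le_rpow_of_nonpos ht h (by linarith)
  rw [Real.mul_rpow hM.le hs.le] at h1
  calc s ^ (-a) = M ^ a * (M ^ (-a) * s ^ (-a)) := by
        rw [← mul_assoc, ← Real.rpow_add hM, add_neg_cancel, Real.rpow_zero, one_mul]
    _ ≤ M ^ a * t ^ (-a) := by gcongr

/-- Equal smoothness means equal decay at infinity, so the densities have bounded ratio whatever
their decay parameters. -/
theorem exists_maternSpectral_le {v₀ v₁ φ₀ φ₁ ν : ℝ} (hv₀ : 0 < v₀) (hv₁ : 0 < v₁) (hφ₀ : 0 < φ₀)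
    (hφ₁ : 0 < φ₁) (hν : 0 < ν) :
    ∃ K : ℝ, 0 < K ∧ ∀ w : E, maternSpectral v₀ φ₀ ν w ≤ K * maternSpectral v₁ φ₁ ν w := by
  set a := ν + (Module.finrank ℝ E : ℝ) / 2 with ha
  have ha0 : 0 < a := by positivity
  -- `M` bounds (φ₁² + ‖w‖²)/(φ₀² + ‖w‖²) for every w.
  set M := (φ₁ ^ 2 + φ₀ ^ 2) / φ₀ ^ 2 with hM
  have hM0 : 0 < M := by positivity
  have h1 := Real.Gamma_pos_of_pos hν
  have h2 := Real.Gamma_pos_of_pos ha0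
  refine ⟨v₀ * φ₀ ^ (2 * ν) / (v₁ * φ₁ ^ (2 * ν)) * M ^ a, by positivity, fun w => ?_⟩
  have h3 : φ₁ ^ 2 + ‖w‖ ^ 2 ≤ M * (φ₀ ^ 2 + ‖w‖ ^ 2) := by
    rw [hM, div_mul_eq_mul_div, le_div_iff₀ (by positivity)]
    nlinarith [sq_nonneg ‖w‖, mul_nonneg (sq_nonneg φ₁) (sq_nonneg ‖w‖), sq_nonneg (φ₀ ^ 2)]
  have h4 := rpow_neg_le_mul_rpow_neg ha0.le (show 0 < φ₀ ^ 2 + ‖w‖ ^ 2 by positivity)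
    (show 0 < φ₁ ^ 2 + ‖w‖ ^ 2 by positivity) hM0 h3
  simp only [maternSpectral, ← ha]
  set G := Real.Gamma a / (Real.Gamma ν * Real.pi ^ ((Module.finrank ℝ E : ℝ) / 2)) with hG
  have hG0 : 0 < G := by positivity
  calc v₀ * φ₀ ^ (2 * ν) * G * (φ₀ ^ 2 + ‖w‖ ^ 2) ^ (-a)
      ≤ v₀ * φ₀ ^ (2 * ν) * G * (M ^ a * (φ₁ ^ 2 + ‖w‖ ^ 2) ^ (-a)) := by gcongr
    _ = _ := by field_simp

/-- Polynomial decay means that a translation by u costs only a power of 1 + ‖u‖. The power is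
rounded up to a natural number to match Schwartz seminorms. -/
theorem exists_maternSpectral_moderate {v φ ν : ℝ} (hv : 0 < v) (hφ : 0 < φ) (hν : 0 < ν) :
    ∃ (K : ℝ) (m : ℕ), ∀ w u : E,
      maternSpectral v φ ν w ≤ K * (1 + ‖u‖) ^ m * maternSpectral v φ ν (w - u) := by
  set a := ν + (Module.finrank ℝ E : ℝ) / 2 with ha
  have ha0 : 0 < a := by positivity
  set M := 2 * ((1 + φ ^ 2) / φ ^ 2) with hM
  have hM0 : 0 < M := by positivity
  have h1 := Real.Gamma_pos_of_pos hν
  have h2 := Real.Gamma_pos_of_pos ha0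
  refine ⟨M ^ a, 2 * ⌈a⌉₊, fun w u => ?_⟩
  have hn : ‖w - u‖ ≤ ‖w‖ + ‖u‖ := norm_sub_le w u
  have h3 : φ ^ 2 + ‖w - u‖ ^ 2 ≤ (M * (1 + ‖u‖) ^ 2) * (φ ^ 2 + ‖w‖ ^ 2) := by
    have h5 : ‖w - u‖ ^ 2 ≤ 2 * ‖w‖ ^ 2 + 2 * ‖u‖ ^ 2 := by
      nlinarith [norm_nonneg (w - u), norm_nonneg w, norm_nonneg u, sq_nonneg (‖w‖ - ‖u‖)]
    have h6 : 1 + ‖u‖ ^ 2 ≤ (1 + ‖u‖) ^ 2 := by nlinarith [norm_nonneg u]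
    have h7 : φ ^ 2 + ‖w - u‖ ^ 2 ≤ M * (1 + ‖u‖ ^ 2) * (φ ^ 2 + ‖w‖ ^ 2) := by
      have h8 : φ ^ 2 + 2 * ‖w‖ ^ 2 + 2 * ‖u‖ ^ 2 ≤ M * (1 + ‖u‖ ^ 2) * (φ ^ 2 + ‖w‖ ^ 2) := by
        have hφ2 : 0 < φ ^ 2 := by positivity
        rw [hM, mul_div_assoc', div_mul_eq_mul_div, div_mul_eq_mul_div, le_div_iff₀ hφ2]
        have e1 := sq_nonneg ‖w‖
        have e2 := sq_nonneg ‖u‖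
        nlinarith [mul_nonneg e1 e2, mul_nonneg hφ2.le e1, mul_nonneg hφ2.le e2,
          mul_nonneg hφ2.le (mul_nonneg e1 e2), sq_nonneg (φ ^ 2),
          mul_nonneg (sq_nonneg (φ ^ 2)) e2]
      linarith
    refine h7.trans ?_
    gcongr
  have h4 := rpow_neg_le_mul_rpow_neg ha0.le (show 0 < φ ^ 2 + ‖w‖ ^ 2 by positivity)
    (show 0 < φ ^ 2 + ‖w - u‖ ^ 2 by positivity) (by positivity) h3
  have h9 : (M * (1 + ‖u‖) ^ 2) ^ a ≤ M ^ a * (1 + ‖u‖) ^ (2 * ⌈a⌉₊) := by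
    rw [Real.mul_rpow hM0.le (by positivity), pow_mul, ← Real.rpow_natCast _ ⌈a⌉₊]
    gcongr
    · nlinarith [norm_nonneg u]
    · exact Nat.le_ceil a
  simp only [maternSpectral, ← ha]
  set G := Real.Gamma a / (Real.Gamma ν * Real.pi ^ ((Module.finrank ℝ E : ℝ) / 2)) with hG
  have hG0 : 0 < G := by positivity
  calc v * φ ^ (2 * ν) * G * (φ ^ 2 + ‖w‖ ^ 2) ^ (-a)
      ≤ v * φ ^ (2 * ν) * G * ((M ^ a * (1 + ‖u‖) ^ (2 * ⌈a⌉₊))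
        * (φ ^ 2 + ‖w - u‖ ^ 2) ^ (-a)) := by
        gcongr
        refine h4.trans ?_
        gcongr
    _ = _ := by ring

theorem abs_exp_sub_one_le_mul_exp (s : ℝ) : |Real.exp s - 1| ≤ |s| * Real.exp |s| := by
  have h1 := Real.add_one_le_exp s
  have h2 := Real.add_one_le_exp (-s)
  have h3 : Real.exp s * Real.exp (-s) = 1 := by rw [← Real.exp_add]; simp
  have h4 : 1 ≤ Real.exp |s| := Real.one_le_exp (abs_nonneg s)
  have h5 := Real.exp_pos s
  rcases le_total 0 s with h | h
  · rw [abs_of_nonneg h, abs_of_nonneg (by linarith)]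
    nlinarith
  · rw [abs_of_nonpos h, abs_of_nonpos (by linarith [Real.exp_le_one_iff.2 h])]
    rw [abs_of_nonpos h] at h4
    nlinarith

/-- Equal microergodic parameters cancel the leading constants, so the ratio of densities is
(X₀/X₁)^a with X_j = φ_j² + ‖w‖². As X₀ - X₁ does not depend on w, log(X₀/X₁) = O((1 + ‖w‖²)⁻¹). -/
theorem exists_abs_maternSpectral_sub_le {v₀ v₁ φ₀ φ₁ ν : ℝ} (hv₀ : 0 < v₀) (hφ₀ : 0 < φ₀)
    (hφ₁ : 0 < φ₁) (hν : 0 < ν) (hv : v₁ * φ₁ ^ (2 * ν) = v₀ * φ₀ ^ (2 * ν)) :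
    ∃ K : ℝ, 0 < K ∧ ∀ w : E, |maternSpectral v₁ φ₁ ν w - maternSpectral v₀ φ₀ ν w| ≤
      K * (maternSpectral v₀ φ₀ ν w * (1 + ‖w‖ ^ 2)⁻¹) := by
  set a := ν + (Module.finrank ℝ E : ℝ) / 2 with ha
  have ha0 : 0 < a := by positivity
  -- Chosen so that m (1 + ‖w‖²) lies below both X₀ and X₁.
  set m := min 1 (min (φ₀ ^ 2) (φ₁ ^ 2)) with hm
  have hm0 : 0 < m := by positivity
  set A := a * (|φ₀ ^ 2 - φ₁ ^ 2| / m) with hA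
  have hA0 : 0 ≤ A := by positivity
  refine ⟨A * Real.exp A + 1, by positivity, fun w => ?_⟩
  have hf := maternSpectral_pos hv₀ hφ₀ hν w
  set X₀ := φ₀ ^ 2 + ‖w‖ ^ 2 with hX₀
  set X₁ := φ₁ ^ 2 + ‖w‖ ^ 2 with hX₁
  have hX₀p : 0 < X₀ := by positivity
  have hX₁p : 0 < X₁ := by positivity
  have hq : 0 < 1 + ‖w‖ ^ 2 := by positivity
  have hb : ∀ X, m * (1 + ‖w‖ ^ 2) ≤ X → 0 < X →
      |φ₀ ^ 2 - φ₁ ^ 2| / X ≤ |φ₀ ^ 2 - φ₁ ^ 2| / m * (1 + ‖w‖ ^ 2)⁻¹ := by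
    intro X h hX
    rw [← div_eq_mul_inv, div_div]
    gcongr
  have hm1 : m ≤ 1 := min_le_left _ _
  have hmw : m * ‖w‖ ^ 2 ≤ ‖w‖ ^ 2 := mul_le_of_le_one_left (sq_nonneg _) hm1
  have hb0 := hb X₀ (by
    have : m ≤ φ₀ ^ 2 := (min_le_right _ _).trans (min_le_left _ _)
    rw [hX₀, mul_add, mul_one]; linarith) hX₀p
  have hb1 := hb X₁ (by
    have : m ≤ φ₁ ^ 2 := (min_le_right _ _).trans (min_le_right _ _)
    rw [hX₁, mul_add, mul_one]; linarith) hX₁p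
  have hlog : |Real.log (X₀ / X₁)| ≤ |φ₀ ^ 2 - φ₁ ^ 2| / m * (1 + ‖w‖ ^ 2)⁻¹ := by
    have e1 := Real.log_le_sub_one_of_pos (show 0 < X₀ / X₁ by positivity)
    have e2 := Real.log_le_sub_one_of_pos (show 0 < X₁ / X₀ by positivity)
    have e3 : Real.log (X₁ / X₀) = -Real.log (X₀ / X₁) := by rw [← Real.log_inv, inv_div]
    have e4 : X₀ / X₁ - 1 = (φ₀ ^ 2 - φ₁ ^ 2) / X₁ := by
      rw [div_sub_one hX₁p.ne', hX₀, hX₁]; ring_nf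
    have e5 : X₁ / X₀ - 1 = -(φ₀ ^ 2 - φ₁ ^ 2) / X₀ := by
      rw [div_sub_one hX₀p.ne', hX₀, hX₁]; ring_nf
    rw [abs_le']
    constructor
    · refine e1.trans (le_trans ?_ hb1)
      rw [e4]
      gcongr
      exact le_abs_self _
    · rw [← e3]
      refine e2.trans (le_trans ?_ hb0)
      rw [e5]
      gcongr
      exact neg_le_abs _
  have hs : |a * Real.log (X₀ / X₁)| ≤ A * (1 + ‖w‖ ^ 2)⁻¹ := by
    rw [abs_mul, abs_of_pos ha0, hA, mul_assoc]
    gcongr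
  have hs' : |a * Real.log (X₀ / X₁)| ≤ A :=
    hs.trans (mul_le_of_le_one_right hA0 (inv_one_add_norm_sq_le_one w))
  have hratio : maternSpectral v₁ φ₁ ν w =
      maternSpectral v₀ φ₀ ν w * Real.exp (a * Real.log (X₀ / X₁)) := by
    rw [mul_comm a, ← Real.rpow_def_of_pos (by positivity), Real.div_rpow hX₀p.le hX₁p.le]
    simp only [maternSpectral, ← ha, ← hX₀, ← hX₁]
    rw [hv, Real.rpow_neg hX₀p.le, Real.rpow_neg hX₁p.le]
    have := (Real.rpow_pos_of_pos hX₀p a).ne'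
    field_simp
  rw [hratio, ← mul_sub_one, abs_mul, abs_of_pos hf]
  calc maternSpectral v₀ φ₀ ν w * |Real.exp (a * Real.log (X₀ / X₁)) - 1|
      ≤ maternSpectral v₀ φ₀ ν w * (A * (1 + ‖w‖ ^ 2)⁻¹ * Real.exp A) := by
        gcongr
        refine (abs_exp_sub_one_le_mul_exp _).trans ?_
        gcongr
    _ = A * Real.exp A * (maternSpectral v₀ φ₀ ν w * (1 + ‖w‖ ^ 2)⁻¹) := by ring
    _ ≤ _ := by
        gcongr
        linarith

theorem matern_eq_integral_maternSpectral {v φ ν : ℝ} (hφ : 0 < φ) (hν : 0 < ν) (x : ℕ → E)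
    (k l : ℕ) : matern v φ ν ‖x k - x l‖ =
      ∫ w, maternSpectral v φ ν w * Real.cos (inner ℝ (x k - x l) w) :=
  matern_eq_integral_cos hφ hν _

theorem matern_comm (v φ ν : ℝ) (x : ℕ → E) (k l : ℕ) :
    matern v φ ν ‖x k - x l‖ = matern v φ ν ‖x l - x k‖ := by
  rw [norm_sub_rev]

theorem exists_norm_expSum_sq_mul_maternSpectral_le {v φ ν : ℝ} (hv : 0 < v) (hφ : 0 < φ)
    (hν : 0 < ν) {D : Set E} (hD : Bornology.IsBounded D) :
    ∃ B : ℝ, 0 < B ∧ ∀ (x : ℕ → E) (n : ℕ), (∀ k < n, x k ∈ D) → ∀ (c : ℕ → ℝ) (w : E),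
      ‖expSum x n c w‖ ^ 2 * maternSpectral v φ ν w ≤
        B * covForm (fun k l => matern v φ ν ‖x k - x l‖) n c c := by
  obtain ⟨K, m, hmod⟩ := exists_maternSpectral_moderate (E := E) hv hφ hν
  obtain ⟨B, hB, h⟩ := exists_norm_expSum_sq_mul_le (continuous_maternSpectral hφ)
    (maternSpectral_pos hv hφ hν) (integrable_maternSpectral hφ hν) hmod hD
  refine ⟨B, hB, fun x n hx c w => ?_⟩
  rw [covForm_self_eq_integral (integrable_maternSpectral hφ hν)
    (matern_eq_integral_maternSpectral hφ hν x)]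
  exact h x n hx c w

/-- Matérn covariance matrices at distinct locations are strictly positive definite. -/
theorem covForm_matern_pos {v φ ν : ℝ} (hv : 0 < v) (hφ : 0 < φ) (hν : 0 < ν) {x : ℕ → E} {n : ℕ}
    (hx : Set.InjOn x (Set.Iio n)) {c : ℕ → ℝ} (hc : ∃ k < n, c k ≠ 0) :
    0 < covForm (fun k l => matern v φ ν ‖x k - x l‖) n c c := by
  by_contra! hle
  -- Finitely many locations form a bounded set, so the pointwise bound applies: a form that is not
  -- positive forces the exponential sum to vanish everywhere.
  obtain ⟨B, hB, h⟩ := exists_norm_expSum_sq_mul_maternSpectral_le hv hφ hν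
    ((Set.finite_Iio n).image x).isBounded
  obtain ⟨k, hk, hck⟩ := hc
  refine hck (eq_zero_of_expSum_eq_zero hx (fun w => ?_) k hk)
  have h1 := h x n (fun k hk => Set.mem_image_of_mem x hk) c w
  have h2 := maternSpectral_pos hv hφ hν w
  have h3 : ‖expSum x n c w‖ ^ 2 * maternSpectral v φ ν w ≤ 0 := h1.trans (by nlinarith)
  by_contra hne
  have : 0 < ‖expSum x n c w‖ ^ 2 * maternSpectral v φ ν w := by
    have := norm_pos_iff.2 hne
    positivity
  linarith

/-- The constant is uniform in the design and in n. It bounds the variance ratios p_i / t_i and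
allows passing between the two alternative assumptions. -/
theorem exists_covForm_matern_le {v₀ v₁ φ₀ φ₁ ν : ℝ} (hv₀ : 0 < v₀) (hv₁ : 0 < v₁) (hφ₀ : 0 < φ₀)
    (hφ₁ : 0 < φ₁) (hν : 0 < ν) :
    ∃ K : ℝ, 0 < K ∧ ∀ (x : ℕ → E) (n : ℕ) (c : ℕ → ℝ),
      covForm (fun k l => matern v₀ φ₀ ν ‖x k - x l‖) n c c ≤
        K * covForm (fun k l => matern v₁ φ₁ ν ‖x k - x l‖) n c c := by
  obtain ⟨K, hK, h⟩ := exists_maternSpectral_le (E := E) hv₀ hv₁ hφ₀ hφ₁ hν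
  exact ⟨K, hK, fun x n c => covForm_self_le (integrable_maternSpectral hφ₀ hν)
    (integrable_maternSpectral hφ₁ hν) h (matern_eq_integral_maternSpectral hφ₀ hν x)
    (matern_eq_integral_maternSpectral hφ₁ hν x) n c⟩

theorem covForm_add_self {C : ℕ → ℕ → ℝ} (hC : ∀ k l, C k l = C l k) (n : ℕ) (a b : ℕ → ℝ) :
    covForm C n (fun k => a k + b k) (fun k => a k + b k) =
      covForm C n a a + 2 * covForm C n a b + covForm C n b b := by
  rw [covForm_add_left, covForm_add_right, covForm_add_right, covForm_comm hC n b a]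
  ring

/-- In dimension at most three, two Matérn models with the same microergodic parameter assign
nearly the same variances to the members of an orthogonal family, up to a total relative error of
order `n ^ (3 / 7)`. -/
theorem exists_abs_covForm_matern_sub_le (hdim : Module.finrank ℝ E ≤ 3) {v₀ v₁ φ₀ φ₁ ν : ℝ}
    (hv₀ : 0 < v₀) (hv₁ : 0 < v₁) (hφ₀ : 0 < φ₀) (hφ₁ : 0 < φ₁) (hν : 0 < ν)
    (hv : v₁ * φ₁ ^ (2 * ν) = v₀ * φ₀ ^ (2 * ν)) {D : Set E} (hD : Bornology.IsBounded D) :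
    ∃ K : ℝ, 0 < K ∧ ∀ (x : ℕ → E) (n : ℕ), 0 < n → (∀ k < n, x k ∈ D) →
      ∀ e δ : ℕ → ℕ → ℝ,
      (∀ i < n, ∀ j < n, i ≠ j →
        covForm (fun k l => matern v₀ φ₀ ν ‖x k - x l‖) n (e i) (e j) = 0) →
      (∀ i < n, 0 < covForm (fun k l => matern v₀ φ₀ ν ‖x k - x l‖) n (e i) (e i)) →
      (∀ i < n, covForm (fun k l => matern v₀ φ₀ ν ‖x k - x l‖) n (e i) (δ i) = 0) →
      ∃ W : ℕ → ℝ, (∀ i, 0 ≤ W i) ∧ ∑ i ∈ Finset.range n, W i ≤ K * (n : ℝ) ^ (3 / 7 : ℝ) ∧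
        ∀ i < n, |covForm (fun k l => matern v₁ φ₁ ν ‖x k - x l‖) n
            (fun k => e i k + δ i k) (fun k => e i k + δ i k)
          - covForm (fun k l => matern v₀ φ₀ ν ‖x k - x l‖) n (e i) (e i)| ≤
          K * (covForm (fun k l => matern v₀ φ₀ ν ‖x k - x l‖) n (e i) (e i) * W i
            + covForm (fun k l => matern v₀ φ₀ ν ‖x k - x l‖) n (δ i) (δ i)) := by
  obtain ⟨B, hB, hbd⟩ := exists_norm_expSum_sq_mul_maternSpectral_le hv₀ hφ₀ hν hD
  obtain ⟨K₁, hK₁, hdiff⟩ := exists_abs_maternSpectral_sub_le (E := E) hv₀ hφ₀ hφ₁ hν hv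
  obtain ⟨K₂, hK₂, hcomp⟩ := exists_covForm_matern_le (E := E) hv₁ hv₀ hφ₁ hφ₀ hν
  set I := ∫ w : E, (1 + ‖w‖ ^ 2) ^ (-(7 / 2 : ℝ) / 2) with hI
  have hI0 : 0 ≤ I := integral_nonneg fun w => by positivity
  set K := 2 * K₁ + K₂ + (1 + 2 * B * I) with hKdef
  refine ⟨K, by positivity, fun x n hn hx e δ horth hpos hδ => ?_⟩
  set C₀ : ℕ → ℕ → ℝ := fun k l => matern v₀ φ₀ ν ‖x k - x l‖ with hC₀
  set C₁ : ℕ → ℕ → ℝ := fun k l => matern v₁ φ₁ ν ‖x k - x l‖ with hC₁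
  have hs₀ := matern_eq_integral_maternSpectral (v := v₀) hφ₀ hν x
  have hs₁ := matern_eq_integral_maternSpectral (v := v₁) hφ₁ hν x
  have hi₀ := integrable_maternSpectral (E := E) (v := v₀) hφ₀ hν
  have hi₁ := integrable_maternSpectral (E := E) (v := v₁) hφ₁ hν
  have hf₀ := maternSpectral_pos (E := E) hv₀ hφ₀ hν
  -- Normalising the e_i makes them orthonormal, as the kernel bound requires; `W i` below is the
  -- tail form of the normalised vector.
  set r : ℕ → ℝ := fun i => (√(covForm C₀ n (e i) (e i)))⁻¹ with hr
  have hr2 : ∀ i < n, covForm C₀ n (e i) (e i) * r i ^ 2 = 1 := fun i hi => by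
    simp only [hr]
    rw [inv_pow, Real.sq_sqrt (hpos i hi).le, mul_inv_cancel₀ (hpos i hi).ne']
  have hsum := sum_tailForm_le hdim hi₀ hf₀ hB hn hs₀ (hbd x n hx)
    (c := fun i k => r i * e i k) (by
      intro i hi j hj
      rw [covForm_mul_left, covForm_mul_right]
      split_ifs with h
      · subst h
        rw [← hr2 i hi]
        ring
      · rw [horth i hi j hj h, mul_zero, mul_zero])
  rw [← hI] at hsum
  refine ⟨fun i => tailForm (maternSpectral v₀ φ₀ ν) x n (fun k => r i * e i k),
    fun i => tailForm_nonneg hf₀ x n _, hsum.trans ?_, fun i hi => ?_⟩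
  · gcongr
    rw [hKdef]
    linarith
  · have h1 := abs_covForm_self_sub_le hi₀ hi₁ hdiff hs₀ hs₁ n (e i)
    have h2 := abs_covForm_sub_le hi₀ hi₁ hf₀ hdiff hK₁.le hs₀ hs₁ n (e i) (δ i)
    have h3 := hcomp x n (δ i)
    have h4 : 0 ≤ covForm C₁ n (δ i) (δ i) := by
      rw [covForm_self_eq_integral hi₁ hs₁]
      exact integral_nonneg fun w =>
        mul_nonneg (sq_nonneg _) (maternSpectral_pos hv₁ hφ₁ hν w).le
    have h5 : 0 ≤ covForm C₀ n (δ i) (δ i) := by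
      rw [covForm_self_eq_integral hi₀ hs₀]
      exact integral_nonneg fun w => mul_nonneg (sq_nonneg _) (hf₀ w).le
    have h6 := tailForm_nonneg hf₀ x n (e i)
    change |covForm C₁ n (e i) (δ i) - covForm C₀ n (e i) (δ i)| ≤ _ at h2
    -- Orthogonality of e_i and δ_i under `C₀` removes that cross term, so the cross term under `C₁`
    -- is itself a difference of forms and hence small.
    rw [hδ i hi, sub_zero] at h2
    beta_reduce
    rw [covForm_add_self (matern_comm v₁ φ₁ ν x), tailForm_mul, ← mul_assoc, hr2 i hi, one_mul]
    set T := tailForm (maternSpectral v₀ φ₀ ν) x n (e i)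
    change |covForm C₁ n (e i) (e i) - covForm C₀ n (e i) (e i)| ≤ _ at h1
    change covForm C₁ n (δ i) (δ i) ≤ K₂ * covForm C₀ n (δ i) (δ i) at h3
    have hKT : (2 * K₁ + K₂) * (T + covForm C₀ n (δ i) (δ i)) ≤
        K * (T + covForm C₀ n (δ i) (δ i)) := by
      refine mul_le_mul_of_nonneg_right ?_ (by positivity)
      have : 0 ≤ 2 * B * I := by positivity
      linarith
    refine le_trans ?_ hKT
    have hcross := abs_le.1 h2
    have hself := abs_le.1 h1
    have hT : 0 ≤ K₂ * T := by positivity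
    have hT1 : 0 ≤ K₁ * T := by positivity
    have hd : 0 ≤ K₁ * covForm C₀ n (δ i) (δ i) := by positivity
    have hd2 : 0 ≤ K₂ * covForm C₀ n (δ i) (δ i) := by positivity
    rw [abs_le]
    constructor <;> nlinarith [hcross.1, hcross.2, hself.1, hself.2]

end MaternForms

/-! ### Linear regression and Vecchia's likelihood -/

/-- The matrix `(C k l)`, `k, l < n`, is symmetric and positive definite. -/
structure IsPosDefBelow (C : ℕ → ℕ → ℝ) (n : ℕ) : Prop where
  symm : ∀ k l, C k l = C l k
  pos : ∀ c : ℕ → ℝ, (∃ k < n, c k ≠ 0) → 0 < covForm C n c c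

/-- The restriction of the matrix `C` to `A`. -/
def subMatrix (C : ℕ → ℕ → ℝ) (A : Finset ℕ) : Matrix A A ℝ := Matrix.of fun a b => C a b

/-- Extension by zero. -/
def extendZero (A : Finset ℕ) (z : A → ℝ) (k : ℕ) : ℝ := if h : k ∈ A then z ⟨k, h⟩ else 0

/-- The value at `x` of the linear form with coefficients `c k`, `k < n`. -/
def linVal (n : ℕ) (c x : ℕ → ℝ) : ℝ := ∑ k ∈ Finset.range n, c k * x k

/-- The coefficients of the best linear predictor of coordinate `i` from the coordinates in `A`. -/
noncomputable def regCoef (C : ℕ → ℕ → ℝ) (A : Finset ℕ) (i : ℕ) : A → ℝ :=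
  (subMatrix C A)⁻¹.mulVec fun a => C a i

/-- The coefficients of the error of the best linear predictor of coordinate `i` from the
coordinates in `A`. -/
noncomputable def errCoef (C : ℕ → ℕ → ℝ) (A : Finset ℕ) (i k : ℕ) : ℝ :=
  (if k = i then 1 else 0) - extendZero A (regCoef C A i) k

theorem extendZero_coe {A : Finset ℕ} (z : A → ℝ) (a : A) : extendZero A z a = z a := by
  simp [extendZero]

theorem extendZero_of_notMem {A : Finset ℕ} (z : A → ℝ) {k : ℕ} (hk : k ∉ A) :
    extendZero A z k = 0 := by
  simp [extendZero, hk]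

theorem sum_extendZero_mul {A : Finset ℕ} {n : ℕ} (hA : A ⊆ Finset.range n) (z : A → ℝ)
    (g : ℕ → ℝ) : ∑ k ∈ Finset.range n, extendZero A z k * g k = ∑ a : A, z a * g a := by
  rw [← Finset.sum_subset hA fun k _ hk => by rw [extendZero_of_notMem z hk, zero_mul],
    ← Finset.sum_coe_sort]
  exact Finset.sum_congr rfl fun a _ => by rw [extendZero_coe]

theorem covForm_extendZero {A : Finset ℕ} {n : ℕ} (hA : A ⊆ Finset.range n) (C : ℕ → ℕ → ℝ)
    (z z' : A → ℝ) : covForm C n (extendZero A z) (extendZero A z') =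
      z ⬝ᵥ (subMatrix C A).mulVec z' := by
  rw [covForm_eq_sum_left, sum_extendZero_mul hA]
  refine Finset.sum_congr rfl fun a _ => ?_
  rw [sum_extendZero_mul hA]
  refine congrArg _ (Finset.sum_congr rfl fun b _ => ?_)
  exact mul_comm _ _

namespace IsPosDefBelow

variable {C : ℕ → ℕ → ℝ} {n : ℕ} {A : Finset ℕ}

theorem posDef (h : IsPosDefBelow C n) (hA : A ⊆ Finset.range n) : (subMatrix C A).PosDef := by
  refine Matrix.PosDef.of_dotProduct_mulVec_pos ?_ fun z hz => ?_
  · ext a b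
    simp [subMatrix, h.symm b.1 a.1]
  · rw [star_trivial, ← covForm_extendZero hA]
    obtain ⟨a, ha⟩ := Function.ne_iff.1 hz
    exact h.pos _ ⟨a, Finset.mem_range.1 (hA a.2), by rwa [extendZero_coe]⟩

theorem isUnit_det (h : IsPosDefBelow C n) (hA : A ⊆ Finset.range n) :
    IsUnit (subMatrix C A).det := (h.posDef hA).det_pos.ne'.isUnit

theorem sum_extendZero_inv_mul (h : IsPosDefBelow C n) (hA : A ⊆ Finset.range n) (z : A → ℝ)
    (a : A) : ∑ k ∈ Finset.range n, extendZero A ((subMatrix C A)⁻¹.mulVec z) k * C k a = z a := by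
  rw [sum_extendZero_mul hA (g := fun k => C k a)]
  have h1 : ((subMatrix C A).mulVec ((subMatrix C A)⁻¹.mulVec z)) a = z a := by
    rw [Matrix.mulVec_mulVec, Matrix.mul_nonsing_inv _ (h.isUnit_det hA), Matrix.one_mulVec]
  rw [← h1]
  refine Finset.sum_congr rfl fun b _ => ?_
  rw [mul_comm, h.symm]
  rfl

/-- The prediction error is uncorrelated with the predictors. -/
theorem sum_errCoef_mul (h : IsPosDefBelow C n) (hA : A ⊆ Finset.range n) {i : ℕ} (hi : i < n)
    {a : ℕ} (ha : a ∈ A) : ∑ k ∈ Finset.range n, errCoef C A i k * C k a = 0 := by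
  have h1 := h.sum_extendZero_inv_mul hA (fun a => C a i) ⟨a, ha⟩
  simp only [errCoef, sub_mul, Finset.sum_sub_distrib]
  change _ - ∑ k ∈ Finset.range n, extendZero A ((subMatrix C A)⁻¹.mulVec _) k * C k a = 0
  rw [h1]
  simp [hi, h.symm i a]

theorem covForm_errCoef_of_support (h : IsPosDefBelow C n) (hA : A ⊆ Finset.range n) {i : ℕ}
    (hi : i < n) {c : ℕ → ℝ} (hc : ∀ k, k ∉ A → c k = 0) :
    covForm C n (errCoef C A i) c = 0 := by
  rw [covForm_comm h.symm, covForm_eq_sum_left]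
  refine Finset.sum_eq_zero fun k _ => ?_
  by_cases hk : k ∈ A
  · simp only [h.symm k]
    rw [h.sum_errCoef_mul hA hi hk, mul_zero]
  · rw [hc k hk, zero_mul]

end IsPosDefBelow

theorem errCoef_self {C : ℕ → ℕ → ℝ} {A : Finset ℕ} {i : ℕ} (hi : i ∉ A) : errCoef C A i i = 1 := by
  simp [errCoef, extendZero_of_notMem _ hi]

theorem errCoef_of_notMem {C : ℕ → ℕ → ℝ} {A : Finset ℕ} {i k : ℕ} (hk : k ∉ A) (hki : k ≠ i) :
    errCoef C A i k = 0 := by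
  simp [errCoef, extendZero_of_notMem _ hk, hki]

namespace IsPosDefBelow

variable {C : ℕ → ℕ → ℝ} {n : ℕ} {A : Finset ℕ}

theorem covForm_errCoef_pos (h : IsPosDefBelow C n) {i : ℕ} (hi : i < n) (hiA : i ∉ A) :
    0 < covForm C n (errCoef C A i) (errCoef C A i) :=
  h.pos _ ⟨i, hi, by rw [errCoef_self hiA]; exact one_ne_zero⟩

/-- The error is uncorrelated with the predictor, so its variance equals its covariance with the
predicted coordinate. -/
theorem covForm_errCoef_self (h : IsPosDefBelow C n) (hA : A ⊆ Finset.range n) {i : ℕ}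
    (hi : i < n) : covForm C n (errCoef C A i) (errCoef C A i) =
      ∑ k ∈ Finset.range n, errCoef C A i k * C k i := by
  have h1 : covForm C n (errCoef C A i) (fun k => errCoef C A i k
      + extendZero A (regCoef C A i) k) = covForm C n (errCoef C A i) (errCoef C A i) := by
    rw [covForm_add_right, h.covForm_errCoef_of_support hA hi fun k hk =>
      extendZero_of_notMem _ hk, add_zero]
  rw [← h1, covForm_eq_sum_left]
  refine Finset.sum_congr rfl fun k _ => ?_
  congr 1
  simp [errCoef, hi]

/-- One step of Gaussian elimination: adding coordinate `i` to the quadratic form adds the squared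
standardised prediction error. -/
theorem dotProduct_inv_mulVec_insert (h : IsPosDefBelow C n) {i : ℕ} (hi : i < n) (hiA : i ∉ A)
    (hA : A ⊆ Finset.range n) (x : ℕ → ℝ) :
    (fun a : (insert i A : Finset ℕ) => x a) ⬝ᵥ (subMatrix C (insert i A))⁻¹.mulVec
        (fun a => x a) =
      (fun a : A => x a) ⬝ᵥ (subMatrix C A)⁻¹.mulVec (fun a => x a)
        + linVal n (errCoef C A i) x ^ 2 / covForm C n (errCoef C A i) (errCoef C A i) := by
  have hA' : insert i A ⊆ Finset.range n := Finset.insert_subset (Finset.mem_range.2 hi) hA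
  set τ := covForm C n (errCoef C A i) (errCoef C A i) with hτ
  have hτ0 : 0 < τ := h.covForm_errCoef_pos hi hiA
  set ℓ := linVal n (errCoef C A i) x with hℓ
  set q : A → ℝ := (subMatrix C A)⁻¹.mulVec (fun a => x a) with hq
  -- The solution of the enlarged linear system. The error has covariance 0 with `A` and τ with `i`,
  -- so the second term repairs coordinate `i` without disturbing those in `A`.
  set p : ℕ → ℝ := fun k => extendZero A q k + ℓ / τ * errCoef C A i k with hp
  have hp0 : ∀ k, k ∉ insert i A → p k = 0 := fun k hk => by
    rw [Finset.mem_insert, not_or] at hk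
    rw [hp]
    simp only
    rw [extendZero_of_notMem _ hk.2, errCoef_of_notMem hk.2 hk.1]
    ring
  have hpsum : ∀ g : ℕ → ℝ, ∑ k ∈ Finset.range n, p k * g k =
      ∑ a : (insert i A : Finset ℕ), p a * g a := fun g => by
    rw [← Finset.sum_subset hA' fun k _ hk => by rw [hp0 k hk, zero_mul], ← Finset.sum_coe_sort]
  have hpC : ∀ b, ∑ k ∈ Finset.range n, p k * C k b =
      ∑ k ∈ Finset.range n, extendZero A q k * C k b
        + ℓ / τ * ∑ k ∈ Finset.range n, errCoef C A i k * C k b := fun b => by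
    simp only [hp, add_mul, Finset.sum_add_distrib, Finset.mul_sum, mul_assoc]
  have hqi : ∑ k ∈ Finset.range n, extendZero A q k * C k i =
      ∑ k ∈ Finset.range n, extendZero A (regCoef C A i) k * x k := by
    rw [sum_extendZero_mul hA (g := fun k => C k i), sum_extendZero_mul hA]
    change q ⬝ᵥ (fun a : A => C a i) = regCoef C A i ⬝ᵥ fun a : A => x a
    rw [hq, regCoef, dotProduct_comm, Matrix.dotProduct_mulVec, ← Matrix.mulVec_transpose,
      Matrix.transpose_nonsing_inv]
    congr 3
    ext a b
    simp [subMatrix, h.symm b.1 a.1]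
  have hVp : ∀ b ∈ insert i A, ∑ k ∈ Finset.range n, p k * C k b = x b := by
    intro b hb
    rw [hpC]
    rcases Finset.mem_insert.1 hb with rfl | hb
    · rw [← h.covForm_errCoef_self hA hi, ← hτ, div_mul_cancel₀ _ hτ0.ne', hqi, hℓ, linVal]
      simp only [errCoef, sub_mul, Finset.sum_sub_distrib]
      simp [hi]
    · rw [h.sum_errCoef_mul hA hi hb, mul_zero, add_zero]
      exact h.sum_extendZero_inv_mul hA (fun a => x a) ⟨b, hb⟩
  have hmul : (subMatrix C (insert i A)).mulVec (fun a => p a) =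
      fun a : (insert i A : Finset ℕ) => x a := by
    funext b
    rw [← hVp b b.2, hpsum fun k => C k b]
    refine Finset.sum_congr rfl fun a _ => ?_
    rw [mul_comm (p a), h.symm]
    rfl
  rw [← hmul, Matrix.mulVec_mulVec, Matrix.nonsing_inv_mul _ (h.isUnit_det hA'), Matrix.one_mulVec,
    hmul, dotProduct_comm]
  change ∑ a : (insert i A : Finset ℕ), p a * x a = _
  rw [← hpsum, dotProduct_comm]
  simp only [hp, add_mul, Finset.sum_add_distrib]
  rw [sum_extendZero_mul hA, sq, mul_div_right_comm]
  congr 1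
  rw [hℓ, linVal, Finset.mul_sum]
  simp only [mul_assoc]

end IsPosDefBelow

theorem gaussDensity_scale {C : ℕ → ℕ → ℝ} {n : ℕ} {A : Finset ℕ} (h : IsPosDefBelow C n)
    (hA : A ⊆ Finset.range n) {t : ℝ} (ht : 0 < t) (x : ℕ → ℝ) :
    gaussDensity (fun a b => t * C a b) A x =
      (√((2 * Real.pi) ^ A.card * (subMatrix C A).det) * √t ^ A.card)⁻¹ *
        Real.exp (-((fun a : A => x a) ⬝ᵥ (subMatrix C A)⁻¹.mulVec (fun a => x a)) / (2 * t)) := by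
  have hV : (Matrix.of fun a b : A => t * C a b) = t • subMatrix C A := by
    ext a b
    simp [subMatrix]
  have hdet := (h.posDef hA).det_pos
  simp only [gaussDensity]
  rw [hV, Matrix.det_smul, Fintype.card_coe]
  let _ := invertibleOfNonzero ht.ne'
  rw [Matrix.inv_smul _ t (h.isUnit_det hA), invOf_eq_inv, Matrix.smul_mulVec, dotProduct_smul,
    smul_eq_mul]
  congr 2
  · rw [← mul_assoc, mul_right_comm, Real.sqrt_mul (by positivity)]
    congr 1
    rw [Real.sqrt_eq_iff_mul_self_eq (by positivity) (by positivity), ← mul_pow,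
      Real.mul_self_sqrt ht.le]
  · field_simp

/-- In the quotient of the two densities the common quadratic form cancels and, the cardinalities
differing by one, a single factor (√t)⁻¹ survives. It matters that `κ` depends on neither `x` nor
`t`. -/
theorem exists_condGaussDensity_scale {C : ℕ → ℕ → ℝ} {n : ℕ} {A : Finset ℕ}
    (h : IsPosDefBelow C n) (hA : A ⊆ Finset.range n) {i : ℕ} (hi : i < n) (hiA : i ∉ A) :
    ∃ κ : ℝ, 0 < κ ∧ ∀ (x : ℕ → ℝ) (t : ℝ), 0 < t →
      condGaussDensity (fun a b => t * C a b) A i x = κ * (√t)⁻¹ *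
        Real.exp (-(linVal n (errCoef C A i) x ^ 2
          / covForm C n (errCoef C A i) (errCoef C A i)) / (2 * t)) := by
  have hA' : insert i A ⊆ Finset.range n := Finset.insert_subset (Finset.mem_range.2 hi) hA
  have hd := (h.posDef hA).det_pos
  have hd' := (h.posDef hA').det_pos
  set s := √((2 * Real.pi) ^ A.card * (subMatrix C A).det) with hs
  set s' := √((2 * Real.pi) ^ (insert i A).card * (subMatrix C (insert i A)).det) with hs'
  have hs0 : 0 < s := Real.sqrt_pos.2 (by positivity)
  have hs0' : 0 < s' := Real.sqrt_pos.2 (by positivity)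
  refine ⟨s / s', by positivity, fun x t ht => ?_⟩
  have htp : 0 < √t := Real.sqrt_pos.2 ht
  rw [condGaussDensity, gaussDensity_scale h hA ht, gaussDensity_scale h hA' ht,
    h.dotProduct_inv_mulVec_insert hi hiA hA, ← hs, ← hs', Finset.card_insert_of_notMem hiA]
  set Q := (fun a : A => x a) ⬝ᵥ (subMatrix C A)⁻¹.mulVec (fun a => x a)
  set R := linVal n (errCoef C A i) x ^ 2 / covForm C n (errCoef C A i) (errCoef C A i)
  have hexp : Real.exp (-(Q + R) / (2 * t)) =
      Real.exp (-Q / (2 * t)) * Real.exp (-R / (2 * t)) := by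
    rw [← Real.exp_add]
    ring_nf
  rw [hexp, pow_succ]
  have := (Real.exp_pos (-Q / (2 * t))).ne'
  field_simp

/-- The sum of the squared standardised prediction errors in Vecchia's approximation. -/
noncomputable def vecchiaQuad (C : ℕ → ℕ → ℝ) (N : ℕ → Finset ℕ) (n : ℕ) (x : ℕ → ℝ) : ℝ :=
  ∑ i ∈ Finset.range n, linVal n (errCoef C (N i) i) x ^ 2
    / covForm C n (errCoef C (N i) i) (errCoef C (N i) i)

theorem exists_vecchiaLik_scale {C : ℕ → ℕ → ℝ} {n : ℕ} {N : ℕ → Finset ℕ}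
    (h : IsPosDefBelow C n) (hN : ∀ i < n, N i ⊆ Finset.range i) :
    ∃ κ : ℝ, 0 < κ ∧ ∀ (x : ℕ → ℝ) (t : ℝ), 0 < t →
      vecchiaLik (fun a b => t * C a b) N n x =
        κ * ((√t)⁻¹ ^ n * Real.exp (-vecchiaQuad C N n x / (2 * t))) := by
  have hcond : ∀ i ∈ Finset.range n, ∃ κ : ℝ, 0 < κ ∧ ∀ (x : ℕ → ℝ) (t : ℝ), 0 < t →
      condGaussDensity (fun a b => t * C a b) (N i) i x = κ * (√t)⁻¹ *
        Real.exp (-(linVal n (errCoef C (N i) i) x ^ 2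
          / covForm C n (errCoef C (N i) i) (errCoef C (N i) i)) / (2 * t)) := fun i hi => by
    have hi := Finset.mem_range.1 hi
    refine exists_condGaussDensity_scale h
      ((hN i hi).trans (Finset.range_subset_range.2 hi.le)) hi fun hmem => ?_
    exact lt_irrefl i (Finset.mem_range.1 (hN i hi hmem))
  choose! κ hκ hκ' using hcond
  refine ⟨∏ i ∈ Finset.range n, κ i, Finset.prod_pos hκ, fun x t ht => ?_⟩
  rw [vecchiaLik, Finset.prod_congr rfl fun i hi => hκ' i hi x t ht, Finset.prod_mul_distrib,
    Finset.prod_mul_distrib, Finset.prod_const, Finset.card_range, ← Real.exp_sum, mul_assoc]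
  congr 4
  rw [vecchiaQuad, neg_div, Finset.sum_div, ← Finset.sum_neg_distrib]
  simp only [neg_div]

/-- The scaled inverse-gamma kernel has a unique maximum. -/
theorem inv_sqrt_pow_mul_exp_lt {n : ℕ} (hn : 1 ≤ n) {Q t : ℝ} (hQ : 0 < Q) (ht : 0 < t)
    (hne : t ≠ Q / n) :
    (√t)⁻¹ ^ n * Real.exp (-Q / (2 * t)) <
      (√(Q / n))⁻¹ ^ n * Real.exp (-Q / (2 * (Q / n))) := by
  have hn0 : (0 : ℝ) < n := by exact_mod_cast hn
  have hform : ∀ s : ℝ, 0 < s → (√s)⁻¹ ^ n * Real.exp (-Q / (2 * s)) =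
      Real.exp (-(n / 2 : ℝ) * Real.log s - Q / (2 * s)) := by
    intro s hs
    have h1 : (√s)⁻¹ ^ n = Real.exp (-(n / 2 : ℝ) * Real.log s) := by
      have : -(n / 2 : ℝ) * Real.log s = n * -(Real.log √s) := by
        rw [Real.log_sqrt hs.le]
        ring
      rw [this, Real.exp_nat_mul, Real.exp_neg, Real.exp_log (Real.sqrt_pos.2 hs)]
    rw [h1, ← Real.exp_add]
    ring_nf
  rw [hform t ht, hform _ (by positivity), Real.exp_lt_exp]
  have hr : Q / n / t ≠ 1 := fun h => hne (by rw [div_eq_one_iff_eq ht.ne'] at h; exact h.symm)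
  -- With u = (Q/n)/t, the comparison of exponents is exactly the strict inequality log u < u - 1
  -- for u ≠ 1.
  have hlog := Real.log_lt_sub_one_of_pos (show 0 < Q / n / t by positivity) hr
  rw [Real.log_div (by positivity) ht.ne'] at hlog
  have h2 : Q / (2 * (Q / n)) = n / 2 := by field_simp
  have h3 : Q / (2 * t) = n / 2 * (Q / n / t) := by field_simp
  rw [h2, h3]
  nlinarith

theorem matern_eq_mul (v w φ ν r : ℝ) (hv : v ≠ 0) : matern w φ ν r = w / v * matern v φ ν r := by
  unfold matern
  split_ifs <;> field_simp

/-- Linearity in the variance lets w = v t be parametrised by t, with the error coefficients fixed.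
For Q = 0 the likelihood would blow up as t → 0, hence the positivity assumption. -/
theorem isVecchiaMLE_iff {E : Type*} [SeminormedAddCommGroup E] {v φ ν : ℝ} (hv : 0 < v)
    {s : ℕ → E} {N : ℕ → Finset ℕ} {n : ℕ} (hn : 1 ≤ n)
    (h : IsPosDefBelow (fun a b => matern v φ ν ‖s a - s b‖) n)
    (hN : ∀ i < n, N i ⊆ Finset.range i) {x : ℕ → ℝ}
    (hQ : 0 < vecchiaQuad (fun a b => matern v φ ν ‖s a - s b‖) N n x) (w : ℝ) :
    IsVecchiaMLE φ ν s N n x w ↔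
      w = v * (vecchiaQuad (fun a b => matern v φ ν ‖s a - s b‖) N n x / n) := by
  obtain ⟨κ, hκ, hlik⟩ := exists_vecchiaLik_scale h hN
  set Q := vecchiaQuad (fun a b => matern v φ ν ‖s a - s b‖) N n x with hQdef
  have hn0 : (0 : ℝ) < n := by exact_mod_cast hn
  have hlik' : ∀ u : ℝ, 0 < u → vecchiaLik (fun a b => matern u φ ν ‖s a - s b‖) N n x =
      κ * ((√(u / v))⁻¹ ^ n * Real.exp (-Q / (2 * (u / v)))) := fun u hu => by
    rw [← hlik x (u / v) (by positivity)]
    simp only [← matern_eq_mul v u φ ν _ hv.ne']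
  have hmax : ∀ u : ℝ, 0 < u → u ≠ v * (Q / n) →
      vecchiaLik (fun a b => matern u φ ν ‖s a - s b‖) N n x <
        vecchiaLik (fun a b => matern (v * (Q / n)) φ ν ‖s a - s b‖) N n x := by
    intro u hu hne
    rw [hlik' u hu, hlik' _ (by positivity), mul_div_cancel_left₀ _ hv.ne']
    refine mul_lt_mul_of_pos_left (inv_sqrt_pow_mul_exp_lt hn hQ (by positivity) ?_) hκ
    rw [Ne, div_eq_iff hv.ne', mul_comm]
    exact hne
  have hpos : 0 < v * (Q / n) := by positivity
  constructor
  · rintro ⟨hw, hwmax⟩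
    by_contra hne
    have hle : vecchiaLik (fun a b => matern (v * (Q / n)) φ ν ‖s a - s b‖) N n x ≤
        vecchiaLik (fun a b => matern w φ ν ‖s a - s b‖) N n x := hwmax (Set.mem_Ioi.2 hpos)
    exact absurd hle (not_le.2 (hmax w hw hne))
  · rintro rfl
    refine ⟨hpos, fun u hu => ?_⟩
    change vecchiaLik (fun a b => matern u φ ν ‖s a - s b‖) N n x ≤ _
    rcases eq_or_ne u (v * (Q / n)) with rfl | hne
    · exact le_rfl
    · exact (hmax u hu hne).le

/-! ### Linear forms of centred Gaussian processes -/

theorem linVal_add (n : ℕ) (c c' x : ℕ → ℝ) :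
    linVal n (fun k => c k + c' k) x = linVal n c x + linVal n c' x := by
  simp only [linVal, add_mul, Finset.sum_add_distrib]

theorem linVal_sub (n : ℕ) (c c' x : ℕ → ℝ) :
    linVal n (fun k => c k - c' k) x = linVal n c x - linVal n c' x := by
  simp only [linVal, sub_mul, Finset.sum_sub_distrib]

theorem linVal_mul (n : ℕ) (r : ℝ) (c x : ℕ → ℝ) :
    linVal n (fun k => r * c k) x = r * linVal n c x := by
  simp only [linVal, Finset.mul_sum, mul_assoc]

theorem linVal_single {n i : ℕ} (hi : i < n) (x : ℕ → ℝ) :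
    linVal n (fun k => if k = i then 1 else 0) x = x i := by
  simp [linVal, hi]

theorem measurable_linVal_of_support {Ω : Type*} {m : MeasurableSpace Ω} {Y : ℕ → Ω → ℝ}
    {A : Finset ℕ} (hY : ∀ k ∈ A, Measurable[m] (Y k)) (n : ℕ) {c : ℕ → ℝ}
    (hc : ∀ k, k ∉ A → c k = 0) : Measurable[m] fun ω => linVal n c (fun k => Y k ω) := by
  unfold linVal
  refine Finset.measurable_fun_sum _ fun k _ => ?_
  by_cases hk : k ∈ A
  · exact (hY k hk).const_mul _
  · simp only [hc k hk, zero_mul]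
    exact measurable_const

theorem obsSigma_eq_comap {Ω : Type*} (Y : ℕ → Ω → ℝ) (A : Finset ℕ) :
    obsSigma Y id A = MeasurableSpace.comap (fun ω (a : A) => Y a ω) inferInstance := by
  change _ = MeasurableSpace.comap _ (⨆ a : A, MeasurableSpace.comap (fun x : A → ℝ => x a) _)
  rw [MeasurableSpace.comap_iSup, obsSigma, iSup_subtype']
  refine iSup_congr fun a => ?_
  rw [MeasurableSpace.comap_comp]
  rfl

theorem measurable_obsSigma {Ω : Type*} (Y : ℕ → Ω → ℝ) {A : Finset ℕ} {k : ℕ} (hk : k ∈ A) :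
    Measurable[obsSigma Y id A] (Y k) := by
  rw [measurable_iff_comap_le]
  exact le_iSup₂_of_le (f := fun j (_ : j ∈ A) => MeasurableSpace.comap (Y (id j)) inferInstance)
    k hk le_rfl

theorem obsSigma_mono {Ω : Type*} (Y : ℕ → Ω → ℝ) {A B : Finset ℕ} (h : A ⊆ B) :
    obsSigma Y id A ≤ obsSigma Y id B :=
  iSup₂_le fun j hj => le_iSup₂_of_le
    (f := fun j (_ : j ∈ B) => MeasurableSpace.comap (Y (id j)) inferInstance) j (h hj) le_rfl

namespace IsCentredGP

variable {Ω : Type*} [mΩ : MeasurableSpace Ω] {Y : ℕ → Ω → ℝ} {P : Measure Ω}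
  [IsProbabilityMeasure P] {C : ℕ → ℕ → ℝ} {n : ℕ}

theorem comp {T : Type*} {y : T → Ω → ℝ} {K : T → T → ℝ} (h : IsCentredGP y P K) (s : ℕ → T) :
    IsCentredGP (fun k => y (s k)) P (fun k l => K (s k) (s l)) where
  measurable _ := h.measurable _
  gaussian := h.gaussian.comp_right s
  mean_zero _ := h.mean_zero _
  cov_eq _ _ := h.cov_eq _ _

theorem obsSigma_le (h : IsCentredGP Y P C) (A : Finset ℕ) : obsSigma Y id A ≤ mΩ :=
  iSup₂_le fun _ _ => (h.measurable _).comap_le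

theorem measurable_linVal (h : IsCentredGP Y P C) (n : ℕ) (c : ℕ → ℝ) :
    Measurable fun ω => linVal n c (fun k => Y k ω) := by
  have := h.measurable
  unfold linVal
  fun_prop

theorem isGaussianProcess_linVal (h : IsCentredGP Y P C) {ι : Type*} (n : ℕ) (c : ι → ℕ → ℝ) :
    IsGaussianProcess (fun i ω => linVal n (c i) (fun k => Y k ω)) P := by
  refine ⟨fun I => ?_⟩
  let L : (Finset.range n → ℝ) →L[ℝ] (I → ℝ) := ContinuousLinearMap.pi fun i : I =>
    ∑ k : Finset.range n, c i k • ContinuousLinearMap.proj (R := ℝ) (φ := fun _ => ℝ) k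
  have hL : (fun ω => I.restrict fun i => linVal n (c i) fun k => Y k ω) =
      fun ω => L ((Finset.range n).restrict fun k => Y k ω) := by
    funext ω i
    change linVal n (c i) (fun k => Y k ω) = _
    rw [linVal, ← Finset.sum_coe_sort]
    simp [L]
  rw [hL]
  exact (h.gaussian.hasGaussianLaw (Finset.range n)).map_fun L

theorem memLp (h : IsCentredGP Y P C) (k : ℕ) : MemLp (Y k) 2 P :=
  (h.gaussian.hasGaussianLaw_eval k).memLp_two

theorem memLp_linVal (h : IsCentredGP Y P C) (n : ℕ) (c : ℕ → ℝ) :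
    MemLp (fun ω => linVal n c (fun k => Y k ω)) 2 P :=
  memLp_finsetSum _ fun k _ => (h.memLp k).const_mul _

theorem integral_linVal (h : IsCentredGP Y P C) (n : ℕ) (c : ℕ → ℝ) :
    ∫ ω, linVal n c (fun k => Y k ω) ∂P = 0 := by
  simp only [linVal]
  rw [integral_finsetSum _ fun k _ => ((h.memLp k).integrable one_le_two).const_mul _]
  refine Finset.sum_eq_zero fun k _ => ?_
  rw [integral_const_mul, h.mean_zero, mul_zero]

theorem integral_mul (h : IsCentredGP Y P C) (k l : ℕ) : ∫ ω, Y k ω * Y l ω ∂P = C k l := by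
  have h1 := covariance_eq_sub (h.memLp k) (h.memLp l)
  rw [h.cov_eq, h.mean_zero, zero_mul, sub_zero] at h1
  exact h1.symm

theorem integral_linVal_mul (h : IsCentredGP Y P C) (n : ℕ) (c c' : ℕ → ℝ) :
    ∫ ω, linVal n c (fun k => Y k ω) * linVal n c' (fun k => Y k ω) ∂P = covForm C n c c' := by
  have hi : ∀ k l, Integrable (fun ω => c k * c' l * (Y k ω * Y l ω)) P := fun k l =>
    ((h.memLp k).integrable_mul (h.memLp l)).const_mul _
  have hterm : ∀ ω, linVal n c (fun k => Y k ω) * linVal n c' (fun k => Y k ω) =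
      ∑ k ∈ Finset.range n, ∑ l ∈ Finset.range n, c k * c' l * (Y k ω * Y l ω) := fun ω => by
    rw [linVal, linVal, Finset.sum_mul_sum]
    exact Finset.sum_congr rfl fun k _ => Finset.sum_congr rfl fun l _ => by ring
  simp only [hterm]
  rw [integral_finsetSum _ fun k _ => integrable_finsetSum _ fun l _ => hi k l]
  refine Finset.sum_congr rfl fun k _ => ?_
  rw [integral_finsetSum _ fun l _ => hi k l]
  refine Finset.sum_congr rfl fun l _ => ?_
  rw [integral_const_mul, h.integral_mul]

theorem integral_linVal_sq (h : IsCentredGP Y P C) (n : ℕ) (c : ℕ → ℝ) :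
    ∫ ω, linVal n c (fun k => Y k ω) ^ 2 ∂P = covForm C n c c := by
  simp only [sq, h.integral_linVal_mul]

theorem covariance_linVal (h : IsCentredGP Y P C) (n : ℕ) (c c' : ℕ → ℝ) :
    cov[fun ω => linVal n c (fun k => Y k ω), fun ω => linVal n c' (fun k => Y k ω); P] =
      covForm C n c c' := by
  rw [covariance_eq_sub (h.memLp_linVal n c) (h.memLp_linVal n c'), h.integral_linVal, zero_mul,
    sub_zero]
  exact h.integral_linVal_mul n c c'

theorem map_linVal (h : IsCentredGP Y P C) (n : ℕ) (c : ℕ → ℝ) :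
    P.map (fun ω => linVal n c (fun k => Y k ω)) =
      gaussianReal 0 (Real.toNNReal (covForm C n c c)) := by
  have h1 := (h.isGaussianProcess_linVal n (fun _ : Unit => c)).hasGaussianLaw_eval ()
  rw [h1.map_eq_gaussianReal, h.integral_linVal, ← covariance_self
    (h.measurable_linVal n c).aemeasurable, h.covariance_linVal]

/-- Linear forms uncorrelated with the observations in `A` are independent of them. -/
theorem indep_obsSigma (h : IsCentredGP Y P C) {A : Finset ℕ} (hA : A ⊆ Finset.range n)
    {c : ℕ → ℝ} (hc : ∀ a ∈ A, ∑ k ∈ Finset.range n, c k * C k a = 0) :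
    Indep (MeasurableSpace.comap (fun ω => linVal n c (fun k => Y k ω)) inferInstance)
      (obsSigma Y id A) P := by
  have hGP : IsGaussianProcess (Sum.elim (fun (_ : Unit) ω => linVal n c (fun k => Y k ω))
      (fun (a : A) ω => Y a ω)) P := by
    convert h.isGaussianProcess_linVal n
      (Sum.elim (fun (_ : Unit) => c) (fun (a : A) k => if k = a then 1 else 0)) using 1
    funext i ω
    rcases i with _ | a
    · rfl
    · exact (linVal_single (Finset.mem_range.1 (hA a.2)) (fun k => Y k ω)).symm
  have hind := hGP.indepFun_of_covariance_eq_zero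
    (fun _ => (h.measurable_linVal n c).aemeasurable) (fun a => (h.measurable a).aemeasurable)
    (fun _ a => by
      have h1 := h.covariance_linVal n c (fun k => if k = (a : ℕ) then 1 else 0)
      have h2 : (fun ω => linVal n (fun k => if k = (a : ℕ) then 1 else 0) (fun k => Y k ω)) =
          Y a := funext fun ω => linVal_single (Finset.mem_range.1 (hA a.2)) fun k => Y k ω
      rw [h2] at h1
      rw [h1, covForm_eq_sum_left]
      refine Eq.trans ?_ (hc a a.2)
      have han := Finset.mem_range.1 (hA a.2)
      refine Finset.sum_congr rfl fun k _ => ?_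
      simp [han])
  have hind' := hind.comp (φ := fun x : Unit → ℝ => x ()) (ψ := id)
    (measurable_pi_apply (X := fun _ : Unit => ℝ) ()) measurable_id
  rw [IndepFun_iff_Indep] at hind'
  rw [obsSigma_eq_comap]
  exact hind'

/-- The prediction error is the residual of linear regression. -/
theorem predError_ae_eq (h : IsCentredGP Y P C) (hC : IsPosDefBelow C n) {A : Finset ℕ}
    (hA : A ⊆ Finset.range n) {i : ℕ} (hi : i < n) :
    predError P Y id A i =ᵐ[P] fun ω => linVal n (errCoef C A i) (fun k => Y k ω) := by
  set r : Ω → ℝ := fun ω => linVal n (errCoef C A i) (fun k => Y k ω) with hr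
  set L : Ω → ℝ := fun ω => linVal n (extendZero A (regCoef C A i)) (fun k => Y k ω) with hL
  have hm := h.obsSigma_le A
  have hrL : Y i = r + L := by
    funext ω
    simp only [hr, hL, Pi.add_apply]
    rw [← linVal_add]
    simp only [errCoef, sub_add_cancel]
    exact (linVal_single hi fun k => Y k ω).symm
  have hri : Integrable r P := (h.memLp_linVal n _).integrable one_le_two
  have hLi : Integrable L P := (h.memLp_linVal n _).integrable one_le_two
  have hLm : Measurable[obsSigma Y id A] L :=
    measurable_linVal_of_support (A := A) (fun k hk => measurable_obsSigma Y hk) n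
      fun k hk => extendZero_of_notMem _ hk
  have h1 : P[L | obsSigma Y id A] = L :=
    condExp_of_stronglyMeasurable hm hLm.stronglyMeasurable hLi
  -- The regression residual is uncorrelated with, hence for Gaussian processes independent of, the
  -- predictors; its conditional mean is its mean 0.
  have h2 : P[r | obsSigma Y id A] =ᵐ[P] fun _ => ∫ ω, r ω ∂P :=
    condExp_indep_eq (h.measurable_linVal n _).comap_le hm
      (comap_measurable r).stronglyMeasurable
      (h.indep_obsSigma hA fun a ha => hC.sum_errCoef_mul hA hi ha)
  have h3 := condExp_add hri hLi (obsSigma Y id A)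
  filter_upwards [h2, h3] with ω hω2 hω3
  rw [predError]
  change Y i ω - (P[Y i | obsSigma Y id A]) ω = r ω
  rw [hrL, hω3, Pi.add_apply, Pi.add_apply, hω2, h1, h.integral_linVal]
  ring

/-- The coefficients of the standardised errors of the best predictors from the past. -/
noncomputable def _root_.stdErrCoef (C : ℕ → ℕ → ℝ) (n i k : ℕ) : ℝ :=
  (√(covForm C n (errCoef C (Finset.range i) i) (errCoef C (Finset.range i) i)))⁻¹ *
    errCoef C (Finset.range i) i k

/-- The later error is orthogonal to all earlier coordinates, and the earlier error is a combination
of these. -/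
theorem _root_.IsPosDefBelow.covForm_errCoef_range (hC : IsPosDefBelow C n) {i j : ℕ} (hi : i < n)
    (hj : j < n) (hij : i ≠ j) :
    covForm C n (errCoef C (Finset.range i) i) (errCoef C (Finset.range j) j) = 0 := by
  have key : ∀ i j, i < n → j < i →
      covForm C n (errCoef C (Finset.range i) i) (errCoef C (Finset.range j) j) = 0 := by
    intro i j hi hji
    refine hC.covForm_errCoef_of_support (Finset.range_subset_range.2 hi.le) hi fun k hk => ?_
    rw [Finset.mem_range, not_lt] at hk
    refine errCoef_of_notMem ?_ (by omega)
    rw [Finset.mem_range]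
    omega
  rcases lt_or_gt_of_ne hij with h | h
  · rw [covForm_comm hC.symm]
    exact key j i hj h
  · exact key i j hi h

theorem _root_.IsPosDefBelow.covForm_stdErrCoef (hC : IsPosDefBelow C n) {i j : ℕ} (hi : i < n)
    (hj : j < n) : covForm C n (stdErrCoef C n i) (stdErrCoef C n j) = if i = j then 1 else 0 := by
  unfold stdErrCoef
  rw [covForm_mul_left, covForm_mul_right]
  split_ifs with hij
  · subst hij
    have h1 := hC.covForm_errCoef_pos (A := Finset.range i) hi (by simp)
    have h2 := Real.sqrt_pos.2 h1
    have h3 := Real.mul_self_sqrt h1.le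
    field_simp
    rw [sq]
    exact h3.symm
  · rw [hC.covForm_errCoef_range hi hj hij, mul_zero, mul_zero]

theorem map_stdErr (h : IsCentredGP Y P C) (hC : IsPosDefBelow C n) {i : ℕ} (hi : i < n) :
    P.map (fun ω => linVal n (stdErrCoef C n i) (fun k => Y k ω)) = gaussianReal 0 1 := by
  rw [h.map_linVal, hC.covForm_stdErrCoef hi hi, if_pos rfl, Real.toNNReal_one]

/-- The standardised errors are jointly Gaussian and uncorrelated, hence independent. -/
theorem map_stdErr_eq_pi (h : IsCentredGP Y P C) (hC : IsPosDefBelow C n) :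
    P.map (fun ω (i : Fin n) => linVal n (stdErrCoef C n i) (fun k => Y k ω)) =
      Measure.pi fun _ => gaussianReal 0 1 := by
  have hm : ∀ i : Fin n, Measurable fun ω => linVal n (stdErrCoef C n i) (fun k => Y k ω) :=
    fun i => h.measurable_linVal n _
  have hlaw := (h.isGaussianProcess_linVal n (fun i : Fin n => stdErrCoef C n i))
  have hG : HasGaussianLaw
      (fun ω (i : Fin n) => linVal n (stdErrCoef C n i) (fun k => Y k ω)) P := by
    have h1 := hlaw.hasGaussianLaw Finset.univ
    exact h1.map_fun (ContinuousLinearMap.pi fun i : Fin n =>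
      ContinuousLinearMap.proj (⟨i, Finset.mem_univ i⟩ : (Finset.univ : Finset (Fin n))))
  have hind := hG.iIndepFun_of_covariance_eq_zero fun i j hij => by
    rw [h.covariance_linVal, hC.covForm_stdErrCoef i.2 j.2,
      if_neg fun h' => hij (Fin.ext h')]
  rw [iIndepFun_iff_map_fun_eq_pi_map fun i => (hm i).aemeasurable] at hind
  rw [hind]
  congr 1
  funext i
  exact h.map_stdErr hC i.2

end IsCentredGP

/-! ### Equivalence of nondegenerate Gaussian laws -/

theorem absolutelyContinuous_pi_fin {μ ν : Measure ℝ} [SigmaFinite μ] [SigmaFinite ν] (h : μ ≪ ν)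
    (n : ℕ) : (Measure.pi fun _ : Fin n => μ) ≪ Measure.pi fun _ : Fin n => ν := by
  induction n with
  | zero => rw [Measure.pi_of_empty, Measure.pi_of_empty]
  | succ n ih =>
    have hμ := (measurePreserving_piFinSuccAbove (fun _ : Fin (n + 1) => μ) 0).symm
    have hν := (measurePreserving_piFinSuccAbove (fun _ : Fin (n + 1) => ν) 0).symm
    rw [← hμ.map_eq, ← hν.map_eq]
    exact (h.prod ih).map (MeasurableEquiv.measurable _)

namespace IsCentredGP

variable {Ω : Type*} [mΩ : MeasurableSpace Ω] {Y : ℕ → Ω → ℝ} {P : Measure Ω}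
  [IsProbabilityMeasure P] {C : ℕ → ℕ → ℝ} {n : ℕ}

/-- Orthonormality of the standardised errors reads M V Mᵀ = 1, so M is invertible. The observations
are then an invertible linear image of a standard Gaussian vector, whose law is equivalent to
Lebesgue measure. -/
theorem absolutelyContinuous_volume (h : IsCentredGP Y P C) (hC : IsPosDefBelow C n) :
    P.map (fun ω (i : Fin n) => Y i ω) ≪ volume ∧
      volume ≪ P.map (fun ω (i : Fin n) => Y i ω) := by
  set M : Matrix (Fin n) (Fin n) ℝ := Matrix.of fun i k => stdErrCoef C n i k with hM
  set V : Matrix (Fin n) (Fin n) ℝ := Matrix.of fun k l => C k l with hV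
  have hMV : M * (V * M.transpose) = 1 := by
    ext i j
    have h1 := hC.covForm_stdErrCoef i.2 j.2
    rw [covForm_eq_sum_left, Finset.sum_range] at h1
    rw [Matrix.mul_apply, Matrix.one_apply]
    simp only [Fin.ext_iff]
    rw [← h1]
    refine Finset.sum_congr rfl fun k _ => ?_
    rw [Finset.sum_range, Matrix.mul_apply, hM, Matrix.of_apply]
    refine congrArg _ (Finset.sum_congr rfl fun l _ => ?_)
    rw [Matrix.transpose_apply, Matrix.of_apply, hV, Matrix.of_apply, mul_comm]
  have hdet : IsUnit M.det := Matrix.isUnit_det_of_right_inverse hMV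
  have hdet' : (M⁻¹).det ≠ 0 := (Matrix.isUnit_nonsing_inv_det M hdet).ne_zero
  have hYm : Measurable fun ω (i : Fin n) => Y i ω :=
    measurable_pi_lambda _ fun i => h.measurable i
  have hZ : (fun ω (i : Fin n) => linVal n (stdErrCoef C n i) (fun k => Y k ω)) =
      fun ω => M.mulVec fun i : Fin n => Y i ω := by
    funext ω i
    rw [linVal, Finset.sum_range]
    rfl
  have hY : (fun ω (i : Fin n) => Y i ω) = Matrix.toLin' M⁻¹ ∘
      fun ω (i : Fin n) => linVal n (stdErrCoef C n i) (fun k => Y k ω) := by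
    rw [hZ]
    funext ω
    rw [Function.comp_apply, Matrix.toLin'_apply, Matrix.mulVec_mulVec,
      Matrix.nonsing_inv_mul _ hdet, Matrix.one_mulVec]
  have hTm : Measurable (Matrix.toLin' M⁻¹) := LinearMap.continuous_of_finiteDimensional _ |>.measurable
  have hZm : Measurable fun ω (i : Fin n) => linVal n (stdErrCoef C n i) (fun k => Y k ω) :=
    measurable_pi_lambda _ fun i => h.measurable_linVal n _
  have hlaw : P.map (fun ω (i : Fin n) => Y i ω) =
      (Measure.pi fun _ : Fin n => gaussianReal 0 1).map (Matrix.toLin' M⁻¹) := by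
    rw [← h.map_stdErr_eq_pi hC, Measure.map_map hTm hZm, ← hY]
  have hdetL : LinearMap.det (Matrix.toLin' M⁻¹) ≠ 0 := by rwa [LinearMap.det_toLin']
  have hvol := Measure.map_linearMap_addHaar_eq_smul_addHaar
    (volume : Measure (Fin n → ℝ)) hdetL
  have h1 : (Measure.pi fun _ : Fin n => gaussianReal 0 1) ≪ (volume : Measure (Fin n → ℝ)) :=
    absolutelyContinuous_pi_fin (gaussianReal_absolutelyContinuous 0 one_ne_zero) n
  have h2 : (volume : Measure (Fin n → ℝ)) ≪ (Measure.pi fun _ : Fin n => gaussianReal 0 1) :=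
    absolutelyContinuous_pi_fin (gaussianReal_absolutelyContinuous' 0 one_ne_zero) n
  rw [hlaw]
  constructor
  · refine (h1.map hTm).trans ?_
    rw [hvol]
    exact Measure.smul_absolutelyContinuous
  · refine Measure.AbsolutelyContinuous.trans ?_ (h2.map hTm)
    rw [hvol]
    refine Measure.absolutelyContinuous_smul ?_
    rw [Ne, ENNReal.ofReal_eq_zero, not_le]
    positivity

/-- Almost sure identities between functions of finitely many observations do not depend on the
nondegenerate Gaussian law. -/
theorem ae_eq_of_ae_eq {P' : Measure Ω} [IsProbabilityMeasure P'] {C' : ℕ → ℕ → ℝ}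
    (h : IsCentredGP Y P C) (hC : IsPosDefBelow C n) (h' : IsCentredGP Y P' C')
    (hC' : IsPosDefBelow C' n) {f g : Ω → ℝ}
    (hf : Measurable[obsSigma Y id (Finset.range n)] f)
    (hg : Measurable[obsSigma Y id (Finset.range n)] g) (hfg : f =ᵐ[P'] g) : f =ᵐ[P] g := by
  have hle : obsSigma Y id (Finset.range n) ≤
      MeasurableSpace.comap (fun ω (i : Fin n) => Y i ω) inferInstance :=
    iSup₂_le fun j hj => by
      rw [← measurable_iff_comap_le]
      exact (measurable_pi_apply (⟨j, Finset.mem_range.1 hj⟩ : Fin n)).comp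
        (comap_measurable fun ω (i : Fin n) => Y i ω)
  have hYm : Measurable fun ω (i : Fin n) => Y i ω :=
    measurable_pi_lambda _ fun i => h.measurable i
  have hset : MeasurableSet[obsSigma Y id (Finset.range n)] {ω | f ω = g ω}ᶜ :=
    (measurableSet_eq_fun hf hg).compl
  obtain ⟨B, hB, hBeq⟩ := hle _ hset
  have h0 : P' {ω | f ω = g ω}ᶜ = 0 := hfg
  change P {ω | f ω = g ω}ᶜ = 0
  rw [← hBeq, ← Measure.map_apply hYm hB] at h0 ⊢
  exact (h.absolutelyContinuous_volume hC).1 ((h'.absolutelyContinuous_volume hC').2 h0)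

end IsCentredGP

/-! ### Moments of the standard normal distribution -/

theorem integral_pow_four_gaussianReal : ∫ x, x ^ 4 ∂gaussianReal 0 1 = 3 := by
  rw [integral_gaussianReal_eq_integral_smul one_ne_zero]
  have h1 : ∀ x : ℝ, gaussianPDFReal 0 1 x • x ^ 4 =
      (√(2 * Real.pi))⁻¹ * (|x| ^ (4 : ℝ) * Real.exp (-(1 / 2) * |x| ^ (2 : ℝ))) := fun x => by
    rw [gaussianPDFReal, smul_eq_mul, Real.rpow_two, sq_abs]
    have : |x| ^ (4 : ℝ) = x ^ 4 := by
      rw [show (4 : ℝ) = ((4 : ℕ) : ℝ) by norm_num, Real.rpow_natCast]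
      exact Even.pow_abs (by decide) x
    rw [this]
    simp only [NNReal.coe_one, mul_one, sub_zero]
    ring_nf
  simp only [h1]
  rw [integral_const_mul, integral_comp_abs
    (f := fun x => x ^ (4 : ℝ) * Real.exp (-(1 / 2) * x ^ (2 : ℝ))),
    integral_rpow_mul_exp_neg_mul_rpow (by norm_num) (by norm_num) (by norm_num)]
  have hΓ : Real.Gamma ((4 + 1) / 2) = 3 / 4 * √Real.pi := by
    rw [show ((4 : ℝ) + 1) / 2 = (1 / 2 + 1) + 1 by norm_num, Real.Gamma_add_one (by norm_num),
      Real.Gamma_add_one (by norm_num), Real.Gamma_one_half_eq]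
    ring
  have hp : (1 / 2 : ℝ) ^ (-(4 + 1) / 2 : ℝ) = 4 * √2 := by
    rw [one_div, Real.inv_rpow (by norm_num), ← Real.rpow_neg (by norm_num),
      show -(-(4 + 1) / 2 : ℝ) = 2 + 1 / 2 by norm_num, Real.rpow_add (by norm_num),
      ← Real.sqrt_eq_rpow]
    norm_num
  rw [hΓ, hp, Real.sqrt_mul (by norm_num)]
  have h2 : √(2 : ℝ) ≠ 0 := by positivity
  have h3 : √Real.pi ≠ 0 := by positivity
  field_simp

section StdNormal

variable {Ω : Type*} [mΩ : MeasurableSpace Ω] {P : Measure Ω} [IsProbabilityMeasure P]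

theorem integral_of_map_eq_gaussianReal {Z : Ω → ℝ} (hZ : Measurable Z)
    (hlaw : P.map Z = gaussianReal 0 1) {f : ℝ → ℝ} (hf : Measurable f) :
    ∫ ω, f (Z ω) ∂P = ∫ x, f x ∂gaussianReal 0 1 := by
  rw [← hlaw, integral_map hZ.aemeasurable hf.aestronglyMeasurable]

theorem integrable_pow_of_map_eq_gaussianReal {Z : Ω → ℝ} (hZ : Measurable Z)
    (hlaw : P.map Z = gaussianReal 0 1) (m : ℕ) : Integrable (fun ω => Z ω ^ m) P := by
  have h1 : Integrable (fun x : ℝ => x ^ m) (gaussianReal 0 1) := by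
    rcases Nat.eq_zero_or_pos m with rfl | hm
    · simp
    · have h2 := (memLp_id_gaussianReal (μ := 0) (v := 1) (m : NNReal)).integrable_norm_pow
        (p := m) hm.ne'
      refine h2.mono' (by fun_prop) (Eventually.of_forall fun x => ?_)
      rw [norm_pow]
      exact le_rfl
  rw [← hlaw] at h1
  exact (integrable_map_measure (continuous_pow m).aestronglyMeasurable hZ.aemeasurable).1 h1

theorem integral_sq_of_map_eq_gaussianReal {Z : Ω → ℝ} (hZ : Measurable Z)
    (hlaw : P.map Z = gaussianReal 0 1) : ∫ ω, Z ω ^ 2 ∂P = 1 := by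
  rw [integral_of_map_eq_gaussianReal hZ hlaw (f := fun x => x ^ 2) (by fun_prop)]
  have h := variance_fun_id_gaussianReal (μ := 0) (v := 1)
  rw [variance_eq_integral (by fun_prop), integral_id_gaussianReal] at h
  simpa using h

theorem integral_id_of_map_eq_gaussianReal {Z : Ω → ℝ} (hZ : Measurable Z)
    (hlaw : P.map Z = gaussianReal 0 1) : ∫ ω, Z ω ∂P = 0 := by
  rw [integral_of_map_eq_gaussianReal hZ hlaw (f := fun x => x) (by fun_prop),
    integral_id_gaussianReal]

theorem memLp_sq_sub_one_of_map_eq_gaussianReal {Z : Ω → ℝ} (hZ : Measurable Z)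
    (hlaw : P.map Z = gaussianReal 0 1) : MemLp (fun ω => Z ω ^ 2 - 1) 2 P := by
  rw [memLp_two_iff_integrable_sq (by fun_prop)]
  have h := ((integrable_pow_of_map_eq_gaussianReal hZ hlaw 4).sub
    ((integrable_pow_of_map_eq_gaussianReal hZ hlaw 2).const_mul 2)).add (integrable_const (1 : ℝ))
  refine h.congr (Eventually.of_forall fun ω => ?_)
  simp only [Pi.add_apply, Pi.sub_apply]
  ring

theorem integral_sq_sub_one_of_map_eq_gaussianReal {Z : Ω → ℝ} (hZ : Measurable Z)
    (hlaw : P.map Z = gaussianReal 0 1) : ∫ ω, (Z ω ^ 2 - 1) ∂P = 0 := by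
  rw [integral_sub (integrable_pow_of_map_eq_gaussianReal hZ hlaw 2) (integrable_const _),
    integral_sq_of_map_eq_gaussianReal hZ hlaw]
  simp

theorem integral_sq_sub_one_sq_of_map_eq_gaussianReal {Z : Ω → ℝ} (hZ : Measurable Z)
    (hlaw : P.map Z = gaussianReal 0 1) : ∫ ω, (Z ω ^ 2 - 1) ^ 2 ∂P = 2 := by
  have h4 : ∫ ω, Z ω ^ 4 ∂P = 3 := by
    rw [integral_of_map_eq_gaussianReal hZ hlaw (f := fun x => x ^ 4) (by fun_prop),
      integral_pow_four_gaussianReal]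
  have h : ∀ ω, (Z ω ^ 2 - 1) ^ 2 = Z ω ^ 4 - 2 * Z ω ^ 2 + 1 := fun ω => by ring
  have hint : Integrable (fun ω => Z ω ^ 4 - 2 * Z ω ^ 2) P :=
    (integrable_pow_of_map_eq_gaussianReal hZ hlaw 4).sub
      ((integrable_pow_of_map_eq_gaussianReal hZ hlaw 2).const_mul 2)
  simp only [h]
  rw [integral_add hint (integrable_const _), integral_sub (integrable_pow_of_map_eq_gaussianReal hZ hlaw 4)
    ((integrable_pow_of_map_eq_gaussianReal hZ hlaw 2).const_mul 2), integral_const_mul, h4,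
    integral_sq_of_map_eq_gaussianReal hZ hlaw]
  simp
  norm_num

/-! ### Perturbations of sums of squares of independent standard normal variables -/

theorem integral_sq_sum_eq {n : ℕ} {M : ℕ → Ω → ℝ} (hM : ∀ i < n, MemLp (M i) 2 P)
    (horth : ∀ i < n, ∀ j < i, ∫ ω, M i ω * M j ω ∂P = 0) :
    ∫ ω, (∑ i ∈ Finset.range n, M i ω) ^ 2 ∂P = ∑ i ∈ Finset.range n, ∫ ω, M i ω ^ 2 ∂P := by
  have hi : ∀ i ∈ Finset.range n, ∀ j ∈ Finset.range n, Integrable (fun ω => M i ω * M j ω) P :=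
    fun i hi j hj => (hM i (Finset.mem_range.1 hi)).integrable_mul (hM j (Finset.mem_range.1 hj))
  simp only [sq, Finset.sum_mul_sum]
  rw [integral_finsetSum _ fun i h => integrable_finsetSum _ fun j h' => hi i h j h']
  refine Finset.sum_congr rfl fun i hi' => ?_
  rw [integral_finsetSum _ fun j h' => hi i hi' j h', Finset.sum_eq_single i]
  · intro j hj hji
    have hi'' := Finset.mem_range.1 hi'
    have hj' := Finset.mem_range.1 hj
    rcases lt_or_gt_of_ne hji with h | h
    · exact horth i hi'' j h
    · simp only [mul_comm (M i _)]
      exact horth j hj' i h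
  · exact fun h => absurd hi' h

/-- The mean absolute deviation between `∑ (q i * Z i + a i) ^ 2` and `∑ Z i ^ 2` for independent
standard normal variables `Z i` and predictable perturbations `a i`. -/
theorem integral_abs_sum_sq_sub_le {n : ℕ} {𝓕 : ℕ → MeasurableSpace Ω} (h𝓕 : ∀ i, 𝓕 i ≤ mΩ)
    (hmono : Monotone 𝓕) {Z a : ℕ → Ω → ℝ} {q : ℕ → ℝ}
    (hZm : ∀ i < n, Measurable[𝓕 (i + 1)] (Z i)) (ham : ∀ i < n, Measurable[𝓕 i] (a i))
    (hind : ∀ i < n, Indep (MeasurableSpace.comap (Z i) inferInstance) (𝓕 i) P)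
    (hlaw : ∀ i < n, P.map (Z i) = gaussianReal 0 1) (ha : ∀ i < n, MemLp (a i) 2 P) :
    ∫ ω, |∑ i ∈ Finset.range n, ((q i * Z i ω + a i ω) ^ 2 - Z i ω ^ 2)| ∂P ≤
      ∑ i ∈ Finset.range n, ∫ ω, a i ω ^ 2 ∂P
        + (1 + ∑ i ∈ Finset.range n, (8 * q i ^ 2 * ∫ ω, a i ω ^ 2 ∂P + 4 * (q i ^ 2 - 1) ^ 2)) / 2
        + |∑ i ∈ Finset.range n, (q i ^ 2 - 1)| := by
  have hZm' : ∀ i < n, Measurable (Z i) := fun i hi => (hZm i hi).mono (h𝓕 _) le_rfl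
  have ham' : ∀ i < n, Measurable (a i) := fun i hi => (ham i hi).mono (h𝓕 _) le_rfl
  have hindF : ∀ i < n, ∀ f : Ω → ℝ, Measurable[𝓕 i] f → IndepFun f (Z i) P := by
    intro i hi f hf
    rw [IndepFun_iff_Indep]
    exact (indep_of_indep_of_le_right (hind i hi) hf.comap_le).symm
  -- As a_i is only square integrable, independence of a_i and Z_i is what puts the product in L².
  have haZ : ∀ i < n, MemLp (fun ω => a i ω * Z i ω) 2 P := by
    intro i hi
    have m1 := ham' i hi
    have m2 := hZm' i hi
    rw [memLp_two_iff_integrable_sq (by fun_prop)]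
    have h1 : IndepFun (fun ω => a i ω ^ 2) (fun ω => Z i ω ^ 2) P :=
      (hindF i hi _ (ham i hi)).comp (φ := fun x => x ^ 2) (ψ := fun x => x ^ 2)
        (by fun_prop) (by fun_prop)
    have h2 := h1.integrable_mul (ha i hi).integrable_sq
      (integrable_pow_of_map_eq_gaussianReal (hZm' i hi) (hlaw i hi) 2)
    refine h2.congr (Eventually.of_forall fun ω => ?_)
    simp only [Pi.mul_apply]
    ring
  have haZsq : ∀ i < n, ∫ ω, (a i ω * Z i ω) ^ 2 ∂P = ∫ ω, a i ω ^ 2 ∂P := by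
    intro i hi
    have m1 := ham' i hi
    have m2 := hZm' i hi
    have h1 : IndepFun (fun ω => a i ω ^ 2) (fun ω => Z i ω ^ 2) P :=
      (hindF i hi _ (ham i hi)).comp (φ := fun x => x ^ 2) (ψ := fun x => x ^ 2)
        (by fun_prop) (by fun_prop)
    simp only [mul_pow]
    rw [h1.integral_fun_mul_eq_mul_integral (by fun_prop) (by fun_prop),
      integral_sq_of_map_eq_gaussianReal (hZm' i hi) (hlaw i hi), mul_one]
  have hZ2 : ∀ i < n, MemLp (fun ω => Z i ω ^ 2 - 1) 2 P := fun i hi =>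
    memLp_sq_sub_one_of_map_eq_gaussianReal (hZm' i hi) (hlaw i hi)
  -- The centred part of the increment: (q Z + a)² - Z² = a² + M + (q² - 1).
  set M : ℕ → Ω → ℝ := fun i ω => 2 * q i * (a i ω * Z i ω) + (q i ^ 2 - 1) * (Z i ω ^ 2 - 1)
    with hMdef
  have hM : ∀ i < n, MemLp (M i) 2 P := fun i hi =>
    ((haZ i hi).const_mul _).add ((hZ2 i hi).const_mul _)
  have hMm : ∀ i < n, Measurable[𝓕 (i + 1)] (M i) := fun i hi => by
    have h1 := hZm i hi
    have h2 : Measurable[𝓕 (i + 1)] (a i) := (ham i hi).mono (hmono i.le_succ) le_rfl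
    exact ((h2.mul h1).const_mul _).add (((h1.pow_const 2).sub_const 1).const_mul _)
  -- For j < i both M_j and a_i are 𝓕_i-measurable, while Z_i and Z_i² - 1 are independent of 𝓕_i
  -- with mean zero.
  have horth : ∀ i < n, ∀ j < i, ∫ ω, M i ω * M j ω ∂P = 0 := by
    intro i hi j hj
    have hj' := hj.trans hi
    have hMj : Measurable[𝓕 i] (M j) := (hMm j hj').mono (hmono hj) le_rfl
    have hMjm : Measurable (M j) := hMj.mono (h𝓕 _) le_rfl
    have m1 := ham' i hi
    have m2 := hZm' i hi
    have e1 : ∫ ω, (M j ω * a i ω) * Z i ω ∂P = 0 := by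
      have h1 : IndepFun (fun ω => M j ω * a i ω) (Z i) P := hindF i hi _ (hMj.mul (ham i hi))
      rw [h1.integral_fun_mul_eq_mul_integral (by fun_prop) (by fun_prop), integral_id_of_map_eq_gaussianReal m2 (hlaw i hi), mul_zero]
    have e2 : ∫ ω, M j ω * (Z i ω ^ 2 - 1) ∂P = 0 := by
      have h1 : IndepFun (M j) (fun ω => Z i ω ^ 2 - 1) P :=
        (hindF i hi _ hMj).comp (φ := id) (ψ := fun x => x ^ 2 - 1) measurable_id (by fun_prop)
      rw [h1.integral_fun_mul_eq_mul_integral (by fun_prop) (by fun_prop),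
        integral_sq_sub_one_of_map_eq_gaussianReal m2 (hlaw i hi), mul_zero]
    have i1 : Integrable (fun ω => (M j ω * a i ω) * Z i ω) P := by
      simp only [mul_assoc]
      exact (hM j hj').integrable_mul (haZ i hi)
    have i2 : Integrable (fun ω => M j ω * (Z i ω ^ 2 - 1)) P :=
      (hM j hj').integrable_mul (hZ2 i hi)
    have hsplit : ∀ ω, M i ω * M j ω = 2 * q i * ((M j ω * a i ω) * Z i ω)
        + (q i ^ 2 - 1) * (M j ω * (Z i ω ^ 2 - 1)) := fun ω => by
      simp only [hMdef]
      ring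
    simp only [hsplit]
    rw [integral_add (i1.const_mul _) (i2.const_mul _), integral_const_mul, integral_const_mul, e1,
      e2]
    ring
  -- From (u + v)² ≤ 2u² + 2v²: the constants are 8 = 2 · 2² and 4 = 2 · E(Z² - 1)².
  have hMsq : ∀ i < n, ∫ ω, M i ω ^ 2 ∂P ≤
      8 * q i ^ 2 * ∫ ω, a i ω ^ 2 ∂P + 4 * (q i ^ 2 - 1) ^ 2 := by
    intro i hi
    have i1 := ((haZ i hi).integrable_sq).const_mul (8 * q i ^ 2)
    have i2 := ((hZ2 i hi).integrable_sq).const_mul (2 * (q i ^ 2 - 1) ^ 2)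
    have h1 : ∫ ω, M i ω ^ 2 ∂P ≤ ∫ ω, (8 * q i ^ 2 * (a i ω * Z i ω) ^ 2
        + 2 * (q i ^ 2 - 1) ^ 2 * (Z i ω ^ 2 - 1) ^ 2) ∂P := by
      refine integral_mono (hM i hi).integrable_sq (i1.add i2) fun ω => ?_
      simp only [hMdef]
      nlinarith [sq_nonneg (2 * q i * (a i ω * Z i ω) - (q i ^ 2 - 1) * (Z i ω ^ 2 - 1))]
    refine h1.trans (le_of_eq ?_)
    rw [integral_add i1 i2, integral_const_mul, integral_const_mul, haZsq i hi,
      integral_sq_sub_one_sq_of_map_eq_gaussianReal (hZm' i hi) (hlaw i hi)]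
    ring
  have hsumM : ∫ ω, (∑ i ∈ Finset.range n, M i ω) ^ 2 ∂P ≤
      ∑ i ∈ Finset.range n, (8 * q i ^ 2 * ∫ ω, a i ω ^ 2 ∂P + 4 * (q i ^ 2 - 1) ^ 2) := by
    rw [integral_sq_sum_eq hM horth]
    exact Finset.sum_le_sum fun i hi => hMsq i (Finset.mem_range.1 hi)
  have hsumMint : Integrable (fun ω => (∑ i ∈ Finset.range n, M i ω) ^ 2) P :=
    (memLp_finsetSum _ fun i hi => hM i (Finset.mem_range.1 hi)).integrable_sq
  have hsuma : Integrable (fun ω => ∑ i ∈ Finset.range n, a i ω ^ 2) P :=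
    integrable_finsetSum _ fun i hi => (ha i (Finset.mem_range.1 hi)).integrable_sq
  set D := ∑ i ∈ Finset.range n, (q i ^ 2 - 1) with hD
  have hpt : ∀ ω, |∑ i ∈ Finset.range n, ((q i * Z i ω + a i ω) ^ 2 - Z i ω ^ 2)| ≤
      ∑ i ∈ Finset.range n, a i ω ^ 2 + (1 + (∑ i ∈ Finset.range n, M i ω) ^ 2) / 2 + |D| := by
    intro ω
    have h1 : ∑ i ∈ Finset.range n, ((q i * Z i ω + a i ω) ^ 2 - Z i ω ^ 2) =
        ∑ i ∈ Finset.range n, a i ω ^ 2 + ∑ i ∈ Finset.range n, M i ω + D := by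
      rw [hD, ← Finset.sum_add_distrib, ← Finset.sum_add_distrib]
      refine Finset.sum_congr rfl fun i _ => ?_
      simp only [hMdef]
      ring
    rw [h1]
    have h2 : 0 ≤ ∑ i ∈ Finset.range n, a i ω ^ 2 := Finset.sum_nonneg fun i _ => sq_nonneg _
    set S := ∑ i ∈ Finset.range n, M i ω
    -- Turns the L² bound on the martingale sum into an L¹ bound.
    have h3 : |S| ≤ (1 + S ^ 2) / 2 := by
      have := sq_nonneg (|S| - 1)
      rw [sub_sq, sq_abs] at this
      linarith
    calc |∑ i ∈ Finset.range n, a i ω ^ 2 + S + D|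
        ≤ |∑ i ∈ Finset.range n, a i ω ^ 2| + |S| + |D| := abs_add_three _ _ _
      _ ≤ _ := by
        rw [abs_of_nonneg h2]
        gcongr
  have hhalf : Integrable (fun ω => (1 + (∑ i ∈ Finset.range n, M i ω) ^ 2) / 2) P :=
    ((integrable_const 1).add hsumMint).div_const 2
  have hadd : Integrable (fun ω => ∑ i ∈ Finset.range n, a i ω ^ 2
      + (1 + (∑ i ∈ Finset.range n, M i ω) ^ 2) / 2) P := hsuma.add hhalf
  have hbint : Integrable (fun ω => ∑ i ∈ Finset.range n, a i ω ^ 2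
      + (1 + (∑ i ∈ Finset.range n, M i ω) ^ 2) / 2 + |D|) P :=
    hadd.add (integrable_const _)
  refine (integral_mono_of_nonneg (Eventually.of_forall fun ω => abs_nonneg _) hbint
    (Eventually.of_forall hpt)).trans ?_
  rw [integral_add hadd (integrable_const _), integral_add hsuma hhalf, integral_div, integral_add (integrable_const 1) hsumMint,
    integral_finsetSum _ fun i hi => (ha i (Finset.mem_range.1 hi)).integrable_sq]
  simp only [integral_const, probReal_univ, one_smul]
  gcongr

end StdNormal

/-! ### Vecchia's quadratic form and the standardised errors -/

/-- The variance of the error of the best linear predictor of coordinate `i` from those in `A`. -/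
noncomputable def errVar (C : ℕ → ℕ → ℝ) (n : ℕ) (A : Finset ℕ) (i : ℕ) : ℝ :=
  covForm C n (errCoef C A i) (errCoef C A i)

/-- The coefficients of the difference between the prediction error of coordinate `i` given those
in `A` under the covariance `C'` and the one given the whole past under the covariance `C`. -/
noncomputable def errDiff (C C' : ℕ → ℕ → ℝ) (A : Finset ℕ) (i k : ℕ) : ℝ :=
  errCoef C' A i k - errCoef C (Finset.range i) i k

theorem errDiff_of_notMem {C C' : ℕ → ℕ → ℝ} {A : Finset ℕ} {i k : ℕ} (hA : A ⊆ Finset.range i)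
    (hk : k ∉ Finset.range i) : errDiff C C' A i k = 0 := by
  rw [errDiff]
  by_cases hki : k = i
  · subst hki
    rw [errCoef_self fun h => hk (hA h), errCoef_self hk, sub_self]
  · rw [errCoef_of_notMem (fun h => hk (hA h)) hki, errCoef_of_notMem hk hki, sub_self]

theorem errCoef_add_errDiff (C C' : ℕ → ℕ → ℝ) (A : Finset ℕ) (i : ℕ) :
    (fun k => errCoef C (Finset.range i) i k + errDiff C C' A i k) = errCoef C' A i := by
  funext k
  rw [errDiff, add_sub_cancel]

namespace IsPosDefBelow

variable {C C' : ℕ → ℕ → ℝ} {n : ℕ} {A : Finset ℕ} {i : ℕ}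

theorem errVar_pos (hC : IsPosDefBelow C n) (hi : i < n) (hA : A ⊆ Finset.range i) :
    0 < errVar C n A i :=
  hC.covForm_errCoef_pos hi fun h => by simpa using hA h

/-- Both errors have coefficient 1 at `i`, so their difference involves only the past, to which the
full-past error is orthogonal. -/
theorem covForm_errCoef_errDiff (hC : IsPosDefBelow C n) (hi : i < n) (hA : A ⊆ Finset.range i) :
    covForm C n (errCoef C (Finset.range i) i) (errDiff C C' A i) = 0 :=
  hC.covForm_errCoef_of_support (Finset.range_subset_range.2 hi.le) hi
    fun _ hk => errDiff_of_notMem hA hk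

theorem covForm_self_nonneg (hC : IsPosDefBelow C n) (c : ℕ → ℝ) : 0 ≤ covForm C n c c := by
  by_cases h : ∃ k < n, c k ≠ 0
  · exact (hC.pos c h).le
  · push Not at h
    refine (Finset.sum_eq_zero fun k hk => Finset.sum_eq_zero fun l _ => ?_).ge
    rw [h k (Finset.mem_range.1 hk), zero_mul, zero_mul]

/-- Pythagoras: predicting from the whole past under `C` minimises the `C`-variance, in particular
against the weights of another model. -/
theorem errVar_range_le (hC : IsPosDefBelow C n) (hi : i < n) (hA : A ⊆ Finset.range i) :
    errVar C n (Finset.range i) i ≤ covForm C n (errCoef C' A i) (errCoef C' A i) := by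
  rw [← errCoef_add_errDiff C C' A i, covForm_add_self hC.symm,
    hC.covForm_errCoef_errDiff hi hA]
  have := hC.covForm_self_nonneg (errDiff C C' A i)
  rw [errVar]
  linarith

end IsPosDefBelow

namespace IsCentredGP

variable {Ω : Type*} [mΩ : MeasurableSpace Ω] {Y : ℕ → Ω → ℝ} {P P' : Measure Ω}
  [IsProbabilityMeasure P] [IsProbabilityMeasure P'] {C C' : ℕ → ℕ → ℝ} {n : ℕ}

/-- The filtration is generated by the past observations. The standardised Vecchia error is
(ρ_i/τ_i) Z_i + a_i, where a_i is the difference of the two errors divided by τ_i and depends on the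
past only. -/
theorem integral_abs_vecchiaQuad_sub_le (h : IsCentredGP Y P C) (hC : IsPosDefBelow C n)
    (hC' : IsPosDefBelow C' n) {N : ℕ → Finset ℕ} (hN : ∀ i < n, N i ⊆ Finset.range i) :
    ∫ ω, |vecchiaQuad C' N n (fun k => Y k ω)
        - ∑ i ∈ Finset.range n, linVal n (stdErrCoef C n i) (fun k => Y k ω) ^ 2| ∂P ≤
      ∑ i ∈ Finset.range n,
          covForm C n (errDiff C C' (N i) i) (errDiff C C' (N i) i) / errVar C' n (N i) i
        + (1 + ∑ i ∈ Finset.range n,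
            (8 * (errVar C n (Finset.range i) i / errVar C' n (N i) i) *
                (covForm C n (errDiff C C' (N i) i) (errDiff C C' (N i) i) / errVar C' n (N i) i)
              + 4 * (errVar C n (Finset.range i) i / errVar C' n (N i) i - 1) ^ 2)) / 2
        + |∑ i ∈ Finset.range n, (errVar C n (Finset.range i) i / errVar C' n (N i) i - 1)| := by
  set τ : ℕ → ℝ := fun i => √(errVar C' n (N i) i) with hτ
  set ρ : ℕ → ℝ := fun i => √(errVar C n (Finset.range i) i) with hρ
  have hτ2 : ∀ i < n, τ i ^ 2 = errVar C' n (N i) i := fun i hi =>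
    Real.sq_sqrt (hC'.errVar_pos hi (hN i hi)).le
  have hρ2 : ∀ i < n, ρ i ^ 2 = errVar C n (Finset.range i) i := fun i hi =>
    Real.sq_sqrt (hC.errVar_pos hi subset_rfl).le
  have hτ0 : ∀ i < n, 0 < τ i := fun i hi => Real.sqrt_pos.2 (hC'.errVar_pos hi (hN i hi))
  have hρ0 : ∀ i < n, 0 < ρ i := fun i hi => Real.sqrt_pos.2 (hC.errVar_pos hi subset_rfl)
  set a : ℕ → Ω → ℝ := fun i ω =>
    linVal n (fun k => (τ i)⁻¹ * errDiff C C' (N i) i k) (fun k => Y k ω) with ha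
  set Z : ℕ → Ω → ℝ := fun i ω => linVal n (stdErrCoef C n i) (fun k => Y k ω) with hZ
  have hsupp : ∀ i k, k ∉ Finset.range (i + 1) → stdErrCoef C n i k = 0 := fun i k hk => by
    rw [Finset.mem_range] at hk
    rw [stdErrCoef, errCoef_of_notMem (by rw [Finset.mem_range]; omega) (by omega), mul_zero]
  have key := integral_abs_sum_sq_sub_le (P := P) (n := n)
    (𝓕 := fun i => obsSigma Y id (Finset.range i)) (Z := Z) (a := a) (q := fun i => ρ i / τ i)
    (fun i => h.obsSigma_le _)
    (fun i j hij => obsSigma_mono Y (Finset.range_subset_range.2 hij))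
    (fun i hi => measurable_linVal_of_support (A := Finset.range (i + 1))
      (fun k hk => measurable_obsSigma Y hk) n (hsupp i))
    (fun i hi => measurable_linVal_of_support (A := Finset.range i)
      (fun k hk => measurable_obsSigma Y hk) n fun k hk => by
        rw [errDiff_of_notMem (hN i hi) hk, mul_zero])
    (fun i hi => h.indep_obsSigma (Finset.range_subset_range.2 hi.le) fun b hb => by
      simp only [stdErrCoef, mul_assoc]
      rw [← Finset.mul_sum, hC.sum_errCoef_mul (Finset.range_subset_range.2 hi.le) hi hb,
        mul_zero])
    (fun i hi => h.map_stdErr hC hi) (fun i hi => h.memLp_linVal n _)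
  have hint : ∀ i < n, ∫ ω, a i ω ^ 2 ∂P =
      covForm C n (errDiff C C' (N i) i) (errDiff C C' (N i) i) / errVar C' n (N i) i := by
    intro i hi
    rw [h.integral_linVal_sq, covForm_mul_left, covForm_mul_right, ← hτ2 i hi]
    have := (hτ0 i hi).ne'
    field_simp
  have hq : ∀ i < n, (ρ i / τ i) ^ 2 = errVar C n (Finset.range i) i / errVar C' n (N i) i := by
    intro i hi
    rw [div_pow, hρ2 i hi, hτ2 i hi]
  have hquad : ∀ ω, vecchiaQuad C' N n (fun k => Y k ω)
        - ∑ i ∈ Finset.range n, linVal n (stdErrCoef C n i) (fun k => Y k ω) ^ 2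
      = ∑ i ∈ Finset.range n, ((ρ i / τ i * Z i ω + a i ω) ^ 2 - Z i ω ^ 2) := by
    intro ω
    rw [vecchiaQuad, ← Finset.sum_sub_distrib]
    refine Finset.sum_congr rfl fun i hi => ?_
    rw [Finset.mem_range] at hi
    congr 1
    have h1 := hτ2 i hi
    rw [errVar] at h1
    rw [← h1, ← div_pow, ← errCoef_add_errDiff C C' (N i) i, linVal_add]
    congr 1
    simp only [hZ, ha, linVal_mul]
    have h2 : linVal n (stdErrCoef C n i) (fun k => Y k ω) =
        (ρ i)⁻¹ * linVal n (errCoef C (Finset.range i) i) (fun k => Y k ω) :=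
      linVal_mul n _ _ _
    rw [h2]
    have := (hτ0 i hi).ne'
    have := (hρ0 i hi).ne'
    field_simp
  simp only [hquad]
  refine key.trans (le_of_eq ?_)
  congr 1
  · congr 1
    · exact Finset.sum_congr rfl fun i hi => hint i (Finset.mem_range.1 hi)
    · congr 2
      refine Finset.sum_congr rfl fun i hi => ?_
      rw [Finset.mem_range] at hi
      rw [hint i hi, hq i hi]
  · congr 1
    refine Finset.sum_congr rfl fun i hi => ?_
    rw [hq i (Finset.mem_range.1 hi)]

/-- The prediction error under `P'` is the linear form of the best linear predictor for `C'`, also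
almost surely under `P`. -/
theorem predError_ae_eq_of_equiv (h : IsCentredGP Y P C) (hC : IsPosDefBelow C n)
    (h' : IsCentredGP Y P' C') (hC' : IsPosDefBelow C' n) {A : Finset ℕ}
    (hA : A ⊆ Finset.range n) {i : ℕ} (hi : i < n) :
    predError P' Y id A i =ᵐ[P] fun ω => linVal n (errCoef C' A i) (fun k => Y k ω) := by
  refine h.ae_eq_of_ae_eq hC h' hC' ?_ ?_ (h'.predError_ae_eq hC' hA hi)
  · refine Measurable.sub ?_ ?_
    · exact measurable_obsSigma Y (Finset.mem_range.2 hi)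
    · exact stronglyMeasurable_condExp.measurable.mono (obsSigma_mono Y hA) le_rfl
  · exact measurable_linVal_of_support (A := insert i A)
      (fun k hk => measurable_obsSigma Y (Finset.insert_subset (Finset.mem_range.2 hi) hA hk)) n
      fun k hk => by
        rw [Finset.mem_insert, not_or] at hk
        exact errCoef_of_notMem hk.2 hk.1

theorem integral_predError_sq (h : IsCentredGP Y P C) (hC : IsPosDefBelow C n) {A : Finset ℕ}
    {i : ℕ} (hi : i < n) (hA : A ⊆ Finset.range i) :
    ∫ ω, predError P Y id A i ω ^ 2 ∂P = errVar C n A i := by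
  rw [errVar, ← h.integral_linVal_sq]
  refine integral_congr_ae ?_
  filter_upwards [h.predError_ae_eq hC (hA.trans (Finset.range_subset_range.2 hi.le)) hi] with ω hω
  rw [hω]

theorem integral_predError_sub_sq (h : IsCentredGP Y P C) (hC : IsPosDefBelow C n)
    (h' : IsCentredGP Y P' C') (hC' : IsPosDefBelow C' n) {A : Finset ℕ} {i : ℕ} (hi : i < n)
    (hA : A ⊆ Finset.range i) :
    ∫ ω, (predError P' Y id A i ω - predError P Y id (Finset.range i) i ω) ^ 2 ∂P =
        covForm C n (errDiff C C' A i) (errDiff C C' A i) ∧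
      ∫ ω, (predError P' Y id A i ω - predError P Y id (Finset.range i) i ω) ^ 2 ∂P' =
        covForm C' n (errDiff C C' A i) (errDiff C C' A i) := by
  have hi' := Finset.range_subset_range.2 hi.le
  have hlin : ∀ ω, linVal n (errDiff C C' A i) (fun k => Y k ω) =
      linVal n (errCoef C' A i) (fun k => Y k ω) -
        linVal n (errCoef C (Finset.range i) i) (fun k => Y k ω) := fun ω => linVal_sub n _ _ _
  constructor
  · rw [← h.integral_linVal_sq]
    refine integral_congr_ae ?_
    filter_upwards [h.predError_ae_eq hC hi' hi,
      h.predError_ae_eq_of_equiv hC h' hC' (hA.trans hi') hi] with ω hω hω'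
    rw [hω, hω', hlin]
  · rw [← h'.integral_linVal_sq]
    refine integral_congr_ae ?_
    filter_upwards [h'.predError_ae_eq_of_equiv hC' h hC hi' hi,
      h'.predError_ae_eq hC' (hA.trans hi') hi] with ω hω hω'
    rw [hω, hω', hlin]

theorem measurable_vecchiaQuad (h : IsCentredGP Y P C) (C' : ℕ → ℕ → ℝ) (N : ℕ → Finset ℕ)
    (n : ℕ) : Measurable fun ω => vecchiaQuad C' N n (fun k => Y k ω) :=
  Finset.measurable_fun_sum _ fun _ _ => ((h.measurable_linVal n _).pow_const 2).div_const _

/-- The first summand suffices: it is a positive multiple of the square of a nondegenerate Gaussian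
variable. -/
theorem vecchiaQuad_pos_ae (h : IsCentredGP Y P C) (hC : IsPosDefBelow C n)
    (hC' : IsPosDefBelow C' n) (hn : 0 < n) {N : ℕ → Finset ℕ}
    (hN : ∀ i < n, N i ⊆ Finset.range i) :
    ∀ᵐ ω ∂P, 0 < vecchiaQuad C' N n (fun k => Y k ω) := by
  set L : Ω → ℝ := fun ω => linVal n (errCoef C' (N 0) 0) (fun k => Y k ω) with hL
  have h0 : (0 : ℕ) ∉ N 0 := fun h => by simpa using hN 0 hn h
  have hpos : 0 < covForm C n (errCoef C' (N 0) 0) (errCoef C' (N 0) 0) :=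
    hC.pos _ ⟨0, hn, by rw [errCoef_self h0]; exact one_ne_zero⟩
  have hne : ∀ᵐ ω ∂P, L ω ≠ 0 := by
    have h1 : (P.map L) {0} = 0 := by
      rw [h.map_linVal]
      have := nullSingletonClass_gaussianReal (μ := 0)
        (Real.toNNReal_pos.2 hpos).ne'
      exact measure_singleton 0
    rw [Measure.map_apply (h.measurable_linVal n _) (measurableSet_singleton 0)] at h1
    exact measure_eq_zero_iff_ae_notMem.1 h1
  filter_upwards [hne] with ω hω
  refine Finset.sum_pos' (fun i hi => ?_) ⟨0, Finset.mem_range.2 hn, ?_⟩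
  · exact div_nonneg (sq_nonneg _) (hC'.covForm_self_nonneg _)
  · exact div_pos (by positivity) (hC'.covForm_errCoef_pos hn h0)

end IsCentredGP

/-! ### The central limit theorem for rows of independent squares -/

theorem tendstoInDistribution_sum_sq_of_map_eq_pi {Ω : Type*} [MeasurableSpace Ω] {P : Measure Ω}
    [IsProbabilityMeasure P] {Z : ℕ → ℕ → Ω → ℝ} (hZ : ∀ n i, Measurable (Z n i))
    (hlaw : ∀ n, P.map (fun ω (i : Fin n) => Z n i ω) = Measure.pi fun _ => gaussianReal 0 1)
    (κ : ℝ) :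
    TendstoInDistribution
      (fun (n : ℕ) ω => (√n)⁻¹ * ∑ i ∈ Finset.range n, κ * (Z n i ω ^ 2 - 1)) atTop id
      (fun _ => P) (gaussianReal 0 (Real.toNNReal (2 * κ ^ 2))) := by
  -- The variables change with the row, but row n has the law of the first n coordinates of a single
  -- i.i.d. sequence. Convergence in distribution sees only these laws, so the classical theorem
  -- applies.
  set Q : Measure (ℕ → ℝ) := Measure.infinitePi fun _ => gaussianReal 0 1 with hQ
  set X : ℕ → (ℕ → ℝ) → ℝ := fun k x => κ * (x k ^ 2 - 1) with hX
  have hproj : ∀ k, Measurable fun x : ℕ → ℝ => x k := fun k => measurable_pi_apply k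
  have hmap : ∀ k, Q.map (fun x => x k) = gaussianReal 0 1 := fun k =>
    (measurePreserving_eval_infinitePi (fun _ => gaussianReal 0 1) k).map_eq
  have hmem : MemLp (X 0) 2 Q := (memLp_sq_sub_one_of_map_eq_gaussianReal (hproj 0) (hmap 0)).const_mul κ
  have hind0 : iIndepFun (fun k (x : ℕ → ℝ) => x k) Q :=
    iIndepFun_infinitePi (X := fun _ x => x) fun _ => measurable_id
  have hg : Measurable fun t : ℝ => κ * (t ^ 2 - 1) := by fun_prop
  have hind : iIndepFun X Q := hind0.comp (fun _ t => κ * (t ^ 2 - 1)) fun _ => hg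
  have hident : ∀ i, IdentDistrib (X i) (X 0) Q Q := fun i =>
    IdentDistrib.comp (u := fun t : ℝ => κ * (t ^ 2 - 1))
      ⟨(hproj i).aemeasurable, (hproj 0).aemeasurable, by rw [hmap, hmap]⟩ hg
  have hmean : Q[X 0] = 0 := by
    simp only [hX]
    rw [integral_const_mul, integral_sq_sub_one_of_map_eq_gaussianReal (hproj 0) (hmap 0), mul_zero]
  have hvar : Var[X 0; Q] = 2 * κ ^ 2 := by
    rw [variance_of_integral_eq_zero (by fun_prop) hmean]
    simp only [hX, mul_pow]
    rw [integral_const_mul,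
      integral_sq_sub_one_sq_of_map_eq_gaussianReal (hproj 0) (hmap 0), mul_comm]
  have hclt := tendstoInDistribution_inv_sqrt_mul_sum_sub (P := Q) (X := X)
    (P' := gaussianReal 0 (Real.toNNReal (2 * κ ^ 2))) (Y := id)
    (by rw [hvar]; exact HasLaw.id) hmem hind hident
  have hTm : ∀ n : ℕ, Measurable fun ω => (√(n : ℝ))⁻¹ * ∑ i ∈ Finset.range n, κ * (Z n i ω ^ 2 - 1) :=
    fun n => by
      have := hZ n
      fun_prop
  refine ⟨fun n => (hTm n).aemeasurable, aemeasurable_id, ?_⟩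
  refine hclt.tendsto.congr fun n => Subtype.ext ?_
  set g : (Fin n → ℝ) → ℝ := fun z => (√(n : ℝ))⁻¹ * ∑ i : Fin n, κ * (z i ^ 2 - 1) with hgdef
  have hgm : Measurable g := by fun_prop
  have hQn : Q.map (fun x (i : Fin n) => x i) = Measure.pi fun _ => gaussianReal 0 1 := by
    have h1 := hind0.precomp (g := fun i : Fin n => (i : ℕ)) Fin.val_injective
    rw [iIndepFun_iff_map_fun_eq_pi_map fun i => (hproj _).aemeasurable] at h1
    rw [h1]
    congr 1
    funext i
    exact hmap i
  have e1 : (fun ω => (√(n : ℝ))⁻¹ * ∑ i ∈ Finset.range n, κ * (Z n i ω ^ 2 - 1)) =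
      g ∘ fun ω (i : Fin n) => Z n i ω := by
    funext ω
    simp only [hgdef, Function.comp]
    rw [Finset.sum_range fun i => κ * (Z n i ω ^ 2 - 1)]
  have e2 : (fun x => (√(n : ℝ))⁻¹ * (∑ k ∈ Finset.range n, X k x - n * Q[X 0])) =
      g ∘ fun x (i : Fin n) => x i := by
    funext x
    simp only [hgdef, Function.comp]
    rw [hmean, mul_zero, sub_zero, Finset.sum_range fun i => X i x]
  have hZ' : Measurable fun ω (i : Fin n) => Z n i ω := measurable_pi_lambda _ fun i => hZ n i
  have hp' : Measurable fun (x : ℕ → ℝ) (i : Fin n) => x i :=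
    measurable_pi_lambda _ fun i => hproj i
  change Q.map (fun x => (√(n : ℝ))⁻¹ * (∑ k ∈ Finset.range n, X k x - n * Q[X 0])) =
    P.map (fun ω => (√(n : ℝ))⁻¹ * ∑ i ∈ Finset.range n, κ * (Z n i ω ^ 2 - 1))
  rw [e1, e2, ← Measure.map_map hgm hZ', ← Measure.map_map hgm hp', hlaw, hQn]

/-! ### Sums of square-summable sequences -/

/-- Bounded partial sums make the squares summable. Cauchy–Schwarz beyond a large index gives √n
times a small tail, and the head is a constant. -/
theorem isLittleO_sum_of_sum_sq_isBigO {x : ℕ → ℝ}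
    (h : (fun n : ℕ => ∑ i ∈ Finset.range n, x i ^ 2) =O[atTop] fun _ => (1 : ℝ)) :
    (fun n : ℕ => ∑ i ∈ Finset.range n, x i) =o[atTop] fun n : ℕ => √(n : ℝ) := by
  obtain ⟨M, hM⟩ := h.bound
  have hsum : Summable fun i => x i ^ 2 := by
    obtain ⟨m, hm⟩ := eventually_atTop.1 hM
    refine summable_of_sum_range_le (c := M) (fun i => sq_nonneg _) fun n => ?_
    have h1 := hm (max n m) (le_max_right _ _)
    rw [norm_one, mul_one] at h1
    exact (Finset.sum_le_sum_of_subset_of_nonneg (Finset.range_mono (le_max_left n m))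
      fun i _ _ => sq_nonneg _).trans ((Real.le_norm_self _).trans h1)
  rw [isLittleO_iff]
  intro ε hε
  have htail := tendsto_sum_nat_add fun i => x i ^ 2
  obtain ⟨m, hm⟩ := (htail.eventually (gt_mem_nhds (show (0 : ℝ) < (ε / 2) ^ 2 by positivity))).exists
  have hcau : ∀ n, m ≤ n → |∑ i ∈ Finset.Ico m n, x i| ≤ ε / 2 * √n := by
    intro n hmn
    refine abs_le_of_sq_le_sq ?_ (by positivity)
    have h1 := sq_sum_le_card_mul_sum_sq (s := Finset.Ico m n) (f := x)
    have h2 : ∑ i ∈ Finset.Ico m n, x i ^ 2 ≤ ∑' k, x (k + m) ^ 2 := by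
      rw [Finset.sum_Ico_eq_sum_range]
      simp only [add_comm m]
      exact ((summable_nat_add_iff m).2 hsum).sum_le_tsum _ fun _ _ => sq_nonneg _
    have h3 : ((Finset.Ico m n).card : ℝ) ≤ n := by
      rw [Nat.card_Ico]
      exact_mod_cast Nat.sub_le n m
    rw [mul_pow, Real.sq_sqrt (Nat.cast_nonneg n), mul_comm]
    exact h1.trans (mul_le_mul h3 (h2.trans hm.le) (Finset.sum_nonneg fun _ _ => sq_nonneg _)
      (Nat.cast_nonneg n))
  have hroot : Tendsto (fun n : ℕ => √(n : ℝ)) atTop atTop :=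
    Real.tendsto_sqrt_atTop.comp tendsto_natCast_atTop_atTop
  filter_upwards [eventually_ge_atTop m,
    hroot.eventually_ge_atTop (|∑ i ∈ Finset.range m, x i| / (ε / 2))] with n hmn hn
  rw [Real.norm_eq_abs, Real.norm_of_nonneg (Real.sqrt_nonneg _),
    ← Finset.sum_range_add_sum_Ico _ hmn]
  refine (abs_add_le _ _).trans ?_
  have h1 := hcau n hmn
  rw [div_le_iff₀ (by positivity)] at hn
  linarith

/-! ### Asymptotics of the approximation error -/

theorem isBigO_one_of_le {f g : ℕ → ℝ} {K : ℝ} (hf : ∀ n, 0 ≤ f n) (h : ∀ n, f n ≤ K * g n)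
    (hg : g =O[atTop] fun _ => (1 : ℝ)) : f =O[atTop] fun _ => (1 : ℝ) := by
  refine IsBigO.trans (IsBigO.of_bound |K| (Eventually.of_forall fun n => ?_)) hg
  rw [Real.norm_of_nonneg (hf n), Real.norm_eq_abs, ← abs_mul]
  exact (h n).trans (le_abs_self _)

/-- The second alternative implies the first at the cost of K²: d₀/t ≤ K² d₁/p, and p/t - 1 =
-(p/t)(t/p - 1) with p/t ≤ K. -/
theorem isBigO_sum_div_of_or {p t d₀ d₁ : ℕ → ℕ → ℝ} {K : ℝ} (hp : ∀ n, ∀ i < n, 0 < p n i)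
    (ht : ∀ n, ∀ i < n, 0 < t n i) (hpt : ∀ n, ∀ i < n, p n i ≤ K * t n i)
    (hd : ∀ n, ∀ i < n, 0 ≤ d₀ n i) (hdd : ∀ n, ∀ i < n, d₀ n i ≤ K * d₁ n i)
    (h : ((fun n : ℕ => ∑ i ∈ Finset.range n, d₀ n i / t n i) =O[atTop] (fun _ => (1 : ℝ)) ∧
        (fun n : ℕ => ∑ i ∈ Finset.range n, (p n i / t n i - 1) ^ 2)
          =O[atTop] (fun _ => (1 : ℝ))) ∨
      ((fun n : ℕ => ∑ i ∈ Finset.range n, d₁ n i / p n i) =O[atTop] (fun _ => (1 : ℝ)) ∧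
        (fun n : ℕ => ∑ i ∈ Finset.range n, (t n i / p n i - 1) ^ 2)
          =O[atTop] (fun _ => (1 : ℝ)))) :
    (fun n : ℕ => ∑ i ∈ Finset.range n, d₀ n i / t n i) =O[atTop] (fun _ => (1 : ℝ)) ∧
      (fun n : ℕ => ∑ i ∈ Finset.range n, (p n i / t n i - 1) ^ 2)
        =O[atTop] (fun _ => (1 : ℝ)) := by
  rcases h with h | ⟨h₁, h₂⟩
  · exact h
  constructor
  · refine isBigO_one_of_le (K := K ^ 2) (fun n => Finset.sum_nonneg fun i hi => ?_) (fun n => ?_) h₁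
    · rw [Finset.mem_range] at hi
      exact div_nonneg (hd n i hi) (ht n i hi).le
    · rw [Finset.mul_sum]
      refine Finset.sum_le_sum fun i hi => ?_
      rw [Finset.mem_range] at hi
      have hp' := hp n i hi
      have ht' := ht n i hi
      have hpt' := hpt n i hi
      have hKd := (hd n i hi).trans (hdd n i hi)
      rw [← mul_div_assoc, div_le_div_iff₀ ht' hp']
      calc d₀ n i * p n i ≤ (K * d₁ n i) * (K * t n i) :=
            mul_le_mul (hdd n i hi) hpt' hp'.le hKd
        _ = K ^ 2 * d₁ n i * t n i := by ring
  · refine isBigO_one_of_le (K := K ^ 2) (fun n => Finset.sum_nonneg fun i hi => sq_nonneg _)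
      (fun n => ?_) h₂
    rw [Finset.mul_sum]
    refine Finset.sum_le_sum fun i hi => ?_
    rw [Finset.mem_range] at hi
    have hp' := hp n i hi
    have ht' := ht n i hi
    have hq : p n i / t n i ≤ K := by
      rw [div_le_iff₀ ht']
      exact hpt n i hi
    have e : (p n i / t n i - 1) ^ 2 = (p n i / t n i) ^ 2 * (t n i / p n i - 1) ^ 2 := by
      field_simp
      ring
    rw [e]
    have := div_pos hp' ht'
    gcongr

theorem isLittleO_sqrt_of_isBigO_one {f : ℕ → ℝ} (hf : f =O[atTop] fun _ => (1 : ℝ)) :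
    f =o[atTop] fun n : ℕ => √(n : ℝ) := by
  refine hf.trans_isLittleO ?_
  rw [isLittleO_const_left]
  right
  simp only [Function.comp_def, Real.norm_of_nonneg (Real.sqrt_nonneg _)]
  exact Real.tendsto_sqrt_atTop.comp tendsto_natCast_atTop_atTop

/-- Everything except the drift is O(1), since the factors `q` are bounded by `K`. -/
theorem isLittleO_rowBound {q r : ℕ → ℕ → ℝ} {K : ℝ} (hq : ∀ n, ∀ i < n, 0 ≤ q n i)
    (hqK : ∀ n, ∀ i < n, q n i ≤ K) (hr : ∀ n, ∀ i < n, 0 ≤ r n i)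
    (h₁ : (fun n : ℕ => ∑ i ∈ Finset.range n, r n i) =O[atTop] (fun _ => (1 : ℝ)))
    (h₂ : (fun n : ℕ => ∑ i ∈ Finset.range n, (q n i - 1) ^ 2) =O[atTop] (fun _ => (1 : ℝ)))
    (h₃ : (fun n : ℕ => ∑ i ∈ Finset.range n, (q n i - 1)) =o[atTop] fun n : ℕ => √(n : ℝ)) :
    (fun n : ℕ => ∑ i ∈ Finset.range n, r n i
      + (1 + ∑ i ∈ Finset.range n, (8 * q n i * r n i + 4 * (q n i - 1) ^ 2)) / 2
      + |∑ i ∈ Finset.range n, (q n i - 1)|) =o[atTop] fun n : ℕ => √(n : ℝ) := by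
  refine IsLittleO.add (isLittleO_sqrt_of_isBigO_one (h₁.add ?_)) ?_
  · simp only [div_eq_inv_mul]
    refine IsBigO.const_mul_left (IsBigO.add (isBigO_refl _ _) ?_) _
    simp only [Finset.sum_add_distrib]
    refine IsBigO.add ?_ ?_
    · refine isBigO_one_of_le (K := 8 * K)
        (fun n => Finset.sum_nonneg fun i hi => ?_) (fun n => ?_) h₁
      · rw [Finset.mem_range] at hi
        have := hq n i hi
        have := hr n i hi
        positivity
      · rw [Finset.mul_sum]
        refine Finset.sum_le_sum fun i hi => ?_
        rw [Finset.mem_range] at hi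
        have := hqK n i hi
        have := hr n i hi
        gcongr
    · simp only [← Finset.mul_sum]
      exact h₂.const_mul_left 4
  · simp only [← Real.norm_eq_abs]
    exact h₃.norm_left

/-! ### The drift for nested designs -/

theorem errCoef_congr {C C' : ℕ → ℕ → ℝ} {A : Finset ℕ} {i n : ℕ} (hA : A ⊆ Finset.range n)
    (hi : i < n) (h : ∀ k < n, ∀ l < n, C' k l = C k l) : errCoef C' A i = errCoef C A i := by
  have hA' : ∀ a : A, (a : ℕ) < n := fun a => Finset.mem_range.1 (hA a.2)
  have h1 : subMatrix C' A = subMatrix C A := by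
    ext a b
    exact h _ (hA' a) _ (hA' b)
  have h2 : (fun a : A => C' a i) = fun a : A => C a i := funext fun a => h _ (hA' a) _ hi
  funext k
  rw [errCoef, errCoef, regCoef, regCoef, h1, h2]

/-- The size n is only a cut-off for the sums: the additional coefficient is zero. -/
theorem errVar_succ {C C' : ℕ → ℕ → ℝ} {A : Finset ℕ} {i n : ℕ} (hi : i < n)
    (hA : A ⊆ Finset.range i) (h : ∀ k < n, ∀ l < n, C' k l = C k l) :
    errVar C' (n + 1) A i = errVar C n A i := by
  have h0 : errCoef C A i n = 0 :=
    errCoef_of_notMem (fun hn => by have := Finset.mem_range.1 (hA hn); omega) hi.ne'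
  rw [errVar, errVar, errCoef_congr (hA.trans (Finset.range_subset_range.2 hi.le)) hi h, covForm,
    covForm, Finset.sum_range_succ]
  simp only [Finset.sum_range_succ, h0, mul_zero, zero_mul, add_zero, Finset.sum_const_zero]
  refine Finset.sum_congr rfl fun k hk => Finset.sum_congr rfl fun l hl => ?_
  rw [h k (Finset.mem_range.1 hk) l (Finset.mem_range.1 hl)]

theorem isLittleO_sum_of_nested {x : ℕ → ℕ → ℝ} (hx : ∀ n, ∀ i < n, x (n + 1) i = x n i)
    (h : (fun n : ℕ => ∑ i ∈ Finset.range n, x n i ^ 2) =O[atTop] fun _ => (1 : ℝ)) :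
    (fun n : ℕ => ∑ i ∈ Finset.range n, x n i) =o[atTop] fun n : ℕ => √(n : ℝ) := by
  -- In a nested array the i-th entry is settled from row i + 1 on, so all rows are initial segments
  -- of one sequence.
  have hfix : ∀ n, ∀ i < n, x n i = x (i + 1) i := by
    intro n i hi
    induction n, Nat.succ_le_iff.2 hi using Nat.le_induction with
    | base => rfl
    | succ m hm ih => rw [hx m i hm, ih hm]
  have h1 : ∀ n, ∑ i ∈ Finset.range n, x n i = ∑ i ∈ Finset.range n, x (i + 1) i := fun n =>
    Finset.sum_congr rfl fun i hi => hfix n i (Finset.mem_range.1 hi)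
  have h2 : ∀ n, ∑ i ∈ Finset.range n, x n i ^ 2 = ∑ i ∈ Finset.range n, x (i + 1) i ^ 2 :=
    fun n => Finset.sum_congr rfl fun i hi => by rw [hfix n i (Finset.mem_range.1 hi)]
  simp only [h1]
  simp only [h2] at h
  exact isLittleO_sum_of_sum_sq_isBigO h

/-! ### Prediction with Matérn covariances -/

section Matern

variable {E : Type*} [NormedAddCommGroup E] [InnerProductSpace ℝ E] [FiniteDimensional ℝ E]
  [MeasurableSpace E] [BorelSpace E] {v₀ v₁ φ₀ φ₁ ν : ℝ}

theorem isPosDefBelow_matern {v φ : ℝ} (hv : 0 < v) (hφ : 0 < φ) (hν : 0 < ν) {x : ℕ → E} {n : ℕ}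
    (hx : Set.InjOn x (Set.Iio n)) : IsPosDefBelow (fun k l => matern v φ ν ‖x k - x l‖) n where
  symm k l := matern_comm v φ ν x k l
  pos _ hc := covForm_matern_pos hv hφ hν hx hc

/-- Dividing |t_i - p_i| ≤ B (p_i W_i + d_i) by t_i and using p_i ≤ K t_i bounds the drift by a
multiple of ∑ W_i + ∑ d_i/t_i. The first sum is O(n^(3/7)), the second O(1). -/
theorem isLittleO_drift_of_finrank_le (hdim : Module.finrank ℝ E ≤ 3) (hv₀ : 0 < v₀) (hv₁ : 0 < v₁)
    (hφ₀ : 0 < φ₀) (hφ₁ : 0 < φ₁) (hν : 0 < ν) (hv : v₁ * φ₁ ^ (2 * ν) = v₀ * φ₀ ^ (2 * ν))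
    {D : Set E} (hD : Bornology.IsBounded D) {x : ℕ → ℕ → E} (hxD : ∀ n, ∀ k < n, x n k ∈ D)
    (hx : ∀ n, Set.InjOn (x n) (Set.Iio n)) {N : ℕ → ℕ → Finset ℕ}
    (hN : ∀ n, ∀ i < n, N n i ⊆ Finset.range i) {C₀ C₁ : ℕ → ℕ → ℕ → ℝ}
    (hC₀ : C₀ = fun n k l => matern v₀ φ₀ ν ‖x n k - x n l‖)
    (hC₁ : C₁ = fun n k l => matern v₁ φ₁ ν ‖x n k - x n l‖) {K : ℝ} (hK : 0 < K)
    (hratio : ∀ n, ∀ i < n,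
      errVar (C₀ n) n (Finset.range i) i ≤ K * errVar (C₁ n) n (N n i) i)
    (h : (fun n : ℕ => ∑ i ∈ Finset.range n,
        covForm (C₀ n) n (errDiff (C₀ n) (C₁ n) (N n i) i) (errDiff (C₀ n) (C₁ n) (N n i) i) /
          errVar (C₁ n) n (N n i) i) =O[atTop] fun _ => (1 : ℝ)) :
    (fun n : ℕ => ∑ i ∈ Finset.range n,
      (errVar (C₀ n) n (Finset.range i) i / errVar (C₁ n) n (N n i) i - 1))
        =o[atTop] fun n : ℕ => √(n : ℝ) := by
  obtain ⟨B, hB, hdiff⟩ := exists_abs_covForm_matern_sub_le hdim hv₀ hv₁ hφ₀ hφ₁ hν hv hD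
  have hP₀ : ∀ n, IsPosDefBelow (C₀ n) n := fun n => by
    rw [hC₀]; exact isPosDefBelow_matern hv₀ hφ₀ hν (hx n)
  have hP₁ : ∀ n, IsPosDefBelow (C₁ n) n := fun n => by
    rw [hC₁]; exact isPosDefBelow_matern hv₁ hφ₁ hν (hx n)
  set S : ℕ → ℝ := fun n => ∑ i ∈ Finset.range n,
        covForm (C₀ n) n (errDiff (C₀ n) (C₁ n) (N n i) i) (errDiff (C₀ n) (C₁ n) (N n i) i) /
          errVar (C₁ n) n (N n i) i with hS
  have hS0 : ∀ n, 0 ≤ S n := fun n => Finset.sum_nonneg fun i hi => by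
    rw [Finset.mem_range] at hi
    exact div_nonneg ((hP₀ n).covForm_self_nonneg _) ((hP₁ n).errVar_pos hi (hN n i hi)).le
  have hbound : ∀ n : ℕ, 0 < n → |∑ i ∈ Finset.range n,
      (errVar (C₀ n) n (Finset.range i) i / errVar (C₁ n) n (N n i) i - 1)| ≤
        B * K * B * (n : ℝ) ^ (3 / 7 : ℝ) + B * S n := by
    intro n hn
    obtain ⟨W, hW, hWsum, hWle⟩ := hdiff (x n) n hn (hxD n)
      (fun i => errCoef (C₀ n) (Finset.range i) i) (fun i => errDiff (C₀ n) (C₁ n) (N n i) i)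
      (fun i hi j hj hij => by
        have := (hP₀ n).covForm_errCoef_range hi hj hij
        simpa only [hC₀] using this)
      (fun i hi => by
        have := (hP₀ n).errVar_pos hi subset_rfl
        simpa only [errVar, hC₀] using this)
      (fun i hi => by
        have := (hP₀ n).covForm_errCoef_errDiff (C' := C₁ n) hi (hN n i hi)
        simpa only [hC₀] using this)
    have hterm : ∀ i ∈ Finset.range n,
        |errVar (C₀ n) n (Finset.range i) i / errVar (C₁ n) n (N n i) i - 1| ≤
          B * K * W i + B * (covForm (C₀ n) n (errDiff (C₀ n) (C₁ n) (N n i) i)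
            (errDiff (C₀ n) (C₁ n) (N n i) i) / errVar (C₁ n) n (N n i) i) := by
      intro i hi
      rw [Finset.mem_range] at hi
      have h1 : |errVar (C₁ n) n (N n i) i - errVar (C₀ n) n (Finset.range i) i| ≤
          B * (errVar (C₀ n) n (Finset.range i) i * W i +
            covForm (C₀ n) n (errDiff (C₀ n) (C₁ n) (N n i) i)
              (errDiff (C₀ n) (C₁ n) (N n i) i)) := by
        have := hWle i hi
        rw [errCoef_add_errDiff] at this
        simpa only [errVar, hC₀, hC₁] using this
      have ht := (hP₁ n).errVar_pos hi (hN n i hi)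
      have hr := hratio n i hi
      set p := errVar (C₀ n) n (Finset.range i) i
      set t := errVar (C₁ n) n (N n i) i
      set d := covForm (C₀ n) n (errDiff (C₀ n) (C₁ n) (N n i) i) (errDiff (C₀ n) (C₁ n) (N n i) i)
      rw [div_sub_one ht.ne', abs_div, abs_of_pos ht, abs_sub_comm, div_le_iff₀ ht]
      refine h1.trans ?_
      have h2 : p * W i ≤ K * t * W i := mul_le_mul_of_nonneg_right hr (hW i)
      calc B * (p * W i + d) ≤ B * (K * t * W i + d) := by gcongr
        _ = (B * K * W i + B * (d / t)) * t := by field_simp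
    calc _ ≤ _ := Finset.abs_sum_le_sum_abs _ _
      _ ≤ _ := Finset.sum_le_sum hterm
      _ = B * K * ∑ i ∈ Finset.range n, W i + B * S n := by
        rw [Finset.sum_add_distrib, Finset.mul_sum, Finset.mul_sum]
      _ ≤ B * K * (B * (n : ℝ) ^ (3 / 7 : ℝ)) + B * S n := by gcongr
      _ = _ := by ring
  have hrpow : (fun n : ℕ => (n : ℝ) ^ (3 / 7 : ℝ)) =o[atTop] fun n : ℕ => √(n : ℝ) := by
    simp only [Real.sqrt_eq_rpow]
    refine (isLittleO_of_tendsto' (f := fun x : ℝ => x ^ (3 / 7 : ℝ))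
      (g := fun x : ℝ => x ^ (1 / 2 : ℝ)) ?_ ?_).comp_tendsto tendsto_natCast_atTop_atTop
    · filter_upwards [eventually_gt_atTop 0] with x hx h0
      exact absurd h0 (Real.rpow_pos_of_pos hx _).ne'
    · refine (tendsto_rpow_neg_atTop (show (0 : ℝ) < 1 / 14 by norm_num)).congr' ?_
      filter_upwards [eventually_gt_atTop 0] with x hx
      rw [← Real.rpow_sub hx]
      norm_num
  refine IsBigO.trans_isLittleO ?_
    ((hrpow.const_mul_left (B * K * B)).add ((isLittleO_sqrt_of_isBigO_one h).const_mul_left B))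
  refine IsBigO.of_bound 1 ?_
  filter_upwards [eventually_gt_atTop 0] with n hn
  rw [one_mul, Real.norm_eq_abs, Real.norm_eq_abs]
  exact (hbound n hn).trans (le_abs_self _)

end Matern

/-! ### The limit law of Vecchia's quadratic form -/

section

variable {Ω : Type*} [mΩ : MeasurableSpace Ω] {P : Measure Ω} [IsProbabilityMeasure P]

theorem tendstoInMeasure_of_integral_abs_le {f : ℕ → Ω → ℝ} {b : ℕ → ℝ}
    (hf : ∀ n, Integrable (f n) P) (hb : ∀ n, ∫ ω, |f n ω| ∂P ≤ b n)
    (h : b =o[atTop] fun n : ℕ => √(n : ℝ)) (κ : ℝ) :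
    TendstoInMeasure P (fun (n : ℕ) ω => κ * ((√(n : ℝ))⁻¹ * f n ω)) atTop 0 := by
  have hlim : Tendsto (fun n : ℕ => |κ| * (b n / √(n : ℝ))) atTop (𝓝 0) := by
    simpa using h.tendsto_div_nhds_zero.const_mul |κ|
  refine tendstoInMeasure_of_tendsto_eLpNorm one_ne_zero
    (fun n => (((hf n).const_mul _).const_mul κ).aestronglyMeasurable)
    aestronglyMeasurable_const ?_
  have hnorm : ∀ n : ℕ, eLpNorm ((fun ω => κ * ((√(n : ℝ))⁻¹ * f n ω)) - 0) 1 P =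
      ENNReal.ofReal (|κ| * ((√(n : ℝ))⁻¹ * ∫ ω, |f n ω| ∂P)) := by
    intro n
    rw [sub_zero, eLpNorm_one_eq_lintegral_enorm,
      ← ofReal_integral_norm_eq_lintegral_enorm (((hf n).const_mul _).const_mul κ)]
    congr 1
    simp only [norm_mul, Real.norm_eq_abs]
    rw [integral_const_mul, integral_const_mul, abs_of_nonneg (inv_nonneg.2 (Real.sqrt_nonneg _))]
  refine tendsto_of_tendsto_of_tendsto_of_le_of_le tendsto_const_nhds
    (h := fun n : ℕ => ENNReal.ofReal (|κ| * (b n / √(n : ℝ)))) ?_ (fun _ => bot_le) fun n => ?_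
  · simpa using ENNReal.tendsto_ofReal hlim
  · change eLpNorm ((fun ω => κ * ((√(n : ℝ))⁻¹ * f n ω)) - 0) 1 P ≤ _
    rw [hnorm]
    refine ENNReal.ofReal_le_ofReal ?_
    rw [div_eq_inv_mul]
    have := hb n
    gcongr

/-- Slutsky: `T` differs from κ n^(-1/2) ∑ (Z_i² - 1) by κ n^(-1/2) (Q - ∑ Z_i²), which tends to 0
in L¹ and so in probability. -/
theorem tendstoInDistribution_of_ae_eq_quad {Q T : ℕ → Ω → ℝ} {Z : ℕ → ℕ → Ω → ℝ} {b : ℕ → ℝ}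
    (κ : ℝ) (hZ : ∀ n i, Measurable (Z n i))
    (hlaw : ∀ n, P.map (fun ω (i : Fin n) => Z n i ω) = Measure.pi fun _ => gaussianReal 0 1)
    (hQm : ∀ n, Measurable (Q n))
    (hint : ∀ n, Integrable (fun ω => Q n ω - ∑ i ∈ Finset.range n, Z n i ω ^ 2) P)
    (hb : ∀ n, ∫ ω, |Q n ω - ∑ i ∈ Finset.range n, Z n i ω ^ 2| ∂P ≤ b n)
    (hbo : b =o[atTop] fun n : ℕ => √(n : ℝ))
    (hT : ∀ n : ℕ, T n =ᵐ[P] fun ω => κ * ((√(n : ℝ))⁻¹ * (Q n ω - n))) :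
    TendstoInDistribution T atTop id (fun _ => P)
      (gaussianReal 0 (Real.toNNReal (2 * κ ^ 2))) := by
  refine tendstoInDistribution_of_tendstoInMeasure_sub T id
    (tendstoInDistribution_sum_sq_of_map_eq_pi hZ hlaw κ) ?_ fun n => ?_
  · refine (tendstoInMeasure_of_integral_abs_le hint hb hbo κ).congr_left fun n => ?_
    filter_upwards [hT n] with ω hω
    rw [Pi.sub_apply, Pi.sub_apply, hω, ← Finset.mul_sum, Finset.sum_sub_distrib]
    simp only [Finset.sum_const, Finset.card_range, nsmul_eq_mul, mul_one]
    ring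
  · have := hQm n
    exact AEMeasurable.congr (by fun_prop) (hT n).symm

end

/-! ### From the quadratic form to the maximiser of the likelihood. -/

theorem theorem1 {d : ℕ} (D : Set (EuclideanSpace ℝ (Fin d))) (hD : Bornology.IsBounded D)
    {Ω : Type*} [MeasurableSpace Ω] (y : D → Ω → ℝ)
    (P₀ P₁ : Measure Ω) [IsProbabilityMeasure P₀] [IsProbabilityMeasure P₁]
    -- `v₀` and `v₁` are the variances `σ₀²` and `σ₁²`
    (v₀ v₁ φ₀ φ₁ ν : ℝ) (hv₀ : 0 < v₀) (hφ₀ : 0 < φ₀) (hφ₁ : 0 < φ₁) (hν : 0 < ν)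
    (hv₁ : v₁ = v₀ * φ₀ ^ (2 * ν) / φ₁ ^ (2 * ν))
    (hP₀ : IsCentredGP y P₀ fun t u => matern v₀ φ₀ ν ‖(t : EuclideanSpace ℝ (Fin d)) - u‖)
    (hP₁ : IsCentredGP y P₁ fun t u => matern v₁ φ₁ ν ‖(t : EuclideanSpace ℝ (Fin d)) - u‖)
    -- at sample size `n` the distinct locations are `s n 0, …, s n (n - 1)`, and the `i`-th
    -- observation is conditioned on the earlier ones with index in `N n i`
    (s : ℕ → ℕ → D) (hs : ∀ n, Set.InjOn (s n) (Set.Iio n))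
    (N : ℕ → ℕ → Finset ℕ) (hN : ∀ n, ∀ i < n, N n i ⊆ Finset.range i)
    (hdesign : d ≤ 3 ∨ ∀ n, ∀ i < n, s (n + 1) i = s n i ∧ N (n + 1) i = N n i)
    (hcond :
      ((fun n : ℕ => ∑ i ∈ Finset.range n,
          (∫ ω, (predError P₁ y (s n) (N n i) i ω
              - predError P₀ y (s n) (Finset.range i) i ω) ^ 2 ∂P₀)
            / ∫ ω, predError P₁ y (s n) (N n i) i ω ^ 2 ∂P₁) =O[atTop] (fun _ => (1 : ℝ)) ∧
        (fun n : ℕ => ∑ i ∈ Finset.range n,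
          ((∫ ω, predError P₀ y (s n) (Finset.range i) i ω ^ 2 ∂P₀)
            / (∫ ω, predError P₁ y (s n) (N n i) i ω ^ 2 ∂P₁) - 1) ^ 2)
          =O[atTop] (fun _ => (1 : ℝ))) ∨
      ((fun n : ℕ => ∑ i ∈ Finset.range n,
          (∫ ω, (predError P₁ y (s n) (N n i) i ω
              - predError P₀ y (s n) (Finset.range i) i ω) ^ 2 ∂P₁)
            / ∫ ω, predError P₀ y (s n) (Finset.range i) i ω ^ 2 ∂P₀)
          =O[atTop] (fun _ => (1 : ℝ)) ∧
        (fun n : ℕ => ∑ i ∈ Finset.range n,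
          ((∫ ω, predError P₁ y (s n) (N n i) i ω ^ 2 ∂P₁)
            / (∫ ω, predError P₀ y (s n) (Finset.range i) i ω ^ 2 ∂P₀) - 1) ^ 2)
          =O[atTop] (fun _ => (1 : ℝ)))) :
    (∀ n ≥ 1, ∀ᵐ ω ∂P₀, ∃! v,
      IsVecchiaMLE φ₁ ν (fun i => (s n i : EuclideanSpace ℝ (Fin d))) (N n) n
        (fun i => y (s n i) ω) v) ∧
    ∀ σhat : ℕ → Ω → ℝ,
      (∀ n ≥ 1, ∀ᵐ ω ∂P₀,
        IsVecchiaMLE φ₁ ν (fun i => (s n i : EuclideanSpace ℝ (Fin d))) (N n) n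
          (fun i => y (s n i) ω) (σhat n ω)) →
      TendstoInDistribution
        (fun (n : ℕ) ω => √(n : ℝ) * (σhat n ω * φ₁ ^ (2 * ν) - v₀ * φ₀ ^ (2 * ν)))
        atTop id (fun _ => P₀)
        (gaussianReal 0 (Real.toNNReal (2 * (v₀ * φ₀ ^ (2 * ν)) ^ 2))) := by
  have hφ₁ν : (0 : ℝ) < φ₁ ^ (2 * ν) := Real.rpow_pos_of_pos hφ₁ _
  have hφ₀ν : (0 : ℝ) < φ₀ ^ (2 * ν) := Real.rpow_pos_of_pos hφ₀ _
  have hv₁0 : 0 < v₁ := by rw [hv₁]; positivity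
  have hv : v₁ * φ₁ ^ (2 * ν) = v₀ * φ₀ ^ (2 * ν) := by
    rw [hv₁, div_mul_cancel₀ _ hφ₁ν.ne']
  set x : ℕ → ℕ → EuclideanSpace ℝ (Fin d) := fun n k => (s n k : EuclideanSpace ℝ (Fin d)) with hx
  have hxinj : ∀ n, Set.InjOn (x n) (Set.Iio n) := fun n =>
    Subtype.val_injective.comp_injOn (hs n)
  set C₀ : ℕ → ℕ → ℕ → ℝ := fun n k l => matern v₀ φ₀ ν ‖x n k - x n l‖ with hC₀
  set C₁ : ℕ → ℕ → ℕ → ℝ := fun n k l => matern v₁ φ₁ ν ‖x n k - x n l‖ with hC₁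
  have hPD₀ : ∀ n, IsPosDefBelow (C₀ n) n := fun n => isPosDefBelow_matern hv₀ hφ₀ hν (hxinj n)
  have hPD₁ : ∀ n, IsPosDefBelow (C₁ n) n := fun n => isPosDefBelow_matern hv₁0 hφ₁ hν (hxinj n)
  set Y : ℕ → ℕ → Ω → ℝ := fun n k => y (s n k) with hY
  have hG₀ : ∀ n, IsCentredGP (Y n) P₀ (C₀ n) := fun n => hP₀.comp (s n)
  have hG₁ : ∀ n, IsCentredGP (Y n) P₁ (C₁ n) := fun n => hP₁.comp (s n)
  obtain ⟨K, hK, hcomp⟩ := exists_covForm_matern_le (E := EuclideanSpace ℝ (Fin d))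
    hv₀ hv₁0 hφ₀ hφ₁ hν
  set p : ℕ → ℕ → ℝ := fun n i => errVar (C₀ n) n (Finset.range i) i with hp
  set t : ℕ → ℕ → ℝ := fun n i => errVar (C₁ n) n (N n i) i with ht
  set δ : ℕ → ℕ → ℕ → ℝ := fun n i => errDiff (C₀ n) (C₁ n) (N n i) i with hδ
  have hp0 : ∀ n, ∀ i < n, 0 < p n i := fun n i hi => (hPD₀ n).errVar_pos hi subset_rfl
  have ht0 : ∀ n, ∀ i < n, 0 < t n i := fun n i hi => (hPD₁ n).errVar_pos hi (hN n i hi)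
  have hpt : ∀ n, ∀ i < n, p n i ≤ K * t n i := fun n i hi =>
    ((hPD₀ n).errVar_range_le hi (hN n i hi)).trans (hcomp (x n) n _)
  have hsub : ∀ n, ∀ i < n, _ := fun n i hi =>
    (hG₀ n).integral_predError_sub_sq (hPD₀ n) (hG₁ n) (hPD₁ n) hi (hN n i hi)
  have hsq₀ : ∀ n, ∀ i < n, ∫ ω, predError P₀ y (s n) (Finset.range i) i ω ^ 2 ∂P₀ = p n i :=
    fun n i hi => (hG₀ n).integral_predError_sq (hPD₀ n) hi subset_rfl
  have hsq₁ : ∀ n, ∀ i < n, ∫ ω, predError P₁ y (s n) (N n i) i ω ^ 2 ∂P₁ = t n i :=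
    fun n i hi => (hG₁ n).integral_predError_sq (hPD₁ n) hi (hN n i hi)
  have hsub₀ : ∀ n, ∀ i < n, ∫ ω, (predError P₁ y (s n) (N n i) i ω
      - predError P₀ y (s n) (Finset.range i) i ω) ^ 2 ∂P₀ = covForm (C₀ n) n (δ n i) (δ n i) :=
    fun n i hi => (hsub n i hi).1
  have hsub₁ : ∀ n, ∀ i < n, ∫ ω, (predError P₁ y (s n) (N n i) i ω
      - predError P₀ y (s n) (Finset.range i) i ω) ^ 2 ∂P₁ = covForm (C₁ n) n (δ n i) (δ n i) :=
    fun n i hi => (hsub n i hi).2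
  have hcongr : ∀ {f g : ℕ → ℕ → ℝ}, (∀ n, ∀ i < n, f n i = g n i) →
      (fun n : ℕ => ∑ i ∈ Finset.range n, f n i) =O[atTop] (fun _ => (1 : ℝ)) →
      (fun n : ℕ => ∑ i ∈ Finset.range n, g n i) =O[atTop] (fun _ => (1 : ℝ)) :=
    fun h hO => hO.congr_left fun n =>
      Finset.sum_congr rfl fun i hi => h n i (Finset.mem_range.1 hi)
  -- Once the expectations are rewritten as covariance forms, either alternative yields the first
  -- pair of bounds.
  obtain ⟨hS₁, hS₂⟩ := isBigO_sum_div_of_or (d₀ := fun n i => covForm (C₀ n) n (δ n i) (δ n i))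
    (d₁ := fun n i => covForm (C₁ n) n (δ n i) (δ n i)) hp0 ht0 hpt
    (fun n i _ => (hPD₀ n).covForm_self_nonneg (δ n i)) (fun n i _ => hcomp (x n) n (δ n i))
    (hcond.imp
      (And.imp (hcongr fun n i hi => by rw [hsub₀ n i hi, hsq₁ n i hi])
        (hcongr fun n i hi => by rw [hsq₀ n i hi, hsq₁ n i hi]))
      (And.imp (hcongr fun n i hi => by rw [hsub₁ n i hi, hsq₀ n i hi])
        (hcongr fun n i hi => by rw [hsq₁ n i hi, hsq₀ n i hi])))
  have hdrift : (fun n : ℕ => ∑ i ∈ Finset.range n, (p n i / t n i - 1))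
      =o[atTop] fun n : ℕ => √(n : ℝ) := by
    rcases hdesign with hd | hnest
    · exact isLittleO_drift_of_finrank_le (by simpa using hd) hv₀ hv₁0 hφ₀ hφ₁ hν hv hD
        (fun n k _ => (s n k).2) hxinj hN hC₀ hC₁ hK hpt hS₁
    · refine isLittleO_sum_of_nested (fun n i hi => ?_) hS₂
      have hxn : ∀ k < n, x (n + 1) k = x n k := fun k hk => by
        simp only [hx, (hnest n k hk).1]
      have h₀ : p (n + 1) i = p n i := errVar_succ hi subset_rfl fun k hk l hl => by
        simp only [hC₀, hxn k hk, hxn l hl]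
      have h₁ : t (n + 1) i = t n i := by
        simp only [ht, (hnest n i hi).2]
        exact errVar_succ hi (hN n i hi) fun k hk l hl => by
          simp only [hC₁, hxn k hk, hxn l hl]
      rw [h₀, h₁]
  have hQpos : ∀ n, 0 < n → ∀ᵐ ω ∂P₀, 0 < vecchiaQuad (C₁ n) (N n) n (fun k => Y n k ω) :=
    fun n hn => (hG₀ n).vecchiaQuad_pos_ae (hPD₀ n) (hPD₁ n) hn (hN n)
  have hMLE : ∀ n, 1 ≤ n → ∀ᵐ ω ∂P₀, ∀ w,
      IsVecchiaMLE φ₁ ν (x n) (N n) n (fun k => Y n k ω) w ↔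
        w = v₁ * (vecchiaQuad (C₁ n) (N n) n (fun k => Y n k ω) / n) := fun n hn => by
    filter_upwards [hQpos n hn] with ω hω w
    exact isVecchiaMLE_iff hv₁0 hn (hPD₁ n) (hN n) hω w
  refine ⟨fun n hn => ?_, fun σhat hσ => ?_⟩
  · filter_upwards [hMLE n hn] with ω hω
    exact ⟨_, (hω _).2 rfl, fun w hw => (hω w).1 hw⟩
  · have hbound := isLittleO_rowBound (fun n i hi => (div_pos (hp0 n i hi) (ht0 n i hi)).le)
      (fun n i hi => (div_le_iff₀ (ht0 n i hi)).2 (hpt n i hi))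
      (fun n i hi => div_nonneg ((hPD₀ n).covForm_self_nonneg (δ n i)) (ht0 n i hi).le)
      hS₁ hS₂ hdrift
    refine tendstoInDistribution_of_ae_eq_quad
      (Q := fun n ω => vecchiaQuad (C₁ n) (N n) n fun k => Y n k ω)
      (Z := fun n i ω => linVal n (stdErrCoef (C₀ n) n i) fun k => Y n k ω) (v₀ * φ₀ ^ (2 * ν))
      (fun n i => (hG₀ n).measurable_linVal n _) (fun n => (hG₀ n).map_stdErr_eq_pi (hPD₀ n))
      (fun n => (hG₀ n).measurable_vecchiaQuad _ _ n) (fun n => ?_)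
      (fun n => (hG₀ n).integral_abs_vecchiaQuad_sub_le (hPD₀ n) (hPD₁ n) (hN n)) hbound
      fun n => ?_
    · exact (integrable_finsetSum _ fun i _ =>
        (((hG₀ n).memLp_linVal n _).integrable_sq).div_const _).sub
        (integrable_finsetSum _ fun i _ => ((hG₀ n).memLp_linVal n _).integrable_sq)
    -- Nothing is assumed about the estimator at n = 0, but there both sides vanish because √0 = 0.
    -- For n ≥ 1 the identity is σ₁² φ₁^(2ν) Q/n - κ = κ (Q - n)/n.
    · rcases Nat.eq_zero_or_pos n with rfl | hn
      · exact Eventually.of_forall fun ω => by simp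
      · filter_upwards [hMLE n hn, hσ n hn] with ω hω hω'
        have hn' : (0 : ℝ) < n := Nat.cast_pos.2 hn
        rw [(hω _).1 hω', mul_right_comm, hv]
        set κ := v₀ * φ₀ ^ (2 * ν)
        set q := vecchiaQuad (C₁ n) (N n) n fun k => Y n k ω
        have e : κ * (q / n) - κ = κ * (q - n) / n := by field_simp
        rw [e, mul_comm, div_mul_eq_mul_div, mul_div_assoc, Real.sqrt_div_self, mul_assoc,
          mul_comm (q - n)]
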